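/- Let $\Delta$ be the set of nonincreasing sequences $x=(x_1\ge x_2\ge\dots\ge 0)$ with $\sum_i x_i=1$, with the topology and Borel $\sigma$-algebra inherited from $\mathbb R^{\mathbb N}$. Any countable family of nonnegative numbers with sum $1$ is identified with the element of $\Delta$ obtained by sorting it in nonincreasing order (padded with zeros if it is finite). For $\rho$ one of the metrics $L^\infty$, $\rho(x,y)=\sup_i|x_i-y_i|$, or $L^1$, $\rho(x,y)=\sum_i|x_i-y_i|$, on $\Delta$ and random elements $X,Y$ of $\Delta$ with laws $\mu,\nu$, let $$d_\rho(X,Y)=\sup\Big\{\int_\Delta f\,d(\mu-\nu): f \text{ continuous},\ \mathrm{Lip}_\rho(f)\le 1\Big\}=\inf\ \mathbb E\,\rho(X',Y')$$ be the Wasserstein distance, the infimum being over all couplings $(X',Y')$ of $\mu$ and $\nu$. (The bounds below hold with either of the two expressions as definition.) **Theorem 1.1 (Square cutting).** There is exactly one law on $\Delta$ of a random partition $\Sigma$ with $$\Sigma=(U,(1-U)\Sigma)\quad\text{in distribution},$$ where $U$ is uniform on $[0,1]$ and independent of $\Sigma$ (the Poisson–Dirichlet law), and there is exactly one law on $\Delta$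 of a random partition $\mathcal P$ with $$\mathcal P=(\tilde U\Sigma,(1-\tilde U)\mathcal P)\quad\text{in distribution},$$ where $\tilde U$ is uniform on $[0,1]$ and $\tilde U,\Sigma,\mathcal P$ are independent. For integers $k,n\ge1$ let $\pi$ be uniform in the wreath product $S_k^n\rtimes S_n$, acting on $kn$ points by permuting $n$ blocks of size $k$ and permuting the points within each block, let $C_1,C_2,\dots$ be the lengths of the cycles of $\pi$ on these $kn$ points (fixed points included), and let $C=\big(\frac{C_1}{kn},\frac{C_2}{kn},\dots\big)$. Then for all $k,n\ge1$ $$d_{L^\infty}(C,\mathcal P)\le\frac1k+\frac1n$$ and $$\frac{\log^2(kn)}{8kn}\le d_{L^1}(C,\mathcal P)\le\frac{3(\log k+\gamma)}{k}+\frac{3(\log n+\gamma)}{n}+O\Big(\frac1{k^2}+\frac1{n^2}\Big),$$ where $\gamma$ is the Euler–Mascheroni constant, and the implied constant is universal (it does not depend on $k$ and $n$). -/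

import Mathlib

open MeasureTheory

noncomputable section

namespace SquareCutting

/-- Partitions of unity indexed by `ι`: families of nonnegative reals with sum `1`.
For `ι = ℕ` this is the infinite simplex of (not necessarily sorted) partitions. -/
abbrev Simplex (ι : Type*) : Type _ :=
  {x : ι → ℝ // (∀ i, 0 ≤ x i) ∧ HasSum x 1}

/-- The space `Δ` of nonincreasing partitions of unity `x 0 ≥ x 1 ≥ ⋯ ≥ 0`, `∑ x i = 1`,
with the topology and the Borel σ-algebra inherited from `ℝ^ℕ`. -/
abbrev Delta : Type :=
  {x : ℕ → ℝ // ((∀ i, 0 ≤ x i) ∧ HasSum x 1) ∧ Antitone x}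

/-- The `j`-th largest entry (counting from `j = 0`, with multiplicity) of a family: the supremum
over all sets of `j + 1` indices of the smallest entry on the set; it is `0` if there are fewer than
`j + 1` indices. -/
def rankEntry {ι : Type*} (x : ι → ℝ) (j : ℕ) : ℝ :=
  ⨆ s : {s : Finset ι // s.card = j + 1}, ⨅ i : s.1, x i

theorem Simplex.le_one {ι : Type*} (x : Simplex ι) (i : ι) : x.1 i ≤ 1 :=
  le_hasSum x.2.2 i fun j _ => x.2.1 j

theorem Simplex.bddAbove {ι : Type*} (x : Simplex ι) (j : ℕ) :
    BddAbove (Set.range fun s : {s : Finset ι // s.card = j + 1} => ⨅ i : s.1, x.1 i) := by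
  refine ⟨1, ?_⟩
  rintro _ ⟨s, rfl⟩
  obtain ⟨i, hi⟩ : s.1.Nonempty := Finset.card_pos.1 (by have := s.2; omega)
  exact (ciInf_le (Set.finite_range _).bddBelow (⟨i, hi⟩ : s.1)).trans (x.le_one i)

theorem Simplex.lt_rankEntry_iff {ι : Type*} (x : Simplex ι) (j : ℕ) {t : ℝ} (ht : 0 ≤ t) :
    t < rankEntry x.1 j ↔ ∃ s : Finset ι, s.card = j + 1 ∧ ∀ i ∈ s, t < x.1 i := by
  constructor
  · intro h
    rcases isEmpty_or_nonempty {s : Finset ι // s.card = j + 1} with he | hne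
    · rw [rankEntry, Real.iSup_of_isEmpty] at h
      exact absurd h (not_lt.2 ht)
    · obtain ⟨s, hs⟩ := exists_lt_of_lt_ciSup h
      exact ⟨s.1, s.2, fun i hi =>
        hs.trans_le (ciInf_le (Set.finite_range _).bddBelow (⟨i, hi⟩ : s.1))⟩
  · rintro ⟨s, hs, hlt⟩
    have hne : Nonempty s := (Finset.card_pos.1 (by omega)).to_subtype
    refine lt_of_lt_of_le ?_ (le_ciSup (x.bddAbove j) ⟨s, hs⟩)
    obtain ⟨i, hi⟩ := exists_eq_ciInf_of_finite (f := fun i : s => x.1 i)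
    change t < ⨅ i : s, x.1 i
    rw [← hi]
    exact hlt i i.2

theorem Simplex.rankEntry_nonneg {ι : Type*} (x : Simplex ι) (j : ℕ) : 0 ≤ rankEntry x.1 j :=
  Real.iSup_nonneg fun _ => Real.iInf_nonneg fun i => x.2.1 i

theorem Simplex.rankEntry_antitone {ι : Type*} (x : Simplex ι) : Antitone (rankEntry x.1) := by
  intro a b hab
  refine le_of_forall_lt_imp_le_of_dense fun t ht => ?_
  rcases lt_or_ge t 0 with h0 | h0
  · exact h0.le.trans (x.rankEntry_nonneg a)
  · obtain ⟨s, hs, hlt⟩ := (x.lt_rankEntry_iff b h0).1 ht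
    obtain ⟨r, hr, hrc⟩ := Finset.exists_subset_card_eq (s := s) (n := a + 1) (by omega)
    exact ((x.lt_rankEntry_iff a h0).2 ⟨r, hrc, fun i hi => hlt i (hr hi)⟩).le

theorem Simplex.encard_rankEntry {ι : Type*} (x : Simplex ι) {t : ℝ} (ht : 0 ≤ t) :
    {j | t < rankEntry x.1 j}.encard = {i | t < x.1 i}.encard := by
  have key : ∀ j : ℕ, t < rankEntry x.1 j ↔ ((j + 1 : ℕ) : ℕ∞) ≤ {i | t < x.1 i}.encard := by
    intro j
    rw [x.lt_rankEntry_iff j ht]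
    constructor
    · rintro ⟨s, hs, hlt⟩
      rw [← hs, ← Set.encard_coe_eq_coe_finsetCard]
      exact Set.encard_le_encard fun i hi => hlt i hi
    · intro h
      obtain ⟨r, hr, hrc⟩ := Set.exists_subset_encard_eq h
      have hf : r.Finite := Set.finite_of_encard_eq_coe hrc
      refine ⟨hf.toFinset, ?_, fun i hi => hr (hf.mem_toFinset.1 hi)⟩
      rw [hf.encard_eq_coe_toFinset_card] at hrc
      exact_mod_cast hrc
  rcases eq_or_ne {i | t < x.1 i}.encard ⊤ with htop | hne
  · have : {j | t < rankEntry x.1 j} = Set.univ := by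
      ext j; simp [key, htop]
    rw [this, htop, Set.encard_univ, ENat.card_eq_top_of_infinite]
  · obtain ⟨m, hm⟩ := ENat.ne_top_iff_exists.1 hne
    have : {j | t < rankEntry x.1 j} = (Finset.range m : Set ℕ) := by
      ext j
      simp only [Set.mem_ofPred_eq, key, ← hm, Nat.cast_le, Finset.coe_range, Set.mem_Iio]
      omega
    rw [this, Set.encard_coe_eq_coe_finsetCard, ← hm, Finset.card_range]

theorem Simplex.hasSum_rankEntry {ι : Type*} (x : Simplex ι) :
    HasSum (rankEntry x.1) 1 := by
  let _ : MeasurableSpace ι := ⊤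
  have layer : ∀ {α : Type _} [MeasurableSpace α] [MeasurableSingletonClass α]
      (f : α → ℝ), Measurable f → (∀ a, 0 ≤ f a) →
      ∑' a, ENNReal.ofReal (f a) =
        ∫⁻ t in Set.Ioi (0 : ℝ), Measure.count {a | t < f a} := by
    intro α _ _ f hm h0
    rw [← lintegral_count]
    exact lintegral_eq_lintegral_meas_lt _ (Filter.Eventually.of_forall h0) hm.aemeasurable
  have layer' : ∀ {α : Type} [MeasurableSpace α] [MeasurableSingletonClass α]
      (f : α → ℝ), Measurable f → (∀ a, 0 ≤ f a) →
      ∑' a, ENNReal.ofReal (f a) =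
        ∫⁻ t in Set.Ioi (0 : ℝ), Measure.count {a | t < f a} := by
    intro α _ _ f hm h0
    rw [← lintegral_count]
    exact lintegral_eq_lintegral_meas_lt _ (Filter.Eventually.of_forall h0) hm.aemeasurable
  have h1 := layer x.1 measurable_from_top x.2.1
  have h2 := layer' (rankEntry x.1) measurable_from_top x.rankEntry_nonneg
  have h3 : ∑' j, ENNReal.ofReal (rankEntry x.1 j) = 1 := by
    rw [h2]
    calc
      _ = ∫⁻ t in Set.Ioi (0 : ℝ), Measure.count {a | t < x.1 a} := by
        refine setLIntegral_congr_fun measurableSet_Ioi fun t ht => ?_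
        simp only [Measure.count_apply MeasurableSpace.measurableSet_top,
          x.encard_rankEntry (le_of_lt ht)]
      _ = 1 := by
        rw [← h1, ← ENNReal.ofReal_tsum_of_nonneg x.2.1 x.2.2.summable, x.2.2.tsum_eq,
          ENNReal.ofReal_one]
  have h4 := (ENNReal.summable (f := fun j => ENNReal.ofReal (rankEntry x.1 j))).hasSum
  rw [h3] at h4
  have h5 := ENNReal.hasSum_toReal (f := fun j => ENNReal.ofReal (rankEntry x.1 j)) (by simp [h3])
  rw [← ENNReal.tsum_toReal_eq (by simp), h3] at h5
  simpa [ENNReal.toReal_ofReal, x.rankEntry_nonneg] using h5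

/-- The projection onto `Δ` that sorts a partition of unity in nonincreasing order. -/
def sort {ι : Type*} (x : Simplex ι) : Delta :=
  ⟨rankEntry x.1, ⟨x.rankEntry_nonneg, x.hasSum_rankEntry⟩, x.rankEntry_antitone⟩

theorem measurable_sort {ι : Type*} [Countable ι] : Measurable (sort : Simplex ι → Delta) := by
  refine Measurable.subtype_mk (measurable_pi_lambda _ fun j => ?_)
  refine Measurable.iSup fun s => Measurable.iInf fun i => ?_
  exact (measurable_pi_apply _).comp measurable_subtype_coe

/-- The partition `(u a, (1 - u) b)` made of the parts `u a i` and the parts `(1 - u) b j`. -/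
def mix {ι κ : Type*} (u : unitInterval) (a : Simplex ι) (b : Simplex κ) : Simplex (ι ⊕ κ) :=
  ⟨Sum.elim (fun i => (u : ℝ) * a.1 i) (fun j => (1 - (u : ℝ)) * b.1 j), by
    constructor
    · rintro (i | j)
      · exact mul_nonneg u.2.1 (a.2.1 i)
      · exact mul_nonneg (sub_nonneg.2 u.2.2) (b.2.1 j)
    · have h1 := a.2.2.mul_left (u : ℝ)
      have h2 := b.2.2.mul_left (1 - (u : ℝ))
      have := HasSum.sum (f := Sum.elim (fun i => (u : ℝ) * a.1 i)
        (fun j => (1 - (u : ℝ)) * b.1 j)) h1 h2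
      simpa using this⟩

/-- The partition `(1)` with a single part. -/
def whole : Simplex Unit := ⟨fun _ => 1, fun _ => zero_le_one, by simp⟩

/-- A partition in `Δ`, regarded as a partition of unity. -/
def Delta.toSimplex (x : Delta) : Simplex ℕ := ⟨x.1, x.2.1⟩

/-- One step of stick breaking: `(u, x) ↦ (u, (1 - u) x)`, sorted. -/
def stickStep (p : unitInterval × Delta) : Delta :=
  sort (mix p.1 whole p.2.toSimplex)

/-- One step of square cutting: `(u, s, x) ↦ (u s, (1 - u) x)`, sorted. -/
def squareStep (p : unitInterval × Delta × Delta) : Delta :=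
  sort (mix p.1 p.2.1.toSimplex p.2.2.toSimplex)

theorem measurable_mix {ι κ : Type*} :
    Measurable fun p : unitInterval × Simplex ι × Simplex κ => mix p.1 p.2.1 p.2.2 := by
  refine Measurable.subtype_mk (measurable_pi_lambda _ fun j => ?_)
  have hu : Measurable fun p : unitInterval × Simplex ι × Simplex κ => (p.1 : ℝ) :=
    measurable_subtype_coe.comp measurable_fst
  rcases j with i | j
  · exact hu.mul ((measurable_pi_apply i).comp
      (measurable_subtype_coe.comp (measurable_fst.comp measurable_snd)))
  · exact (measurable_const.sub hu).mul ((measurable_pi_apply j).comp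
      (measurable_subtype_coe.comp (measurable_snd.comp measurable_snd)))

theorem measurable_toSimplex : Measurable Delta.toSimplex :=
  Measurable.subtype_mk measurable_subtype_coe

theorem measurable_stickStep : Measurable stickStep :=
  measurable_sort.comp <| measurable_mix.comp <| measurable_fst.prodMk <|
    measurable_const.prodMk (measurable_toSimplex.comp measurable_snd)

theorem measurable_squareStep : Measurable squareStep :=
  measurable_sort.comp <| measurable_mix.comp <| measurable_fst.prodMk <|
    (measurable_toSimplex.comp (measurable_fst.comp measurable_snd)).prodMk
      (measurable_toSimplex.comp (measurable_snd.comp measurable_snd))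

/-- `μ` is the law of a random partition `Σ` with `Σ = (U, (1 - U) Σ)` in distribution, where `U` is
uniform on `[0, 1]` and independent of `Σ` (the Poisson–Dirichlet law). -/
def IsStickBreaking (μ : Measure Delta) : Prop :=
  IsProbabilityMeasure μ ∧
    ((volume : Measure unitInterval).prod μ).map stickStep = μ

/-- `ν` is the law of a random partition `P` with `P = (U S, (1 - U) P)` in distribution, where `U`
is uniform on `[0, 1]`, `S` has law `μ`, and `U`, `S`, `P` are independent. -/
def IsSquareCutting (μ ν : Measure Delta) : Prop :=
  IsProbabilityMeasure ν ∧
    ((volume : Measure unitInterval).prod (μ.prod ν)).map squareStep = ν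

/-- The wreath product `S_k^n ⋊ S_n`, with `S_n` permuting the `n` coordinates. -/
abbrev Wreath (k n : ℕ) : Type :=
  (Fin n → Equiv.Perm (Fin k)) ⋊[mulAutArrow] Equiv.Perm (Fin n)

instance (k n : ℕ) : Fintype (Wreath k n) :=
  Fintype.ofEquiv _ SemidirectProduct.equivProd.symm

/-- The wreath product as a group of permutations of `n` blocks `{i} × Fin k` of size `k`: the
element `(g; h)` first moves block `i` to block `h i` and then permutes each block `j` by `g j`. -/
def Wreath.toPerm (k n : ℕ) : Wreath k n →* Equiv.Perm (Fin n × Fin k) where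
  toFun w :=
    { toFun := fun p => (w.right p.1, w.left (w.right p.1) p.2)
      invFun := fun p => (w.right⁻¹ p.1, (w.left p.1)⁻¹ p.2)
      left_inv := fun p => by simp
      right_inv := fun p => by simp }
  map_one' := by ext p <;> simp
  map_mul' v w := by
    ext p
    · simp [SemidirectProduct.mul_right]
    · have h : mulAutArrow v.right w.left (v.right (w.right p.1)) = w.left (w.right p.1) := by
        change w.left (v.right⁻¹ (v.right (w.right p.1))) = _
        simp
      change ((v.left (v.right (w.right p.1)) * mulAutArrow v.right w.left
        (v.right (w.right p.1))) p.2 : ℕ) = _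
      rw [h]
      rfl

/-- The cycle lengths of a permutation `σ` of a finite nonempty set (fixed points are cycles of
length `1`), divided by the size of the set; the cycles are the classes of `SameCycle`. -/
def cycleSimplex {α : Type*} [Finite α] [Nonempty α] (σ : Equiv.Perm α) :
    Simplex (Quotient (Equiv.Perm.SameCycle.setoid σ)) :=
  ⟨fun q => (Nat.card {a : α // Quotient.mk _ a = q} : ℝ) / Nat.card α, by
    refine ⟨fun q => by positivity, ?_⟩
    have := Fintype.ofFinite α
    have := Fintype.ofFinite (Quotient (Equiv.Perm.SameCycle.setoid σ))
    have h : ∑ q, Nat.card {a : α // Quotient.mk (Equiv.Perm.SameCycle.setoid σ) a = q}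
        = Nat.card α := by
      rw [← Nat.card_sigma]
      exact Nat.card_congr (Equiv.sigmaFiberEquiv _)
    have h0 : (Nat.card α : ℝ) ≠ 0 := Nat.cast_ne_zero.2 Nat.card_pos.ne'
    have hs := hasSum_fintype fun q : Quotient (Equiv.Perm.SameCycle.setoid σ) =>
      (Nat.card {a : α // Quotient.mk _ a = q} : ℝ) / Nat.card α
    rwa [← Finset.sum_div, ← Nat.cast_sum, h, div_self h0] at hs⟩

/-- The law on `Δ` of the cycle lengths, divided by `k n`, of a uniform random element of
`S_k^n ⋊ S_n`. -/
def cycleLaw (k n : ℕ) [NeZero k] [NeZero n] : Measure Delta :=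
  ((PMF.uniformOfFintype (Wreath k n)).map
    fun w => sort (cycleSimplex (Wreath.toPerm k n w))).toMeasure

/-- The `L^∞` distance on `Δ`. -/
def distSup (x y : Delta) : ℝ := ⨆ i, |x.1 i - y.1 i|

/-- The `L^1` distance on `Δ`. -/
def distOne (x y : Delta) : ℝ := ∑' i, |x.1 i - y.1 i|

/-- The transport (Wasserstein) distance for the metric `ρ`: infimum of `E ρ(X, Y)` over all
couplings of `μ` and `ν`. -/
def transportDist (ρ : Delta → Delta → ℝ) (μ ν : Measure Delta) : ℝ :=
  sInf {c | ∃ γ : Measure (Delta × Delta),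
    γ.map Prod.fst = μ ∧ γ.map Prod.snd = ν ∧ c = ∫ p, ρ p.1 p.2 ∂γ}

/-- The dual form of the Wasserstein distance for the metric `ρ`: supremum of `∫ f d(μ - ν)` over
all continuous `f` that are `1`-Lipschitz for `ρ`. -/
def dualDist (ρ : Delta → Delta → ℝ) (μ ν : Measure Delta) : ℝ :=
  sSup {c | ∃ f : Delta → ℝ, Continuous f ∧ (∀ x y, |f x - f y| ≤ ρ x y) ∧
    c = ∫ x, f x ∂μ - ∫ x, f x ∂ν}

end SquareCutting

end

/-!
Poisson–Dirichlet partitions, square cutting and cycles of the wreath product.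

All partitions are built on one probability space from independent uniform breaks `u₀, u₁, …`. After
`j` breaks a stick of length `rⱼ = ∏_{i<j} (1 - uᵢ)` remains, and the `j`-th piece has length
`uⱼ rⱼ`. If the `j`-th piece is in turn cut by an independent partition of law `Q`, the result
`limitPartition` satisfies the distributional equation of `IsSquareCutting Q`
(`isSquareCutting_map_limitPartition`); the Poisson–Dirichlet equation is the case in which `Q` is
the point mass at the partition with one part (`isStickBreaking_iff`). Solutions are unique because
one step of cutting contracts the `L¹` distance by the factor `1 - u`, of mean `1 / 2`
(`IsSquareCutting.unique`).

The cycles of a wreath product element have a discrete version of this structure. The cycle of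
blocks of a marked block leaves out `i` blocks with `i` uniform in `{0, …, n - 1}`, the return map to
the marked block is a uniform permutation of its points, and the other blocks carry an independent
uniform element of the wreath product of degree `i` (`markedMean_fin`, proved by inserting a block
into a cycle). A stick of `n` units whose remaining length `n rⱼ` is rounded down to `⌊n rⱼ⌋` also
loses a uniform part of its units at each break that removes any, so that the same breaks `uⱼ`
produce the cycle law (`discretePartition`, `map_discretePartition`, `map_wreathPartition`).
This applies twice, to the blocks and to the points of a block, and it couples the cycle law with
the square-cutting law (`squareCoupling`).

In this coupling each piece is off by at most `1 / n`, and sorting does not increase the `L^∞` nor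
the `L¹` distance, which gives the `L^∞` bound (`distSup_discretePartition_le`). For the `L¹` bound,
the total error is at most `2 / n` times the number of breaks at which `⌊n rⱼ⌋` changes, whose mean
is at most the harmonic number `Hₙ` (`lintegral_distOne_discretePartition_le`). For the lower bound,
the function `∑ᵢ dist(M xᵢ, ℤ) / M` with `M = k n` is `1`-Lipschitz for the `L¹` distance and
vanishes on cycle lengths, while its mean under the square-cutting law is at least `log² M / (8 M)`
(`log_sq_le_lintegral_squarePartition`). Finitely many terms of this sum give a continuous test
function for the dual form of the distance.
-/

open MeasureTheory

noncomputable section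

namespace SquareCutting

open scoped ENNReal

/-! ### Sorting and counting parts -/

/-- The number of entries of the family `x` that exceed `t`, in `[0, ∞]`. -/
def partCount {ι : Type*} (x : ι → ℝ) (t : ℝ) : ℝ≥0∞ := ∑' i, if t < x i then 1 else 0

theorem partCount_eq_encard {ι : Type*} (x : ι → ℝ) (t : ℝ) :
    partCount x t = ({i | t < x i}.encard : ℝ≥0∞) := by
  rw [← ENNReal.tsum_set_one, partCount, tsum_subtype {i | t < x i} (fun _ => (1 : ℝ≥0∞))]
  rfl

theorem Simplex.partCount_sort {ι : Type*} (x : Simplex ι) {t : ℝ} (ht : 0 ≤ t) :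
    partCount (sort x).1 t = partCount x.1 t := by
  rw [partCount_eq_encard, partCount_eq_encard]
  exact congrArg _ (x.encard_rankEntry ht)

theorem Simplex.lt_rankEntry_iff_le_partCount {ι : Type*} (x : Simplex ι) (j : ℕ) {t : ℝ}
    (ht : 0 ≤ t) : t < rankEntry x.1 j ↔ ((j + 1 : ℕ) : ℝ≥0∞) ≤ partCount x.1 t := by
  rw [x.lt_rankEntry_iff j ht, partCount_eq_encard, ← ENat.toENNReal_coe, ENat.toENNReal_le]
  constructor
  · rintro ⟨s, hs, hlt⟩
    rw [← hs, ← Set.encard_coe_eq_coe_finsetCard]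
    exact Set.encard_le_encard fun i hi => hlt i hi
  · intro h
    obtain ⟨r, hr, hrc⟩ := Set.exists_subset_encard_eq h
    have hf : r.Finite := Set.finite_of_encard_eq_coe hrc
    refine ⟨hf.toFinset, ?_, fun i hi => hr (hf.mem_toFinset.1 hi)⟩
    rw [hf.encard_eq_coe_toFinset_card] at hrc
    exact_mod_cast hrc

theorem eq_of_forall_nonneg_lt_iff {a b : ℝ} (ha : 0 ≤ a) (hb : 0 ≤ b)
    (h : ∀ t, 0 ≤ t → (t < a ↔ t < b)) : a = b := by
  rcases lt_trichotomy a b with hab | hab | hab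
  · exact absurd ((h a ha).2 hab) (lt_irrefl _)
  · exact hab
  · exact absurd ((h b hb).1 hab) (lt_irrefl _)

/-- Sorting only depends on the counting function of the parts. -/
theorem sort_eq_sort {ι κ : Type*} {x : Simplex ι} {y : Simplex κ}
    (h : ∀ t, 0 ≤ t → partCount x.1 t = partCount y.1 t) : sort x = sort y := by
  refine Subtype.ext (funext fun j => ?_)
  refine eq_of_forall_nonneg_lt_iff (x.rankEntry_nonneg j) (y.rankEntry_nonneg j) fun t ht => ?_
  change t < rankEntry x.1 j ↔ t < rankEntry y.1 j
  rw [x.lt_rankEntry_iff_le_partCount j ht, y.lt_rankEntry_iff_le_partCount j ht, h t ht]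

theorem sort_toSimplex (z : Delta) : sort z.toSimplex = z := by
  refine Subtype.ext (funext fun j => ?_)
  refine eq_of_forall_nonneg_lt_iff (z.toSimplex.rankEntry_nonneg j) (z.2.1.1 j) fun t ht => ?_
  change t < rankEntry z.toSimplex.1 j ↔ t < z.1 j
  rw [z.toSimplex.lt_rankEntry_iff j ht]
  constructor
  · rintro ⟨s, hs, hlt⟩
    obtain ⟨i, hi, hji⟩ : ∃ i ∈ s, j ≤ i := by
      by_contra! hcon
      have : s ⊆ Finset.range j := fun i hi => Finset.mem_range.2 (hcon i hi)
      have := Finset.card_le_card this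
      rw [Finset.card_range] at this
      omega
    exact (hlt i hi).trans_le (z.2.2 hji)
  · intro h
    refine ⟨Finset.range (j + 1), Finset.card_range _, fun i hi => h.trans_le (z.2.2 ?_)⟩
    exact Nat.lt_succ_iff.1 (Finset.mem_range.1 hi)

theorem Delta.ext_partCount {z w : Delta}
    (h : ∀ t, 0 ≤ t → partCount z.1 t = partCount w.1 t) : z = w := by
  rw [← sort_toSimplex z, ← sort_toSimplex w]
  exact sort_eq_sort h

theorem partCount_const_mul {ι : Type*} (x : ι → ℝ) {c : ℝ} (hc : 0 < c) (t : ℝ) :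
    partCount (fun i => c * x i) t = partCount x (t / c) := by
  simp only [partCount, div_lt_iff₀' hc]

theorem partCount_of_le_zero {ι : Type*} {x : ι → ℝ} (hx : ∀ i, x i ≤ 0) {t : ℝ} (ht : 0 ≤ t) :
    partCount x t = 0 := by
  simp [partCount, fun i => not_lt.2 ((hx i).trans ht)]

theorem partCount_const_mul_congr {ι κ : Type*} {x : ι → ℝ} {y : κ → ℝ}
    (h : ∀ t, 0 ≤ t → partCount x t = partCount y t) {c : ℝ} (hc : 0 ≤ c) {t : ℝ} (ht : 0 ≤ t) :
    partCount (fun i => c * x i) t = partCount (fun i => c * y i) t := by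
  rcases hc.eq_or_lt with rfl | hc
  · rw [partCount_of_le_zero (by simp) ht, partCount_of_le_zero (by simp) ht]
  · rw [partCount_const_mul x hc, partCount_const_mul y hc, h _ (by positivity)]

theorem partCount_sumElim {ι κ : Type*} (x : ι → ℝ) (y : κ → ℝ) (t : ℝ) :
    partCount (Sum.elim x y) t = partCount x t + partCount y t :=
  Summable.tsum_sum (f := fun i : ι ⊕ κ => if t < Sum.elim x y i then (1 : ℝ≥0∞) else 0)
    ENNReal.summable ENNReal.summable

theorem partCount_squareStep (u : unitInterval) (a b : Delta) {t : ℝ} (ht : 0 ≤ t) :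
    partCount (squareStep (u, a, b)).1 t =
      partCount (fun i => (u : ℝ) * a.1 i) t + partCount (fun i => (1 - (u : ℝ)) * b.1 i) t := by
  rw [squareStep, Simplex.partCount_sort _ ht]
  exact partCount_sumElim _ _ t

theorem partCount_sort_whole {t : ℝ} (ht : 0 ≤ t) :
    partCount (sort whole).1 t = if t < 1 then 1 else 0 := by
  rw [Simplex.partCount_sort _ ht, partCount, tsum_fintype]
  by_cases h : t < 1 <;> simp [whole, h]

/-- Stick breaking is square cutting in which the cut-off piece is kept whole. -/
theorem stickStep_eq_squareStep (u : unitInterval) (x : Delta) :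
    stickStep (u, x) = squareStep (u, sort whole, x) := by
  refine Delta.ext_partCount fun t ht => ?_
  rw [partCount_squareStep _ _ _ ht, stickStep, Simplex.partCount_sort _ ht]
  refine (partCount_sumElim _ _ t).trans ?_
  congr 1
  exact partCount_const_mul_congr (fun t ht => (Simplex.partCount_sort whole ht).symm) u.2.1 ht

theorem Delta.le_one (z : Delta) (i : ℕ) : z.1 i ≤ 1 := z.toSimplex.le_one i

theorem Simplex.rankEntry_sub_le {ι : Type*} (x y : Simplex ι) {δ : ℝ} (hδ : 0 ≤ δ)
    (h : ∀ i, x.1 i - y.1 i ≤ δ) (j : ℕ) : rankEntry x.1 j - rankEntry y.1 j ≤ δ := by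
  rw [sub_le_iff_le_add']
  refine le_of_forall_lt_imp_le_of_dense fun t ht => ?_
  rcases lt_or_ge (t - δ) 0 with h0 | h0
  · have := y.rankEntry_nonneg j
    linarith
  · obtain ⟨s, hs, hlt⟩ := (x.lt_rankEntry_iff j (by linarith)).1 ht
    have := (y.lt_rankEntry_iff j h0).2 ⟨s, hs, fun i hi => by linarith [h i, hlt i hi]⟩
    linarith

/-- Sorting does not increase the supremum distance. -/
theorem distSup_sort_le {ι : Type*} (x y : Simplex ι) {δ : ℝ} (hδ : 0 ≤ δ)
    (h : ∀ i, |x.1 i - y.1 i| ≤ δ) : distSup (sort x) (sort y) ≤ δ := by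
  refine ciSup_le fun j => abs_sub_le_iff.2 ⟨?_, ?_⟩
  · exact x.rankEntry_sub_le y hδ (fun i => (le_abs_self _).trans (h i)) j
  · refine y.rankEntry_sub_le x hδ (fun i => ?_) j
    exact (le_abs_self _).trans ((abs_sub_comm _ _).trans_le (h i))

theorem Simplex.summable_abs_sub {ι : Type*} (x y : Simplex ι) :
    Summable fun i => |x.1 i - y.1 i| := by
  refine Summable.of_nonneg_of_le (fun _ => abs_nonneg _) (fun i => ?_)
    (x.2.2.summable.add y.2.2.summable)
  rw [abs_sub_le_iff]
  constructor <;> linarith [x.2.1 i, y.2.1 i]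

theorem abs_sub_eq_two_mul_max (a b : ℝ) : |a - b| = 2 * max a b - a - b := by
  rcases le_total a b with h | h
  · rw [max_eq_right h, abs_of_nonpos (by linarith)]; ring
  · rw [max_eq_left h, abs_of_nonneg (by linarith)]; ring

theorem Simplex.rankEntry_le_mul {ι : Type*} (x z : Simplex ι) {S : ℝ} (hS : 0 < S)
    (h : ∀ i, x.1 i ≤ S * z.1 i) (j : ℕ) : rankEntry x.1 j ≤ S * rankEntry z.1 j := by
  refine le_of_forall_lt_imp_le_of_dense fun t ht => ?_
  rcases lt_or_ge t 0 with h0 | h0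
  · exact h0.le.trans (mul_nonneg hS.le (z.rankEntry_nonneg j))
  · obtain ⟨s, hs, hlt⟩ := (x.lt_rankEntry_iff j h0).1 ht
    have := (z.lt_rankEntry_iff j (div_nonneg h0 hS.le)).2
      ⟨s, hs, fun i hi => (div_lt_iff₀' hS).2 ((hlt i hi).trans_le (h i))⟩
    exact ((div_lt_iff₀' hS).1 this).le

/-- Sorting does not increase the `L¹` distance: since `|a - b| = 2 max a b - a - b`, it suffices
that the entrywise maximum of two sorted families is dominated by the sorted entrywise maximum,
which has the same sum as the unsorted one. -/
theorem distOne_sort_le {ι : Type*} (x y : Simplex ι) :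
    distOne (sort x) (sort y) ≤ ∑' i, |x.1 i - y.1 i| := by
  have hmax : Summable fun i => max (x.1 i) (y.1 i) :=
    Summable.of_nonneg_of_le (fun i => le_max_of_le_left (x.2.1 i))
      (fun i => max_le (by linarith [y.2.1 i]) (by linarith [x.2.1 i]))
      (x.2.2.summable.add y.2.2.summable)
  set S := ∑' i, max (x.1 i) (y.1 i) with hSdef
  have hS1 : 1 ≤ S := by
    rw [← x.2.2.tsum_eq]
    exact x.2.2.summable.tsum_le_tsum (fun i => le_max_left _ _) hmax
  have hS : 0 < S := by linarith
  let z : Simplex ι := ⟨fun i => max (x.1 i) (y.1 i) / S,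
    fun i => div_nonneg (le_max_of_le_left (x.2.1 i)) hS.le, by
      have := hmax.hasSum.div_const S
      rwa [← hSdef, div_self hS.ne'] at this⟩
  have hz : ∀ i, S * z.1 i = max (x.1 i) (y.1 i) := fun i => mul_div_cancel₀ _ hS.ne'
  have hx := x.rankEntry_le_mul z hS fun i => (le_max_left _ _).trans (hz i).ge
  have hy := y.rankEntry_le_mul z hS fun i => (le_max_right _ _).trans (hz i).ge
  have h1 : HasSum (fun i => 2 * max (x.1 i) (y.1 i) - x.1 i - y.1 i) (2 * S - 1 - 1) :=
    ((hmax.hasSum.mul_left 2).sub x.2.2).sub y.2.2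
  have h2 : HasSum (fun j => 2 * (S * rankEntry z.1 j) - rankEntry x.1 j - rankEntry y.1 j)
      (2 * (S * 1) - 1 - 1) :=
    (((z.hasSum_rankEntry.mul_left S).mul_left 2).sub x.hasSum_rankEntry).sub y.hasSum_rankEntry
  have h3 : ∑' i, |x.1 i - y.1 i| = 2 * S - 1 - 1 := by
    simp_rw [abs_sub_eq_two_mul_max]
    exact h1.tsum_eq
  rw [h3, ← mul_one S, ← h2.tsum_eq]
  refine Summable.tsum_le_tsum (fun j => ?_)
    ((sort x).toSimplex.summable_abs_sub (sort y).toSimplex) h2.summable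
  change |rankEntry x.1 j - rankEntry y.1 j| ≤ _
  rw [abs_sub_eq_two_mul_max]
  linarith [max_le (hx j) (hy j)]

theorem Simplex.finite_setOf_lt {ι : Type*} (x : Simplex ι) {c : ℝ} (hc : 0 < c) :
    {i | c < x.1 i}.Finite := by
  have := x.2.2.summable.tendsto_cofinite_zero.eventually (gt_mem_nhds hc)
  exact (Filter.eventually_cofinite.1 this).subset fun i hi => not_lt.2 (le_of_lt hi)

theorem Simplex.encard_fiber_rankEntry {ι : Type*} (x : Simplex ι) {c : ℝ} (hc : 0 < c) :
    {j | rankEntry x.1 j = c}.encard = {i | x.1 i = c}.encard := by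
  have hfin' := (sort x).toSimplex.finite_setOf_lt (half_pos hc)
  have hfinx := x.finite_setOf_lt (half_pos hc)
  -- Between `c / 2` and `c` only finitely many values occur, so `{c ≤ ·}` is `{t < ·}` for a `t`.
  obtain ⟨t, ht, htc, htx, htr⟩ : ∃ t, 0 ≤ t ∧ t < c ∧ (∀ i, t < x.1 i ↔ c ≤ x.1 i) ∧
      ∀ j, t < rankEntry x.1 j ↔ c ≤ rankEntry x.1 j := by
    let A : Set ℝ := insert (c / 2) ((x.1 '' {i | c / 2 < x.1 i} ∪
      rankEntry x.1 '' {j | c / 2 < rankEntry x.1 j}) ∩ Set.Iio c)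
    have hA : A.Finite :=
      ((((hfinx.image _).union (hfin'.image _))).inter_of_left _).insert _
    obtain ⟨m, hmA, hm⟩ := hA.exists_maximalFor id A ⟨c / 2, Set.mem_insert _ _⟩
    have hmc : m < c := by
      rcases hmA with rfl | h
      · linarith
      · exact h.2
    have hcm : c / 2 ≤ m := not_lt.1 fun h => absurd (hm (Set.mem_insert _ _) h.le) (not_le.2 h)
    have key : ∀ v, v ∈ A → v ≤ m := fun v hv => not_lt.1 fun h =>
      absurd (hm hv h.le) (not_le.2 h)
    refine ⟨m, by linarith, hmc, fun i => ⟨fun h => ?_, fun h => hmc.trans_le h⟩,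
      fun i => ⟨fun h => ?_, fun h => hmc.trans_le h⟩⟩
    · by_contra! hlt
      exact absurd (key _ (Or.inr ⟨Or.inl ⟨i, lt_of_le_of_lt hcm h, rfl⟩, hlt⟩)) (not_le.2 h)
    · by_contra! hlt
      exact absurd (key _ (Or.inr ⟨Or.inr ⟨i, lt_of_le_of_lt hcm h, rfl⟩, hlt⟩)) (not_le.2 h)
  have h1 := x.encard_rankEntry ht
  have h2 := x.encard_rankEntry hc.le
  have split : {i | t < x.1 i}.encard = {i | x.1 i = c}.encard + {i | c < x.1 i}.encard := by
    rw [← Set.encard_union_eq]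
    · congr 1
      ext i
      change t < x.1 i ↔ x.1 i = c ∨ c < x.1 i
      rw [htx i, le_iff_eq_or_lt, eq_comm]
    · exact Set.disjoint_left.2 fun i (hi : x.1 i = c) (hi' : c < x.1 i) => hi'.ne' hi
  have split' : {i | t < rankEntry x.1 i}.encard =
      {i | rankEntry x.1 i = c}.encard + {i | c < rankEntry x.1 i}.encard := by
    rw [← Set.encard_union_eq]
    · congr 1
      ext i
      change t < rankEntry x.1 i ↔ rankEntry x.1 i = c ∨ c < rankEntry x.1 i
      rw [htr i, le_iff_eq_or_lt, eq_comm]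
    · exact Set.disjoint_left.2 fun i (hi : rankEntry x.1 i = c) (hi' : c < rankEntry x.1 i) =>
        hi'.ne' hi
  rw [split', split, h2] at h1
  have hne : {i | c < x.1 i}.encard ≠ ⊤ :=
    Set.encard_ne_top_iff.2 (hfinx.subset fun i (hi : c < x.1 i) =>
      show c / 2 < x.1 i by linarith)
  exact (ENat.add_left_injective_of_ne_top hne) h1

theorem tsum_comp_eq_tsum_encard_fiber {ι : Type*} (x : ι → ℝ) (g : ℝ → ℝ≥0∞) :
    ∑' i, g (x i) = ∑' c, ({i | x i = c}.encard : ℝ≥0∞) * g c := by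
  rw [← (Equiv.sigmaFiberEquiv x).tsum_eq, ENNReal.tsum_sigma']
  refine tsum_congr fun c => ?_
  rw [← ENNReal.tsum_set_one, ← ENNReal.tsum_mul_right]
  refine tsum_congr fun i => ?_
  rw [one_mul]
  exact congrArg g i.2

/-- A sum over the parts does not change under sorting. -/
theorem Simplex.tsum_comp_rankEntry {ι : Type*} (x : Simplex ι) {g : ℝ → ℝ≥0∞} (g0 : g 0 = 0) :
    ∑' j, g ((sort x).1 j) = ∑' i, g (x.1 i) := by
  rw [tsum_comp_eq_tsum_encard_fiber, tsum_comp_eq_tsum_encard_fiber]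
  refine tsum_congr fun c => ?_
  rcases lt_trichotomy c 0 with hc | rfl | hc
  · have h1 : {j | (sort x).1 j = c} = ∅ := Set.eq_empty_iff_forall_notMem.2
      fun j (hj : (sort x).1 j = c) => absurd ((sort x).2.1.1 j) (by rw [hj]; exact not_le.2 hc)
    have h2 : {j | x.1 j = c} = ∅ := Set.eq_empty_iff_forall_notMem.2
      fun j (hj : x.1 j = c) => absurd (x.2.1 j) (by rw [hj]; exact not_le.2 hc)
    rw [h1, h2]
    simp
  · simp [g0]
  · rw [← x.encard_fiber_rankEntry hc]
    rfl

/-- The families of nonnegative numbers with sum `1`. -/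
def IsSimplex {ι : Type*} (x : ι → ℝ) : Prop := (∀ i, 0 ≤ x i) ∧ HasSum x 1

open Classical in
/-- The sorted version of a family of nonnegative numbers with sum `1`; any other family is sent
to the trivial partition. This totalises `sort`, so that random families that are partitions of
unity only almost surely can be sorted. -/
def sortFamily {ι : Type*} (x : ι → ℝ) : Delta :=
  if h : IsSimplex x then sort ⟨x, h⟩ else sort whole

theorem sortFamily_of {ι : Type*} {x : ι → ℝ} (h : IsSimplex x) :
    sortFamily x = sort ⟨x, h⟩ := dif_pos h

theorem partCount_sortFamily {ι : Type*} {x : ι → ℝ} (h : IsSimplex x) {t : ℝ} (ht : 0 ≤ t) :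
    partCount (sortFamily x).1 t = partCount x t := by
  rw [sortFamily_of h, Simplex.partCount_sort _ ht]

theorem isSimplex_iff_tsum_ofReal {ι : Type*} {x : ι → ℝ} :
    IsSimplex x ↔ (∀ i, 0 ≤ x i) ∧ ∑' i, ENNReal.ofReal (x i) = 1 := by
  refine and_congr_right fun h0 => ⟨fun h => ?_, fun h => ?_⟩
  · rw [← ENNReal.ofReal_tsum_of_nonneg h0 h.summable, h.tsum_eq, ENNReal.ofReal_one]
  · have h1 := ENNReal.hasSum_toReal (f := fun j => ENNReal.ofReal (x j)) (by simp [h])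
    rw [← ENNReal.tsum_toReal_eq (by simp), h] at h1
    simpa [ENNReal.toReal_ofReal, h0] using h1

theorem measurable_sortFamily {ι : Type*} [Countable ι] :
    Measurable (sortFamily : (ι → ℝ) → Delta) := by
  classical
  have hs : MeasurableSet {x : ι → ℝ | IsSimplex x} := by
    simp only [isSimplex_iff_tsum_ofReal]
    have h1 : MeasurableSet {x : ι → ℝ | ∀ i, 0 ≤ x i} := by
      simp only [Set.ofPred_forall]
      exact MeasurableSet.iInter fun i => measurableSet_le measurable_const (measurable_pi_apply i)
    exact h1.inter (measurableSet_eq_fun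
      (Measurable.tsum fun i => (measurable_pi_apply i).ennreal_ofReal) measurable_const)
  exact Measurable.dite (s := {x : ι → ℝ | IsSimplex x}) (f := fun x => sort ⟨x.1, x.2⟩)
    (g := fun _ => sort whole) (measurable_sort (ι := ι)) measurable_const hs

/-! ### Integrals over the unit interval -/

theorem lintegral_unitInterval_mul {φ : ℝ → ℝ≥0∞} (hφ : Measurable φ) {x : ℝ} (hx : 0 < x) :
    ∫⁻ u : unitInterval, φ (x * u) = ENNReal.ofReal x⁻¹ * ∫⁻ y in Set.Ico 0 x, φ y := by
  have h1 : ∫⁻ u : unitInterval, φ (x * u) = ∫⁻ y in unitInterval, φ (x * y) :=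
    unitInterval.measurePreserving_coe.lintegral_comp (hφ.comp (measurable_const_mul x))
  rw [h1, unitInterval, ← setLIntegral_congr (Ico_ae_eq_Icc (a := (0 : ℝ)) (b := 1)),
    ← lintegral_indicator measurableSet_Ico, ← lintegral_indicator measurableSet_Ico]
  have h2 : ∀ y : ℝ, (Set.Ico (0 : ℝ) 1).indicator (fun y => φ (x * y)) y =
      (Set.Ico 0 x).indicator φ (x * y) := by
    intro y
    have : y ∈ Set.Ico (0 : ℝ) 1 ↔ x * y ∈ Set.Ico 0 x := by
      simp only [Set.mem_Ico, mul_nonneg_iff_of_pos_left hx, mul_lt_iff_lt_one_right hx]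
    by_cases h : y ∈ Set.Ico (0 : ℝ) 1
    · rw [Set.indicator_of_mem h, Set.indicator_of_mem (this.1 h)]
    · rw [Set.indicator_of_notMem h, Set.indicator_of_notMem (fun h' => h (this.2 h'))]
  simp_rw [h2]
  rw [← lintegral_map (hφ.indicator measurableSet_Ico) (measurable_const_mul x),
    Real.map_volume_mul_left hx.ne', lintegral_smul_measure, abs_of_pos (inv_pos.2 hx)]
  rfl

theorem lintegral_unitInterval_symm {f : unitInterval → ℝ≥0∞} (hf : Measurable f) :
    ∫⁻ u, f (unitInterval.symm u) = ∫⁻ u, f u :=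
  unitInterval.measurePreserving_symm.lintegral_comp hf

theorem lintegral_unitInterval_mul_symm {φ : ℝ → ℝ≥0∞} (hφ : Measurable φ) {x : ℝ} (hx : 0 < x) :
    ∫⁻ u : unitInterval, φ (x * (1 - u)) = ENNReal.ofReal x⁻¹ * ∫⁻ y in Set.Ico 0 x, φ y := by
  rw [← lintegral_unitInterval_mul hφ hx]
  exact lintegral_unitInterval_symm (f := fun u => φ (x * u))
    (hφ.comp (measurable_const.mul measurable_subtype_coe))

theorem setLIntegral_floor_Ico (G : ℕ → ℝ≥0∞) (m : ℕ) {a : ℝ} (h2 : a ≤ m + 1) :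
    ∫⁻ y in Set.Ico (m : ℝ) a, G ⌊y⌋₊ = ENNReal.ofReal (a - m) * G m := by
  have : ∫⁻ y in Set.Ico (m : ℝ) a, G ⌊y⌋₊ = ∫⁻ _ in Set.Ico (m : ℝ) a, G m := by
    refine setLIntegral_congr_fun measurableSet_Ico fun y hy => ?_
    have : ⌊y⌋₊ = m := (Nat.floor_eq_iff ((Nat.cast_nonneg m).trans hy.1)).2
      ⟨hy.1, hy.2.trans_le h2⟩
    simp only [this]
  rw [this, setLIntegral_const, Real.volume_Ico, mul_comm]

theorem setLIntegral_floor_natCast (G : ℕ → ℝ≥0∞) (m : ℕ) :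
    ∫⁻ y in Set.Ico 0 (m : ℝ), G ⌊y⌋₊ = ∑ i ∈ Finset.range m, G i := by
  induction m with
  | zero => simp
  | succ m ih =>
    have hu : Set.Ico (0 : ℝ) ((m + 1 : ℕ) : ℝ) = Set.Ico 0 (m : ℝ) ∪ Set.Ico (m : ℝ) (m + 1) := by
      rw [Set.Ico_union_Ico_eq_Ico (by positivity) (by linarith)]
      push_cast
      rfl
    rw [hu, lintegral_union measurableSet_Ico (Set.Ico_disjoint_Ico_same), ih,
      Finset.sum_range_succ, setLIntegral_floor_Ico G m le_rfl]
    simp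

/-- If `U` is uniform on `[0, 1]` and `m = ⌊x⌋`, then `⌊x (1 - U)⌋` takes each value `i < m` with
probability `1 / x` and the value `m` with the remaining probability `(x - m) / x`. -/
theorem lintegral_floor_mul_symm (G : ℕ → ℝ≥0∞) {x : ℝ} (hx : 0 < x) :
    ∫⁻ u : unitInterval, G ⌊x * (1 - u)⌋₊ = ENNReal.ofReal x⁻¹ *
      (∑ i ∈ Finset.range ⌊x⌋₊, G i + ENNReal.ofReal (x - ⌊x⌋₊) * G ⌊x⌋₊) := by
  have hG : Measurable fun y : ℝ => G ⌊y⌋₊ :=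
    (measurable_from_top (f := G)).comp Nat.measurable_floor
  rw [lintegral_unitInterval_mul_symm hG hx,
    ← Set.Ico_union_Ico_eq_Ico (Nat.cast_nonneg ⌊x⌋₊) (Nat.floor_le hx.le),
    lintegral_union measurableSet_Ico (Set.Ico_disjoint_Ico_same), setLIntegral_floor_natCast,
    setLIntegral_floor_Ico G _ (Nat.lt_floor_add_one x).le]

theorem lintegral_ofReal_one_sub :
    ∫⁻ u : unitInterval, ENNReal.ofReal (1 - (u : ℝ)) = ENNReal.ofReal (1 / 2) := by
  have h := lintegral_unitInterval_mul_symm ENNReal.measurable_ofReal one_pos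
  simp only [one_mul, inv_one, ENNReal.ofReal_one] at h
  rw [h, setLIntegral_congr (Ico_ae_eq_Ioc (a := (0 : ℝ)) (b := 1)),
    ← ofReal_integral_eq_lintegral_ofReal, ← intervalIntegral.integral_of_le zero_le_one]
  · simp
  · exact (continuous_id.integrableOn_Icc (a := (0 : ℝ)) (b := 1)).mono_set Set.Ioc_subset_Icc_self
  · exact (ae_restrict_iff' measurableSet_Ioc).2 (Filter.Eventually.of_forall fun y hy => hy.1.le)

/-! ### Stick breaking with marks -/

/-- The sample space of a stick-breaking sequence in which the `j`-th break `u j ∈ [0, 1]` carries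
a mark in `Θ`. -/
abbrev Path (Θ : Type*) : Type _ := ℕ → unitInterval × Θ

section Path

variable {Θ : Type*} [MeasurableSpace Θ] (P : Measure Θ) [IsProbabilityMeasure P]

/-- The law of one break and its mark. -/
abbrev stepLaw : Measure (unitInterval × Θ) := (volume : Measure unitInterval).prod P

/-- The law under which breaks are uniform, marks have law `P`, and all are independent. -/
def pathLaw : Measure (Path Θ) := Measure.infinitePi fun _ => stepLaw P

instance : IsProbabilityMeasure (pathLaw P) := by
  unfold pathLaw; infer_instance

/-- The path that starts with `w` and continues with `ω`. -/
def consPath {Θ : Type*} (w : unitInterval × Θ) (ω : Path Θ) : Path Θ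
  | 0 => w
  | j + 1 => ω j

@[simp]
theorem consPath_zero {Θ : Type*} (w : unitInterval × Θ) (ω : Path Θ) : consPath w ω 0 = w := rfl

@[simp]
theorem consPath_succ {Θ : Type*} (w : unitInterval × Θ) (ω : Path Θ) (j : ℕ) :
    consPath w ω (j + 1) = ω j := rfl

theorem measurable_consPath :
    Measurable fun p : (unitInterval × Θ) × Path Θ => consPath p.1 p.2 := by
  refine measurable_pi_lambda _ fun j => ?_
  cases j with
  | zero => exact measurable_fst
  | succ j => exact (measurable_pi_apply j).comp measurable_snd

/-- The first step of a random path is independent of the path that follows it, which again has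
the law `pathLaw P`. -/
theorem map_consPath :
    ((stepLaw P).prod (pathLaw P)).map (fun p => consPath p.1 p.2) = pathLaw P := by
  classical
  refine Measure.eq_infinitePi _ fun s t ht => ?_
  -- enlarge `s` to an initial segment by trivial constraints
  obtain ⟨N, hN⟩ : ∃ N, s ⊆ Finset.range (N + 1) := by
    obtain ⟨N, hN⟩ := s.exists_nat_subset_range
    exact ⟨N, hN.trans (Finset.range_mono (Nat.le_succ N))⟩
  let t' : ℕ → Set (unitInterval × Θ) := fun i => if i ∈ s then t i else Set.univ
  have ht' : ∀ i, MeasurableSet (t' i) := fun i => by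
    by_cases h : i ∈ s <;> simp [t', h, ht i]
  have hpi : (fun p : (unitInterval × Θ) × Path Θ => consPath p.1 p.2) ⁻¹' (Set.pi s t) =
      t' 0 ×ˢ Set.pi (Finset.range N) fun i => t' (i + 1) := by
    ext ⟨w, ω⟩
    simp only [Set.mem_preimage, Set.mem_pi, Set.mem_prod, Finset.mem_coe]
    constructor
    · refine fun h => ⟨?_, fun i _ => ?_⟩
      · by_cases h0 : 0 ∈ s
        · simpa [t', h0] using h 0 h0
        · simp [t', h0]
      · by_cases h0 : i + 1 ∈ s
        · simpa [t', h0] using h (i + 1) h0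
        · simp [t', h0]
    · rintro ⟨h0, h1⟩ i hi
      cases i with
      | zero => simpa [t', hi] using h0
      | succ i =>
        have := h1 i (by have := Finset.mem_range.1 (hN hi); simp; omega)
        simpa [t', hi] using this
  have hprod : ∏ i ∈ s, stepLaw P (t i) = ∏ i ∈ Finset.range (N + 1), stepLaw P (t' i) := by
    rw [← Finset.prod_subset hN]
    · exact Finset.prod_congr rfl fun i hi => by simp [t', hi]
    · intro i _ hi
      simp [t', hi]
  rw [Measure.map_apply measurable_consPath (MeasurableSet.pi (Finset.countable_toSet s)
    fun i _ => ht i), hpi, Measure.prod_prod, pathLaw, Measure.infinitePi_pi _ fun i _ => ht' _,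
    hprod, Finset.prod_range_succ', mul_comm]

theorem lintegral_pathLaw {F : Path Θ → ℝ≥0∞} (hF : Measurable F) :
    ∫⁻ ω, F ω ∂pathLaw P = ∫⁻ w, ∫⁻ ω, F (consPath w ω) ∂pathLaw P ∂stepLaw P := by
  conv_lhs => rw [← map_consPath P]
  rw [lintegral_map hF measurable_consPath, lintegral_prod]
  exact (hF.comp measurable_consPath).aemeasurable

/-- The length of the stick that remains after `j` breaks. -/
def remaining {Θ : Type*} (ω : Path Θ) (j : ℕ) : ℝ := ∏ i ∈ Finset.range j, (1 - ((ω i).1 : ℝ))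

/-- The length of the `j`-th piece broken off. -/
def stick {Θ : Type*} (ω : Path Θ) (j : ℕ) : ℝ := (ω j).1 * remaining ω j

theorem remaining_zero {Θ : Type*} (ω : Path Θ) : remaining ω 0 = 1 := by simp [remaining]

theorem remaining_succ {Θ : Type*} (ω : Path Θ) (j : ℕ) :
    remaining ω (j + 1) = remaining ω j * (1 - ((ω j).1 : ℝ)) := Finset.prod_range_succ _ _

theorem remaining_consPath_succ {Θ : Type*} (w : unitInterval × Θ) (ω : Path Θ) (j : ℕ) :
    remaining (consPath w ω) (j + 1) = (1 - (w.1 : ℝ)) * remaining ω j := by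
  rw [remaining, Finset.prod_range_succ', mul_comm]
  rfl

theorem stick_consPath_succ {Θ : Type*} (w : unitInterval × Θ) (ω : Path Θ) (j : ℕ) :
    stick (consPath w ω) (j + 1) = (1 - (w.1 : ℝ)) * stick ω j := by
  rw [stick, remaining_consPath_succ, stick]
  change ((ω j).1 : ℝ) * _ = _
  ring

theorem stick_consPath_zero {Θ : Type*} (w : unitInterval × Θ) (ω : Path Θ) :
    stick (consPath w ω) 0 = w.1 := by
  rw [stick, remaining_zero, mul_one]
  rfl

theorem remaining_nonneg {Θ : Type*} (ω : Path Θ) (j : ℕ) : 0 ≤ remaining ω j :=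
  Finset.prod_nonneg fun i _ => sub_nonneg.2 (ω i).1.2.2

theorem stick_nonneg {Θ : Type*} (ω : Path Θ) (j : ℕ) : 0 ≤ stick ω j :=
  mul_nonneg (ω j).1.2.1 (remaining_nonneg ω j)

theorem stick_eq_sub {Θ : Type*} (ω : Path Θ) (j : ℕ) :
    stick ω j = remaining ω j - remaining ω (j + 1) := by
  rw [stick, remaining_succ]; ring

theorem remaining_succ_le {Θ : Type*} (ω : Path Θ) (j : ℕ) :
    remaining ω (j + 1) ≤ remaining ω j := by
  have := stick_nonneg ω j
  rw [stick_eq_sub] at this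
  linarith

theorem measurable_remaining (j : ℕ) : Measurable fun ω : Path Θ => remaining ω j := by
  unfold remaining
  fun_prop

theorem measurable_stick (j : ℕ) : Measurable fun ω : Path Θ => stick ω j := by
  unfold stick
  exact (by fun_prop : Measurable fun ω : Path Θ => ((ω j).1 : ℝ)).mul (measurable_remaining j)

theorem lintegral_stepLaw_fst {f : unitInterval → ℝ≥0∞} (hf : Measurable f) :
    ∫⁻ w, f w.1 ∂stepLaw P = ∫⁻ u, f u := by
  rw [lintegral_prod (fun w => f w.1) (hf.comp measurable_fst).aemeasurable]
  simp

/-- The sum along a path of a cost `c` of the current stick length, the break and its mark. -/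
def pathSum {Θ : Type*} (c : ℝ → unitInterval × Θ → ℝ≥0∞) (x : ℝ) (ω : Path Θ) : ℝ≥0∞ :=
  ∑' j, c (x * remaining ω j) (ω j)

theorem pathSum_consPath {Θ : Type*} (c : ℝ → unitInterval × Θ → ℝ≥0∞) (x : ℝ)
    (w : unitInterval × Θ) (ω : Path Θ) :
    pathSum c x (consPath w ω) = c x w + pathSum c (x * (1 - w.1)) ω := by
  rw [pathSum, tsum_eq_zero_add' ENNReal.summable]
  simp only [remaining_consPath_succ, remaining_zero, mul_one, ← mul_assoc]
  rfl

theorem measurable_pathTerm {c : ℝ → unitInterval × Θ → ℝ≥0∞}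
    (hc : Measurable fun p : ℝ × (unitInterval × Θ) => c p.1 p.2) (x : ℝ) (j : ℕ) :
    Measurable fun ω : Path Θ => c (x * remaining ω j) (ω j) :=
  hc.comp ((measurable_const.mul (measurable_remaining j)).prodMk (measurable_pi_apply j))

theorem measurable_pathSum {c : ℝ → unitInterval × Θ → ℝ≥0∞}
    (hc : Measurable fun p : ℝ × (unitInterval × Θ) => c p.1 p.2) (x : ℝ) :
    Measurable (pathSum c x) :=
  Measurable.tsum fun j => measurable_pathTerm hc x j

theorem lintegral_pathSum {c : ℝ → unitInterval × Θ → ℝ≥0∞}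
    (hc : Measurable fun p : ℝ × (unitInterval × Θ) => c p.1 p.2) (x : ℝ) :
    ∫⁻ ω, pathSum c x ω ∂pathLaw P = ∫⁻ w, c x w ∂stepLaw P +
      ∫⁻ w, ∫⁻ ω, pathSum c (x * (1 - w.1)) ω ∂pathLaw P ∂stepLaw P := by
  rw [lintegral_pathLaw P (measurable_pathSum hc x),
    ← lintegral_add_left (f := c x) (hc.comp measurable_prodMk_left)]
  refine lintegral_congr fun w => ?_
  simp only [pathSum_consPath]
  rw [lintegral_add_left measurable_const, lintegral_const, measure_univ, mul_one]

/-- A function that is superharmonic with respect to the cost dominates the expected cost. -/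
theorem lintegral_pathSum_le {c : ℝ → unitInterval × Θ → ℝ≥0∞}
    (hc : Measurable fun p : ℝ × (unitInterval × Θ) => c p.1 p.2) {φ : ℝ → ℝ≥0∞}
    (hφ : ∀ x, 0 ≤ x →
      ∫⁻ w, c x w ∂stepLaw P + ∫⁻ w, φ (x * (1 - w.1)) ∂stepLaw P ≤ φ x)
    {x : ℝ} (hx : 0 ≤ x) : ∫⁻ ω, pathSum c x ω ∂pathLaw P ≤ φ x := by
  have key : ∀ J x, 0 ≤ x →
      ∫⁻ ω, ∑ j ∈ Finset.range J, c (x * remaining ω j) (ω j) ∂pathLaw P ≤ φ x := by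
    intro J
    induction J with
    | zero => intro x _; simp
    | succ J ih =>
      intro x hx
      rw [lintegral_pathLaw P (Finset.measurable_fun_sum _ fun j _ => measurable_pathTerm hc x j)]
      refine le_trans ?_ (hφ x hx)
      rw [← lintegral_add_left (f := c x) (hc.comp measurable_prodMk_left)]
      refine lintegral_mono fun w => ?_
      simp only [Finset.sum_range_succ' _ J, remaining_consPath_succ, remaining_zero, mul_one,
        consPath_zero, consPath_succ, ← mul_assoc]
      rw [lintegral_add_right _ measurable_const, lintegral_const, measure_univ, mul_one, add_comm]
      exact add_le_add le_rfl (ih _ (mul_nonneg hx (sub_nonneg.2 w.1.2.2)))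
  simp only [pathSum]
  rw [lintegral_tsum fun j => (measurable_pathTerm hc x j).aemeasurable]
  refine ENNReal.tsum_le_of_sum_range_le fun J => ?_
  rw [← lintegral_finsetSum _ fun j _ => measurable_pathTerm hc x j]
  exact key J x hx

/-- A function of at most linear growth that is subharmonic with respect to the cost is at most
the expected cost: the mean length of the stick is halved by each break. -/
theorem le_lintegral_pathSum {c : ℝ → unitInterval × Θ → ℝ≥0∞}
    (hc : Measurable fun p : ℝ × (unitInterval × Θ) => c p.1 p.2) {φ : ℝ → ℝ≥0∞}
    (hφ : ∀ x, 0 ≤ x →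
      φ x ≤ ∫⁻ w, c x w ∂stepLaw P + ∫⁻ w, φ (x * (1 - w.1)) ∂stepLaw P)
    {C : ℝ} (hC : 0 ≤ C) (hlin : ∀ x, 0 ≤ x → φ x ≤ ENNReal.ofReal (C * x))
    {x : ℝ} (hx : 0 ≤ x) : φ x ≤ ∫⁻ ω, pathSum c x ω ∂pathLaw P := by
  have key : ∀ (J : ℕ) x, 0 ≤ x →
      φ x ≤ ∫⁻ ω, pathSum c x ω ∂pathLaw P + ENNReal.ofReal (C * x * (1 / 2) ^ J) := by
    intro J
    induction J with
    | zero => intro x hx; simpa using (hlin x hx).trans le_add_self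
    | succ J ih =>
      intro x hx
      refine (hφ x hx).trans ?_
      rw [lintegral_pathSum P hc, add_assoc]
      refine add_le_add le_rfl ?_
      have hm : Measurable fun w : unitInterval × Θ =>
          ENNReal.ofReal (C * (x * (1 - (w.1 : ℝ))) * (1 / 2) ^ J) := by fun_prop
      have h2 : ∫⁻ w, ENNReal.ofReal (C * (x * (1 - (w.1 : ℝ))) * (1 / 2) ^ J) ∂stepLaw P =
          ENNReal.ofReal (C * x * (1 / 2) ^ (J + 1)) := by
        rw [lintegral_stepLaw_fst P (f := fun u => ENNReal.ofReal
          (C * (x * (1 - (u : ℝ))) * (1 / 2) ^ J)) (by fun_prop)]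
        have : ∀ u : unitInterval, ENNReal.ofReal (C * (x * (1 - (u : ℝ))) * (1 / 2) ^ J) =
            ENNReal.ofReal (C * x * (1 / 2) ^ J) * ENNReal.ofReal (1 - (u : ℝ)) := by
          intro u
          rw [← ENNReal.ofReal_mul (by positivity)]
          congr 1; ring
        simp_rw [this]
        rw [lintegral_const_mul _ (by fun_prop), lintegral_ofReal_one_sub,
          ← ENNReal.ofReal_mul (by positivity)]
        congr 1; ring
      rw [← h2, ← lintegral_add_right _ hm]
      exact lintegral_mono fun w => ih _ (mul_nonneg hx (sub_nonneg.2 w.1.2.2))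
  have hlim : Filter.Tendsto (fun J : ℕ => ∫⁻ ω, pathSum c x ω ∂pathLaw P +
      ENNReal.ofReal (C * x * (1 / 2) ^ J)) Filter.atTop
      (nhds (∫⁻ ω, pathSum c x ω ∂pathLaw P + ENNReal.ofReal (C * x * 0))) := by
    refine tendsto_const_nhds.add (ENNReal.tendsto_ofReal ?_)
    exact (tendsto_pow_atTop_nhds_zero_of_lt_one (by norm_num) (by norm_num)).const_mul _
  simpa using ge_of_tendsto' hlim fun J => key J x hx

/-- Almost surely the stick is eventually used up, since the sum of its lengths after `0, 1, 2, …`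
breaks has mean at most `2`. -/
theorem ae_tendsto_remaining :
    ∀ᵐ ω ∂pathLaw P, Filter.Tendsto (remaining ω) Filter.atTop (nhds 0) := by
  have hc : Measurable fun p : ℝ × (unitInterval × Θ) => ENNReal.ofReal p.1 := by fun_prop
  have h := lintegral_pathSum_le P (c := fun x _ => ENNReal.ofReal x) hc
    (φ := fun x => ENNReal.ofReal (2 * x)) (fun x hx => by
      rw [lintegral_stepLaw_fst P (f := fun u => ENNReal.ofReal (2 * (x * (1 - (u : ℝ)))))
        (by fun_prop)]
      have : ∀ u : unitInterval, ENNReal.ofReal (2 * (x * (1 - (u : ℝ)))) =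
          ENNReal.ofReal (2 * x) * ENNReal.ofReal (1 - (u : ℝ)) := fun u => by
        rw [← ENNReal.ofReal_mul (by positivity), mul_assoc]
      simp_rw [this]
      rw [lintegral_const_mul _ (by fun_prop), lintegral_ofReal_one_sub,
        ← ENNReal.ofReal_mul (by positivity), lintegral_const, measure_univ, mul_one,
        ← ENNReal.ofReal_add hx (by positivity)]
      refine (congrArg _ ?_).le
      ring) zero_le_one
  have hlt := ae_lt_top (measurable_pathSum hc 1) (h.trans_lt ENNReal.ofReal_lt_top).ne
  filter_upwards [hlt] with ω hω
  have := ENNReal.tendsto_atTop_zero_of_tsum_ne_top hω.ne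
  have := (ENNReal.tendsto_toReal ENNReal.zero_ne_top).comp this
  refine this.congr fun j => ?_
  simp [ENNReal.toReal_ofReal, remaining_nonneg]

/-- Telescoping sums of a sequence that tends to zero. -/
theorem hasSum_telescope {a : ℕ → ℝ} (ha : Antitone a)
    (h0 : Filter.Tendsto a Filter.atTop (nhds 0)) : HasSum (fun j => a j - a (j + 1)) (a 0) := by
  rw [hasSum_iff_tendsto_nat_of_nonneg fun j => sub_nonneg.2 (ha (Nat.le_succ j))]
  simp_rw [Finset.sum_range_sub']
  simpa using h0.const_sub (a 0)

theorem antitone_remaining {Θ : Type*} (ω : Path Θ) : Antitone (remaining ω) :=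
  antitone_nat_of_succ_le (remaining_succ_le ω)

theorem hasSum_stick {Θ : Type*} {ω : Path Θ}
    (h : Filter.Tendsto (remaining ω) Filter.atTop (nhds 0)) : HasSum (stick ω) 1 := by
  have := hasSum_telescope (antitone_remaining ω) h
  rw [remaining_zero] at this
  exact this.congr_fun (fun j => stick_eq_sub ω j)

end Path

/-! ### The invariant law is unique -/

theorem summable_abs_sub (x y : Delta) : Summable fun i => |x.1 i - y.1 i| :=
  x.toSimplex.summable_abs_sub y.toSimplex

theorem distOne_nonneg (x y : Delta) : 0 ≤ distOne x y := tsum_nonneg fun _ => abs_nonneg _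

theorem distOne_le_two (x y : Delta) : distOne x y ≤ 2 := by
  have h : HasSum (fun i => x.1 i + y.1 i) (1 + 1) := x.2.1.2.add y.2.1.2
  rw [← one_add_one_eq_two, ← h.tsum_eq]
  refine (summable_abs_sub x y).tsum_le_tsum (fun i => ?_) h.summable
  rw [abs_sub_le_iff]
  constructor <;> linarith [x.2.1.1 i, y.2.1.1 i]

theorem distOne_eq_toReal (x y : Delta) :
    distOne x y = (∑' i, ENNReal.ofReal |x.1 i - y.1 i|).toReal := by
  rw [← ENNReal.ofReal_tsum_of_nonneg (fun _ => abs_nonneg _) (summable_abs_sub x y)]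
  exact (ENNReal.toReal_ofReal (distOne_nonneg x y)).symm

theorem measurable_coord (i : ℕ) : Measurable fun x : Delta => x.1 i :=
  (measurable_pi_apply i).comp measurable_subtype_coe

theorem measurable_distOne : Measurable fun p : Delta × Delta => distOne p.1 p.2 := by
  simp only [distOne_eq_toReal]
  refine (Measurable.tsum fun i => ?_).ennreal_toReal
  have h1 : Measurable fun p : Delta × Delta => p.1.1 i := (measurable_coord i).comp measurable_fst
  have h2 : Measurable fun p : Delta × Delta => p.2.1 i := (measurable_coord i).comp measurable_snd
  exact (h1.sub h2).abs.ennreal_ofReal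

/-- Cutting two partitions by the same break, with the same inserted partition, contracts the
`L¹` distance by the length of the remaining stick. -/
theorem distOne_squareStep_le (u : unitInterval) (s x y : Delta) :
    distOne (squareStep (u, s, x)) (squareStep (u, s, y)) ≤ (1 - (u : ℝ)) * distOne x y := by
  refine (distOne_sort_le _ _).trans (le_of_eq ?_)
  have h1 : ∀ i, |(mix u s.toSimplex x.toSimplex).1 (Sum.inl i) -
      (mix u s.toSimplex y.toSimplex).1 (Sum.inl i)| = 0 := fun i => by
    rw [abs_eq_zero]; exact sub_self _
  have h2 : ∀ i, |(mix u s.toSimplex x.toSimplex).1 (Sum.inr i) -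
      (mix u s.toSimplex y.toSimplex).1 (Sum.inr i)| = (1 - (u : ℝ)) * |x.1 i - y.1 i| := by
    intro i
    change |(1 - (u : ℝ)) * x.1 i - (1 - (u : ℝ)) * y.1 i| = _
    rw [← mul_sub, abs_mul, abs_of_nonneg (sub_nonneg.2 u.2.2)]
  rw [Summable.tsum_sum (summable_zero.congr fun i => (h1 i).symm)
    (((summable_abs_sub x y).mul_left _).congr fun i => (h2 i).symm)]
  simp only [h1, h2, tsum_zero, zero_add]
  exact tsum_mul_left

theorem integrable_of_abs_sub_le {α : Type*} [MeasurableSpace α] {μ : Measure α}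
    [IsFiniteMeasure μ] [Nonempty α] {f : α → ℝ} (hf : Measurable f) {C : ℝ}
    (h : ∀ x y, |f x - f y| ≤ C) : Integrable f μ := by
  obtain ⟨x0⟩ := ‹Nonempty α›
  refine Integrable.of_bound hf.aestronglyMeasurable (C + |f x0|) (Filter.Eventually.of_forall ?_)
  intro x
  rw [Real.norm_eq_abs]
  have := abs_sub_abs_le_abs_sub (f x) (f x0)
  linarith [h x x0]

instance : Nonempty Delta := ⟨sort whole⟩

/-- The coupling bound for a bounded function of which the increments are controlled by `ρ`. -/
theorem integral_sub_le_of_coupling {γ : Measure (Delta × Delta)} [IsProbabilityMeasure γ]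
    {ρ : Delta → Delta → ℝ} (hρ : Integrable (fun p : Delta × Delta => ρ p.1 p.2) γ) {C : ℝ}
    (hC : ∀ x y, ρ x y ≤ C) {f : Delta → ℝ} (hf : Measurable f)
    (h : ∀ x y, |f x - f y| ≤ ρ x y) :
    |∫ x, f x ∂γ.map Prod.fst - ∫ x, f x ∂γ.map Prod.snd| ≤ ∫ p, ρ p.1 p.2 ∂γ := by
  have hi : ∀ g : Delta × Delta → Delta, Measurable g → Integrable (fun p => f (g p)) γ :=
    fun g hg => integrable_of_abs_sub_le (hf.comp hg) fun x y => (h _ _).trans (hC _ _)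
  rw [integral_map measurable_fst.aemeasurable hf.aestronglyMeasurable,
    integral_map measurable_snd.aemeasurable hf.aestronglyMeasurable,
    ← integral_sub (hi _ measurable_fst) (hi _ measurable_snd), ← Real.norm_eq_abs]
  exact (norm_integral_le_integral_norm _).trans
    (integral_mono ((hi _ measurable_fst).sub (hi _ measurable_snd)).norm hρ fun p => h _ _)

theorem integral_one_sub_stepLaw {Θ : Type*} [MeasurableSpace Θ] (P : Measure Θ)
    [IsProbabilityMeasure P] : ∫ w, (1 - (w.1 : ℝ)) ∂stepLaw P = 1 / 2 := by
  rw [integral_eq_lintegral_of_nonneg_ae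
    (Filter.Eventually.of_forall fun w => sub_nonneg.2 w.1.2.2) (by fun_prop),
    lintegral_stepLaw_fst P (f := fun u => ENNReal.ofReal (1 - (u : ℝ))) (by fun_prop),
    lintegral_ofReal_one_sub, ENNReal.toReal_ofReal (by norm_num)]

section Uniqueness

variable {Q : Measure Delta} [IsProbabilityMeasure Q]

theorem measurable_squareStep_assoc :
    Measurable fun p : (unitInterval × Delta) × Delta => squareStep (p.1.1, p.1.2, p.2) :=
  measurable_squareStep.comp (by fun_prop)

theorem IsSquareCutting.integral_eq {ν : Measure Delta} (hν : IsSquareCutting Q ν) {f : Delta → ℝ}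
    (hf : Measurable f) {C : ℝ} (hC : ∀ x y, |f x - f y| ≤ C) :
    ∫ x, f x ∂ν = ∫ x, ∫ w, f (squareStep (w.1, w.2, x)) ∂stepLaw Q ∂ν := by
  have := hν.1
  have hm : Measurable fun p : (unitInterval × Delta) × Delta =>
      f (squareStep (p.1.1, p.1.2, p.2)) := hf.comp measurable_squareStep_assoc
  rw [← integral_prod_symm (fun p : (unitInterval × Delta) × Delta =>
    f (squareStep (p.1.1, p.1.2, p.2))) (integrable_of_abs_sub_le hm fun x y => hC _ _)]
  conv_lhs => rw [← hν.2]
  rw [integral_map measurable_squareStep.aemeasurable hf.aestronglyMeasurable,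
    ← Measure.prodAssoc_prod, integral_map (f := fun p => f (squareStep p)) (by fun_prop)
      (hf.comp measurable_squareStep).aestronglyMeasurable]
  rfl

/-- One step of square cutting turns a Lipschitz function with constant `K` into one with constant
`K / 2`, with the same integrals against invariant laws. -/
theorem IsSquareCutting.abs_integral_sub_le {μ ν : Measure Delta} (hμ : IsSquareCutting Q μ)
    (hν : IsSquareCutting Q ν) (N : ℕ) : ∀ {f : Delta → ℝ}, Measurable f → ∀ {K : ℝ}, 0 ≤ K →
      (∀ x y, |f x - f y| ≤ K * distOne x y) →
      |∫ x, f x ∂μ - ∫ x, f x ∂ν| ≤ K * 2 * (1 / 2) ^ N := by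
  have := hμ.1
  have := hν.1
  induction N with
  | zero =>
    intro f hf K hK h
    have hb : ∀ x y, K * distOne x y ≤ K * 2 :=
      fun x y => mul_le_mul_of_nonneg_left (distOne_le_two x y) hK
    have hint : Integrable (fun p : Delta × Delta => K * distOne p.1 p.2) (μ.prod ν) := by
      refine Integrable.of_bound (measurable_distOne.const_mul K).aestronglyMeasurable (K * 2)
        (Filter.Eventually.of_forall fun p => ?_)
      rw [Real.norm_of_nonneg (mul_nonneg hK (distOne_nonneg _ _))]
      exact hb _ _
    have := integral_sub_le_of_coupling (γ := μ.prod ν) (ρ := fun x y => K * distOne x y) hint hb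
      hf h
    simp only [Measure.map_fst_prod, Measure.map_snd_prod, measure_univ, one_smul] at this
    refine this.trans ?_
    refine (integral_mono hint (integrable_const (K * 2)) fun p => hb _ _).trans ?_
    simp
  | succ N ih =>
    intro f hf K hK h
    have hb : ∀ x y, |f x - f y| ≤ K * 2 :=
      fun x y => (h x y).trans (mul_le_mul_of_nonneg_left (distOne_le_two x y) hK)
    rw [hμ.integral_eq hf hb, hν.integral_eq hf hb]
    have hg : Measurable fun p : Delta × (unitInterval × Delta) => (p.2.1, p.2.2, p.1) := by
      fun_prop
    have hm : Measurable fun p : Delta × (unitInterval × Delta) =>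
        f (squareStep (p.2.1, p.2.2, p.1)) := hf.comp (measurable_squareStep.comp hg)
    have hi : ∀ x, Integrable (fun w : unitInterval × Delta => f (squareStep (w.1, w.2, x)))
        (stepLaw Q) := fun x =>
      integrable_of_abs_sub_le (C := K * 2)
        (hf.comp (measurable_squareStep.comp (hg.comp measurable_prodMk_left)))
        fun v w => hb (squareStep (v.1, v.2, x)) (squareStep (w.1, w.2, x))
    have := ih (f := fun x => ∫ w, f (squareStep (w.1, w.2, x)) ∂stepLaw Q)
      (hm.stronglyMeasurable.integral_prod_right).measurable (K := K / 2) (by positivity) ?_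
    · refine this.trans (le_of_eq ?_)
      rw [pow_succ]; ring
    · intro x y
      rw [← integral_sub (hi x) (hi y), ← Real.norm_eq_abs]
      refine (norm_integral_le_integral_norm _).trans ?_
      have hr : Integrable (fun w : unitInterval × Delta => (1 - (w.1 : ℝ)) * (K * distOne x y))
          (stepLaw Q) := by
        refine Integrable.mul_const ?_ _
        refine Integrable.of_bound (by fun_prop) 1 (Filter.Eventually.of_forall fun w => ?_)
        rw [Real.norm_of_nonneg (sub_nonneg.2 w.1.2.2)]
        linarith [w.1.2.1]
      refine (integral_mono ((hi x).sub (hi y)).norm hr fun w => ?_).trans (le_of_eq ?_)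
      · refine (h _ _).trans ?_
        refine (mul_le_mul_of_nonneg_left (distOne_squareStep_le w.1 w.2 x y) hK).trans_eq ?_
        ring
      · rw [integral_mul_const, integral_one_sub_stepLaw]
        ring

/-- A law on `Δ` is determined by the integrals of `L¹`-Lipschitz functions. -/
theorem Delta.measure_ext {μ ν : Measure Delta} [IsProbabilityMeasure μ] [IsProbabilityMeasure ν]
    (h : ∀ f : Delta → ℝ, Measurable f → ∀ K : ℝ, 0 ≤ K →
      (∀ x y, |f x - f y| ≤ K * distOne x y) → ∫ x, f x ∂μ = ∫ x, f x ∂ν) : μ = ν := by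
  -- bounded continuous functions on `ℝ^ℕ` that are `L¹`-Lipschitz on `Δ`
  let A : StarSubalgebra ℝ (BoundedContinuousFunction (ℕ → ℝ) ℝ) :=
    { carrier := {f | ∃ K : ℝ, 0 ≤ K ∧ ∀ x y : Delta, |f x.1 - f y.1| ≤ K * distOne x y}
      mul_mem' := by
        rintro f g ⟨K, hK, hf⟩ ⟨L, hL, hg⟩
        refine ⟨‖f‖ * L + ‖g‖ * K, by positivity, fun x y => ?_⟩
        have h1 : (f * g) x.1 - (f * g) y.1 =
            f x.1 * (g x.1 - g y.1) + g y.1 * (f x.1 - f y.1) := by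
          simp only [BoundedContinuousFunction.coe_mul, Pi.mul_apply]; ring
        rw [h1]
        refine (abs_add_le _ _).trans ?_
        rw [abs_mul, abs_mul, add_mul, mul_assoc, mul_assoc]
        exact add_le_add (mul_le_mul (f.norm_coe_le_norm _) (hg x y) (abs_nonneg _) (norm_nonneg _))
          (mul_le_mul (g.norm_coe_le_norm _) (hf x y) (abs_nonneg _) (norm_nonneg _))
      add_mem' := by
        rintro f g ⟨K, hK, hf⟩ ⟨L, hL, hg⟩
        refine ⟨K + L, by positivity, fun x y => ?_⟩
        have h1 : (f + g) x.1 - (f + g) y.1 = (f x.1 - f y.1) + (g x.1 - g y.1) := by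
          simp only [BoundedContinuousFunction.coe_add, Pi.add_apply]; ring
        rw [h1, add_mul]
        exact (abs_add_le _ _).trans (add_le_add (hf x y) (hg x y))
      algebraMap_mem' := fun r => ⟨0, le_rfl, fun x y => by
        have : (algebraMap ℝ (BoundedContinuousFunction (ℕ → ℝ) ℝ) r) x.1 -
            (algebraMap ℝ (BoundedContinuousFunction (ℕ → ℝ) ℝ) r) y.1 = 0 := sub_self r
        rw [this]; simp⟩
      star_mem' := fun {f} hf => by simpa using hf }
  have key : μ.map Subtype.val = ν.map Subtype.val := by
    have := Measure.isProbabilityMeasure_map (μ := μ) (f := (Subtype.val : Delta → ℕ → ℝ))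
      measurable_subtype_coe.aemeasurable
    have := Measure.isProbabilityMeasure_map (μ := ν) (f := (Subtype.val : Delta → ℕ → ℝ))
      measurable_subtype_coe.aemeasurable
    refine ext_of_forall_mem_subalgebra_integral_eq_of_polish (𝕜 := ℝ) (A := A) ?_ ?_
    · intro x y hxy
      obtain ⟨i, hi⟩ := Function.ne_iff.1 hxy
      -- a coordinate, truncated at a level that does not affect `x i` and `y i`
      let R := |x i| + |y i|
      have hlip : LipschitzWith 1 fun t : ℝ => max (-R) (min R t) :=
        (LipschitzWith.id.const_min R).const_max (-R)
      have hcont : Continuous fun x : ℕ → ℝ => max (-R) (min R (x i)) := by fun_prop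
      have hR : 0 ≤ R := by positivity
      let F : BoundedContinuousFunction (ℕ → ℝ) ℝ :=
        BoundedContinuousFunction.ofNormedAddCommGroup _ hcont R fun x => by
          rw [Real.norm_eq_abs, abs_le]
          exact ⟨le_max_left _ _, max_le (by linarith) (min_le_left _ _)⟩
      have hF : F ∈ A := by
        refine ⟨1, zero_le_one, fun x y => ?_⟩
        have h1 := hlip.dist_le_mul (x.1 i) (y.1 i)
        rw [Real.dist_eq, Real.dist_eq, NNReal.coe_one] at h1
        refine h1.trans (mul_le_mul_of_nonneg_left ?_ zero_le_one)
        exact (summable_abs_sub x y).le_tsum i fun _ _ => abs_nonneg _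
      refine ⟨F, ⟨F.toContinuousMap, ⟨F, hF, rfl⟩, rfl⟩, ?_⟩
      have hval : ∀ z : ℕ → ℝ, |z i| ≤ R → F z = z i := fun z hz => by
        rw [abs_le] at hz
        change max (-R) (min R (z i)) = z i
        rw [min_eq_right hz.2, max_eq_right hz.1]
      rw [hval x (by simp [R]), hval y (by simp [R])]
      exact hi
    · rintro g ⟨K, hK, hg⟩
      rw [integral_map measurable_subtype_coe.aemeasurable g.continuous.aestronglyMeasurable,
        integral_map measurable_subtype_coe.aemeasurable g.continuous.aestronglyMeasurable]
      exact h _ (g.continuous.measurable.comp measurable_subtype_coe) K hK hg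
  refine Measure.ext fun s hs => ?_
  obtain ⟨t, ht, rfl⟩ := hs
  rw [← Measure.map_apply measurable_subtype_coe ht, key,
    Measure.map_apply measurable_subtype_coe ht]

theorem IsSquareCutting.unique {μ ν : Measure Delta} (hμ : IsSquareCutting Q μ)
    (hν : IsSquareCutting Q ν) : μ = ν := by
  have := hμ.1
  have := hν.1
  refine Delta.measure_ext fun f hf K hK h => ?_
  have hlim : Filter.Tendsto (fun N : ℕ => K * 2 * (1 / 2 : ℝ) ^ N) Filter.atTop
      (nhds (K * 2 * 0)) :=
    (tendsto_pow_atTop_nhds_zero_of_lt_one (by norm_num) (by norm_num)).const_mul _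
  have := ge_of_tendsto' hlim fun N => hμ.abs_integral_sub_le hν N hf hK h
  rw [mul_zero] at this
  exact sub_eq_zero.1 (abs_nonpos_iff.1 this)

end Uniqueness

/-! ### The limiting partition -/

/-- The family in which the `j`-th of the pieces `a` is cut in the proportions `b j`. -/
def blend (a : ℕ → ℝ) (b : ℕ → Delta) : ℕ × ℕ → ℝ := fun p => a p.1 * (b p.1).1 p.2

theorem Delta.tsum_ofReal (x : Delta) : ∑' i, ENNReal.ofReal (x.1 i) = 1 :=
  (isSimplex_iff_tsum_ofReal.1 x.2.1).2

theorem IsSimplex.blend {a : ℕ → ℝ} (ha : IsSimplex a) (b : ℕ → Delta) :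
    IsSimplex (blend a b) := by
  rw [isSimplex_iff_tsum_ofReal] at ha ⊢
  refine ⟨fun p => mul_nonneg (ha.1 _) ((b p.1).2.1.1 _), ?_⟩
  rw [ENNReal.tsum_prod', ← ha.2]
  refine tsum_congr fun j => ?_
  simp only [SquareCutting.blend, ENNReal.ofReal_mul (ha.1 j), ENNReal.tsum_mul_left,
    Delta.tsum_ofReal, mul_one]

theorem partCount_blend {a : ℕ → ℝ} {b : ℕ → Delta} (t : ℝ) :
    partCount (blend a b) t = ∑' j, partCount (fun i => a j * (b j).1 i) t :=
  ENNReal.tsum_prod' (f := fun p => if t < blend a b p then (1 : ℝ≥0∞) else 0)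

/-- Splitting off the first piece of a blended family is one step of square cutting. -/
theorem sortFamily_blend_step {a a' : ℕ → ℝ} {b b' : ℕ → Delta} (u : unitInterval)
    (ha : IsSimplex a) (ha' : (u : ℝ) ≠ 1 → IsSimplex a') (h0 : a 0 = u)
    (h1 : ∀ j, a (j + 1) = (1 - (u : ℝ)) * a' j) (hb : ∀ j, b (j + 1) = b' j) :
    sortFamily (blend a b) = squareStep (u, b 0, sortFamily (blend a' b')) := by
  refine Delta.ext_partCount fun t ht => ?_
  rw [partCount_sortFamily (ha.blend b) ht, partCount_squareStep _ _ _ ht, partCount_blend,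
    tsum_eq_zero_add' ENNReal.summable, h0]
  congr 1
  simp only [h1, hb, mul_assoc]
  rcases u.2.2.eq_or_lt with hu | hu
  · simp only [hu, sub_self, zero_mul]
    rw [partCount_of_le_zero (fun _ => le_rfl) ht, tsum_zero]
  · have hc : 0 < 1 - (u : ℝ) := sub_pos.2 hu
    simp only [partCount_const_mul _ hc]
    rw [partCount_sortFamily ((ha' hu.ne).blend b') (by positivity), partCount_blend]

section Limit

variable {Θ : Type*} [MeasurableSpace Θ] (P : Measure Θ) [IsProbabilityMeasure P]

/-- The random partition obtained by stick breaking when the `j`-th piece is further cut in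
proportions that depend on its mark. -/
def limitPartition {Θ : Type*} (z : Θ → Delta) (ω : Path Θ) : Delta :=
  sortFamily (blend (stick ω) fun j => z (ω j).2)

theorem measurable_blend {z : Θ → Delta} (hz : Measurable z) {a : Path Θ → ℕ → ℝ}
    (ha : ∀ j, Measurable fun ω => a ω j) :
    Measurable fun ω : Path Θ => blend (a ω) fun j => z (ω j).2 := by
  refine measurable_pi_lambda _ fun p => (ha p.1).mul ?_
  exact (measurable_coord p.2).comp (hz.comp (measurable_snd.comp (measurable_pi_apply p.1)))

theorem measurable_limitPartition {z : Θ → Delta} (hz : Measurable z) :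
    Measurable (limitPartition z) :=
  measurable_sortFamily.comp (measurable_blend hz measurable_stick)

theorem isSimplex_stick {Θ : Type*} {ω : Path Θ}
    (h : Filter.Tendsto (remaining ω) Filter.atTop (nhds 0)) : IsSimplex (stick ω) :=
  ⟨stick_nonneg ω, hasSum_stick h⟩

theorem tendsto_remaining_consPath {Θ : Type*} (w : unitInterval × Θ) {ω : Path Θ}
    (h : Filter.Tendsto (remaining ω) Filter.atTop (nhds 0)) :
    Filter.Tendsto (remaining (consPath w ω)) Filter.atTop (nhds 0) := by
  rw [← Filter.tendsto_add_atTop_iff_nat 1]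
  simp only [remaining_consPath_succ]
  simpa using h.const_mul (1 - (w.1 : ℝ))

theorem limitPartition_consPath {Θ : Type*} (z : Θ → Delta) (w : unitInterval × Θ) {ω : Path Θ}
    (h : Filter.Tendsto (remaining ω) Filter.atTop (nhds 0)) :
    limitPartition z (consPath w ω) = squareStep (w.1, z w.2, limitPartition z ω) :=
  sortFamily_blend_step w.1 (isSimplex_stick (tendsto_remaining_consPath w h))
    (fun _ => isSimplex_stick h) (stick_consPath_zero w ω) (stick_consPath_succ w ω) fun _ => rfl

/-- The law of the limiting partition is invariant under square cutting. -/
theorem isSquareCutting_map_limitPartition {z : Θ → Delta} (hz : Measurable z) :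
    IsSquareCutting (P.map z) ((pathLaw P).map (limitPartition z)) := by
  have hl := measurable_limitPartition hz
  have := Measure.isProbabilityMeasure_map (μ := P) hz.aemeasurable
  refine ⟨Measure.isProbabilityMeasure_map hl.aemeasurable, ?_⟩
  conv_rhs => rw [← map_consPath P]
  rw [Measure.map_map hl measurable_consPath]
  have h1 : (limitPartition z ∘ fun p : (unitInterval × Θ) × Path Θ => consPath p.1 p.2)
      =ᵐ[(stepLaw P).prod (pathLaw P)]
      fun p => squareStep (p.1.1, z p.1.2, limitPartition z p.2) := by
    have := Measure.quasiMeasurePreserving_snd (μ := stepLaw P) (ν := pathLaw P)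
    filter_upwards [this.ae (ae_tendsto_remaining P)] with p hp
    exact limitPartition_consPath z p.1 hp
  have hid : (volume : Measure unitInterval) = volume.map id := Measure.map_id.symm
  have hm : Measurable (Prod.map id (Prod.map z (limitPartition z)) :
      unitInterval × Θ × Path Θ → _) := measurable_id.prodMap (hz.prodMap hl)
  rw [Measure.map_congr h1, Measure.map_prod_map P (pathLaw P) hz hl]
  conv_lhs => rw [hid]
  rw [Measure.map_prod_map _ _ measurable_id (hz.prodMap hl), ← Measure.prodAssoc_prod,
    Measure.map_map hm (by fun_prop), Measure.map_map measurable_squareStep (hm.comp (by fun_prop))]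
  rfl

/-- A lower bound for the expected value of a sum over the parts of the limiting partition, by a
function that is subharmonic for stick breaking. -/
theorem le_lintegral_tsum_limitPartition {z : Θ → Delta} (hz : Measurable z) {g : ℝ → ℝ≥0∞}
    (hg : Measurable g) (g0 : g 0 = 0) {φ : ℝ → ℝ≥0∞}
    (hφ : ∀ x, 0 ≤ x → φ x ≤ ∫⁻ w, ∑' i, g (x * w.1 * (z w.2).1 i) ∂stepLaw P +
      ∫⁻ w, φ (x * (1 - w.1)) ∂stepLaw P)
    {C : ℝ} (hC : 0 ≤ C) (hlin : ∀ x, 0 ≤ x → φ x ≤ ENNReal.ofReal (C * x))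
    {x : ℝ} (hx : 0 ≤ x) :
    φ x ≤ ∫⁻ ω, ∑' i, g (x * (limitPartition z ω).1 i) ∂pathLaw P := by
  have hc : Measurable fun p : ℝ × (unitInterval × Θ) =>
      ∑' i, g (p.1 * p.2.1 * (z p.2.2).1 i) := by
    refine Measurable.tsum fun i => hg.comp (Measurable.mul (by fun_prop) ?_)
    exact (measurable_coord i).comp (hz.comp (by fun_prop))
  refine (le_lintegral_pathSum P hc hφ hC hlin hx).trans (lintegral_mono_ae ?_)
  filter_upwards [ae_tendsto_remaining P] with ω hω
  refine le_of_eq ?_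
  have hs := (isSimplex_stick hω).blend fun j => z (ω j).2
  rw [limitPartition, sortFamily_of hs, Simplex.tsum_comp_rankEntry ⟨_, hs⟩
    (g := fun y => g (x * y)) (by simpa using g0), ENNReal.tsum_prod', pathSum]
  refine tsum_congr fun j => tsum_congr fun i => congrArg g ?_
  simp only [blend, stick]
  ring

end Limit

/-! ### Discrete stick breaking -/

/-- The break point `(m - i) / m`, at which a stick of `m` units is cut so that `i` units remain. -/
def cutFraction (m i : ℕ) : unitInterval :=
  Set.projIcc 0 1 zero_le_one (((m : ℝ) - i) / m)

theorem coe_cutFraction {m i : ℕ} (h : i ≤ m) : (cutFraction m i : ℝ) = ((m : ℝ) - i) / m := by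
  have h' : (i : ℝ) ≤ m := Nat.cast_le.2 h
  have h0 : (0 : ℝ) ≤ i := i.cast_nonneg
  rw [cutFraction, Set.coe_projIcc, min_eq_right, max_eq_right]
  · exact div_nonneg (by linarith) (by positivity)
  · exact div_le_one_of_le₀ (by linarith) (by positivity)

theorem one_sub_cutFraction {m i : ℕ} (hm : m ≠ 0) (h : i ≤ m) :
    1 - (cutFraction m i : ℝ) = (i : ℝ) / m := by
  have : (m : ℝ) ≠ 0 := Nat.cast_ne_zero.2 hm
  rw [coe_cutFraction h]
  field_simp
  ring

theorem squareStep_of_eq_zero {u : unitInterval} (hu : (u : ℝ) = 0) (a b : Delta) :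
    squareStep (u, a, b) = b := by
  refine Delta.ext_partCount fun t ht => ?_
  rw [partCount_squareStep _ _ _ ht, hu, partCount_of_le_zero (by simp) ht]
  simp

/-- The law of the cycle-like structure of `m` units: a block of `m - i` units, with `i` uniform in
`{0, …, m - 1}`, is split in proportions of law `Q`, and the remaining `i` units are treated in the
same way, independently. For `m = 0` the value is irrelevant. -/
def discreteLaw (Q : Measure Delta) : ℕ → Measure Delta
  | 0 => Measure.dirac (sort whole)
  | m + 1 => ((m + 1 : ℕ) : ℝ≥0∞)⁻¹ • ∑ i : Fin (m + 1),
      (Q.prod (discreteLaw Q i)).map fun p => squareStep (cutFraction (m + 1) i, p.1, p.2)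

theorem discreteLaw_succ (Q : Measure Delta) (m : ℕ) :
    discreteLaw Q (m + 1) = ((m + 1 : ℕ) : ℝ≥0∞)⁻¹ • ∑ i ∈ Finset.range (m + 1),
      (Q.prod (discreteLaw Q i)).map fun p => squareStep (cutFraction (m + 1) i, p.1, p.2) := by
  rw [discreteLaw, Finset.sum_range fun i =>
    (Q.prod (discreteLaw Q i)).map fun p => squareStep (cutFraction (m + 1) i, p.1, p.2)]

theorem measurable_squareStep_right (u : unitInterval) :
    Measurable fun p : Delta × Delta => squareStep (u, p.1, p.2) :=
  measurable_squareStep.comp measurable_prodMk_left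

instance (Q : Measure Delta) [IsProbabilityMeasure Q] (m : ℕ) :
    IsProbabilityMeasure (discreteLaw Q m) := by
  induction m using Nat.strong_induction_on with
  | _ m ih =>
    cases m with
    | zero => rw [discreteLaw]; infer_instance
    | succ m =>
      refine ⟨?_⟩
      rw [discreteLaw_succ, Measure.smul_apply, Measure.finsetSum_apply]
      have : ∀ i ∈ Finset.range (m + 1), ((Q.prod (discreteLaw Q i)).map
          fun p => squareStep (cutFraction (m + 1) i, p.1, p.2)) Set.univ = 1 := by
        intro i hi
        have := ih i (Finset.mem_range.1 hi)
        rw [Measure.map_apply (measurable_squareStep_right _) MeasurableSet.univ, Set.preimage_univ,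
          measure_univ]
      rw [Finset.sum_congr rfl this]
      simp only [Finset.sum_const, Finset.card_range, nsmul_eq_mul, mul_one, smul_eq_mul]
      exact ENNReal.inv_mul_cancel (by simp) (by finiteness)

theorem lintegral_discreteLaw {Q : Measure Delta} [IsProbabilityMeasure Q] {m : ℕ} (hm : m ≠ 0)
    {f : Delta → ℝ≥0∞} (hf : Measurable f) :
    ∫⁻ x, f x ∂discreteLaw Q m = (m : ℝ≥0∞)⁻¹ * ∑ i ∈ Finset.range m,
      ∫⁻ s, ∫⁻ y, f (squareStep (cutFraction m i, s, y)) ∂discreteLaw Q i ∂Q := by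
  obtain ⟨m, rfl⟩ := Nat.exists_eq_succ_of_ne_zero hm
  rw [Nat.succ_eq_add_one, discreteLaw_succ, lintegral_smul_measure, lintegral_finsetSum_measure,
    smul_eq_mul]
  congr 1
  refine Finset.sum_congr rfl fun i _ => ?_
  rw [lintegral_map hf (measurable_squareStep_right _), lintegral_prod]
  exact (hf.comp (measurable_squareStep_right _)).aemeasurable

/-- The integer part of the stick that remains after `j` breaks, if the initial length is `x`. -/
def level {Θ : Type*} (x : ℝ) (ω : Path Θ) (j : ℕ) : ℕ := ⌊x * remaining ω j⌋₊

/-- The discrete pieces: the decrements of the integer part of the stick, as proportions of the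
integer part of its initial length `x`. -/
def discreteStick {Θ : Type*} (x : ℝ) (ω : Path Θ) (j : ℕ) : ℝ :=
  ((level x ω j : ℝ) - level x ω (j + 1)) / ⌊x⌋₊

/-- The random partition obtained from the discrete pieces when the `j`-th piece is further cut in
proportions that depend on its mark. -/
def discretePartition {Θ : Type*} (z : Θ → Delta) (x : ℝ) (ω : Path Θ) : Delta :=
  sortFamily (blend (discreteStick x ω) fun j => z (ω j).2)

theorem level_zero {Θ : Type*} (x : ℝ) (ω : Path Θ) : level x ω 0 = ⌊x⌋₊ := by
  rw [level, remaining_zero, mul_one]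

theorem level_consPath_succ {Θ : Type*} (x : ℝ) (w : unitInterval × Θ) (ω : Path Θ) (j : ℕ) :
    level x (consPath w ω) (j + 1) = level (x * (1 - w.1)) ω j := by
  rw [level, remaining_consPath_succ, ← mul_assoc, level]

theorem antitone_level {Θ : Type*} {x : ℝ} (hx : 0 ≤ x) (ω : Path Θ) : Antitone (level x ω) :=
  fun _ _ h => Nat.floor_mono (mul_le_mul_of_nonneg_left (antitone_remaining ω h) hx)

theorem isSimplex_discreteStick {Θ : Type*} {x : ℝ} (hx : 0 ≤ x) (h1 : ⌊x⌋₊ ≠ 0) {ω : Path Θ}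
    (h : Filter.Tendsto (remaining ω) Filter.atTop (nhds 0)) : IsSimplex (discreteStick x ω) := by
  have hanti : Antitone fun j => (level x ω j : ℝ) :=
    fun _ _ h => Nat.cast_le.2 (antitone_level hx ω h)
  refine ⟨fun j => div_nonneg (sub_nonneg.2 (hanti (Nat.le_succ j))) (Nat.cast_nonneg _), ?_⟩
  have h0 : Filter.Tendsto (fun j => (level x ω j : ℝ)) Filter.atTop (nhds 0) := by
    have hx0 := h.const_mul x
    rw [mul_zero] at hx0
    refine tendsto_const_nhds.congr' ?_
    filter_upwards [hx0.eventually (gt_mem_nhds one_pos)] with j hj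
    rw [level, Nat.floor_eq_zero.2 hj, Nat.cast_zero]
  have := (hasSum_telescope hanti h0).div_const (⌊x⌋₊ : ℝ)
  rwa [level_zero, div_self (Nat.cast_ne_zero.2 h1)] at this

section Discrete

variable {Θ : Type*} [MeasurableSpace Θ] (P : Measure Θ) [IsProbabilityMeasure P]

theorem measurable_level (x : ℝ) (j : ℕ) : Measurable fun ω : Path Θ => (level x ω j : ℝ) :=
  (measurable_from_top (f := fun n : ℕ => (n : ℝ))).comp
    (Nat.measurable_floor.comp ((measurable_remaining j).const_mul x))

theorem measurable_discretePartition {z : Θ → Delta} (hz : Measurable z) (x : ℝ) :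
    Measurable (discretePartition z x) :=
  measurable_sortFamily.comp (measurable_blend hz fun j =>
    ((measurable_level x j).sub (measurable_level x (j + 1))).div_const _)

theorem discretePartition_of_floor_eq_zero {Θ : Type*} (z : Θ → Delta) {x : ℝ} (hx : ⌊x⌋₊ = 0)
    (ω : Path Θ) : discretePartition z x ω = sort whole := by
  refine dif_neg fun h => ?_
  have h0 : blend (discreteStick x ω) (fun j => z (ω j).2) = 0 := by
    funext p
    simp [blend, discreteStick, hx]
  have h1 := h.2
  rw [h0] at h1
  exact zero_ne_one (hasSum_zero.unique h1)

theorem floor_mul_one_sub_le {x : ℝ} (hx : 0 ≤ x) (u : unitInterval) :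
    ⌊x * (1 - (u : ℝ))⌋₊ ≤ ⌊x⌋₊ :=
  Nat.floor_mono (mul_le_of_le_one_right hx (by linarith [u.2.1]))

theorem discretePartition_consPath {Θ : Type*} (z : Θ → Delta) {x : ℝ} (hx : 0 ≤ x)
    (h1 : ⌊x⌋₊ ≠ 0) (w : unitInterval × Θ) {ω : Path Θ}
    (h : Filter.Tendsto (remaining ω) Filter.atTop (nhds 0)) :
    discretePartition z x (consPath w ω) =
      squareStep (cutFraction ⌊x⌋₊ ⌊x * (1 - w.1)⌋₊, z w.2,
        discretePartition z (x * (1 - w.1)) ω) := by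
  have hle := floor_mul_one_sub_le hx w.1
  have hx' : 0 ≤ x * (1 - (w.1 : ℝ)) := mul_nonneg hx (sub_nonneg.2 w.1.2.2)
  have hm : (⌊x⌋₊ : ℝ) ≠ 0 := Nat.cast_ne_zero.2 h1
  refine sortFamily_blend_step _ (isSimplex_discreteStick hx h1 (tendsto_remaining_consPath w h))
    (fun hu => isSimplex_discreteStick hx' (fun h0 => hu ?_) h) ?_ (fun j => ?_) fun _ => rfl
  · rw [coe_cutFraction hle, h0, Nat.cast_zero, sub_zero, div_self hm]
  · rw [coe_cutFraction hle, discreteStick, level_consPath_succ, level_zero, level_zero]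
  · rw [one_sub_cutFraction h1 hle, discreteStick, level_consPath_succ, level_consPath_succ,
      discreteStick]
    rcases Nat.eq_zero_or_pos ⌊x * (1 - (w.1 : ℝ))⌋₊ with h0 | h0
    · have hl : ∀ i, level (x * (1 - w.1)) ω i = 0 := fun i =>
        Nat.le_zero.1 ((antitone_level hx' ω (Nat.zero_le i)).trans (by rw [level_zero, h0]))
      simp [hl]
    · have : (⌊x * (1 - (w.1 : ℝ))⌋₊ : ℝ) ≠ 0 := Nat.cast_ne_zero.2 h0.ne'
      field_simp

theorem lintegral_discretePartition {z : Θ → Delta} (hz : Measurable z) {x : ℝ} (hx : 0 ≤ x)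
    (h1 : ⌊x⌋₊ ≠ 0) {f : Delta → ℝ≥0∞} (hf : Measurable f) :
    ∫⁻ ω, f (discretePartition z x ω) ∂pathLaw P = ∫⁻ u : unitInterval, ∫⁻ θ, ∫⁻ ω,
      f (squareStep (cutFraction ⌊x⌋₊ ⌊x * (1 - u)⌋₊, z θ, discretePartition z (x * (1 - u)) ω))
        ∂pathLaw P ∂P := by
  have hF := hf.comp (measurable_discretePartition hz x)
  have hm : Measurable fun w : unitInterval × Θ =>
      ∫⁻ ω, f (discretePartition z x (consPath w ω)) ∂pathLaw P :=
    (hF.comp measurable_consPath).lintegral_prod_right'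
  rw [lintegral_pathLaw P (F := fun ω => f (discretePartition z x ω)) hF,
    lintegral_prod _ hm.aemeasurable]
  refine lintegral_congr fun u => lintegral_congr fun θ => lintegral_congr_ae ?_
  filter_upwards [ae_tendsto_remaining P] with ω hω
  rw [discretePartition_consPath z hx h1 (u, θ) hω]

/-- As long as the integer part of the stick does not change, nothing is cut off in the discrete
process; repeatedly conditioning on the first change shows that the mass of the discrete partition
that is not yet accounted for by the recursion of `discreteLaw` is at most `2⁻ᴺ`. -/
theorem mul_lintegral_discreteLaw_le {z : Θ → Delta} (hz : Measurable z) {m : ℕ} (hm : m ≠ 0)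
    (ih : ∀ i < m, ∀ x, 0 ≤ x → ⌊x⌋₊ = i →
      (pathLaw P).map (discretePartition z x) = discreteLaw (P.map z) i)
    {f : Delta → ℝ≥0∞} (hf : Measurable f) (N : ℕ) : ∀ {x : ℝ}, 0 ≤ x → ⌊x⌋₊ = m →
      ENNReal.ofReal (1 - (1 / 2) ^ N) * ∫⁻ y, f y ∂discreteLaw (P.map z) m ≤
        ∫⁻ ω, f (discretePartition z x ω) ∂pathLaw P := by
  have := Measure.isProbabilityMeasure_map (μ := P) hz.aemeasurable
  induction N with
  | zero => intro x _ _; simp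
  | succ N ihN =>
    intro x hx hxm
    have hx0 : 0 < x := by
      rcases hx.eq_or_lt with rfl | h
      · simp at hxm; exact absurd hxm.symm hm
      · exact h
    set I := ∫⁻ y, f y ∂discreteLaw (P.map z) m with hI
    -- given that `i` units are left: the exact value if `i < m`, by induction on `m`, and the bound
    -- from the previous step if nothing has been cut off
    let H : ℕ → ℝ≥0∞ := fun i => if i < m then
      ∫⁻ s, ∫⁻ y, f (squareStep (cutFraction m i, s, y)) ∂discreteLaw (P.map z) i ∂P.map z
      else if i = m then ENNReal.ofReal (1 - (1 / 2) ^ N) * I else 0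
    have hH : ∀ u : unitInterval, H ⌊x * (1 - u)⌋₊ ≤ ∫⁻ θ, ∫⁻ ω,
        f (squareStep (cutFraction m ⌊x * (1 - u)⌋₊, z θ, discretePartition z (x * (1 - u)) ω))
          ∂pathLaw P ∂P := by
      intro u
      have hx' : 0 ≤ x * (1 - (u : ℝ)) := mul_nonneg hx (sub_nonneg.2 u.2.2)
      rcases (floor_mul_one_sub_le hx u).lt_or_eq with hlt | heq
      · rw [hxm] at hlt
        simp only [H, if_pos hlt]
        have hm2 : Measurable fun p : Delta × Delta =>
            f (squareStep (cutFraction m ⌊x * (1 - (u : ℝ))⌋₊, p.1, p.2)) :=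
          hf.comp (measurable_squareStep_right _)
        rw [lintegral_map hm2.lintegral_prod_right' hz]
        refine lintegral_mono fun θ => le_of_eq ?_
        rw [← ih _ hlt _ hx' rfl]
        exact lintegral_map (hm2.comp measurable_prodMk_left) (measurable_discretePartition hz _)
      · rw [hxm] at heq
        have h0 : (cutFraction m m : ℝ) = 0 := by rw [coe_cutFraction le_rfl, sub_self, zero_div]
        simp only [H, heq, lt_irrefl, if_false, if_true, squareStep_of_eq_zero h0]
        rw [lintegral_const, measure_univ, mul_one]
        exact ihN hx' heq
    rw [lintegral_discretePartition P hz hx (hxm ▸ hm) hf, hxm]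
    refine le_trans ?_ (lintegral_mono hH)
    rw [lintegral_floor_mul_symm H hx0, hxm]
    have hsum : ∑ i ∈ Finset.range m, H i = m * I := by
      rw [hI, lintegral_discreteLaw hm hf, ← mul_assoc, ENNReal.mul_inv_cancel (by simpa using hm)
        (by finiteness), one_mul]
      exact Finset.sum_congr rfl fun i hi => if_pos (Finset.mem_range.1 hi)
    have hHm : H m = ENNReal.ofReal (1 - (1 / 2) ^ N) * I := by simp [H]
    have hmx : (m : ℝ) ≤ x := hxm ▸ Nat.floor_le hx
    have hxm1 : x < m + 1 := hxm ▸ Nat.lt_floor_add_one x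
    have hm1 : (1 : ℝ) ≤ m := by exact_mod_cast Nat.one_le_iff_ne_zero.2 hm
    have hp : (0 : ℝ) < (1 / 2) ^ N := by positivity
    have hp1 : ((1 : ℝ) / 2) ^ N ≤ 1 := pow_le_one₀ (by norm_num) (by norm_num)
    rw [hsum, hHm, ← mul_assoc (ENNReal.ofReal (x - m)), ← add_mul, ← mul_assoc,
      ← ENNReal.ofReal_natCast, ← ENNReal.ofReal_mul (by linarith),
      ← ENNReal.ofReal_add (by positivity) (mul_nonneg (by linarith) (by linarith)),
      ← ENNReal.ofReal_mul (by positivity)]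
    gcongr
    -- nothing is cut off with probability `(x - m) / x ≤ 1 / 2`
    rw [inv_mul_eq_div, le_div_iff₀ hx0, pow_succ]
    nlinarith

/-- The integer parts of a continuous stick-breaking sequence form a discrete stick-breaking
sequence. Only one inequality is needed, because both sides are probability measures. -/
theorem map_discretePartition {z : Θ → Delta} (hz : Measurable z) (m : ℕ) :
    ∀ {x : ℝ}, 0 ≤ x → ⌊x⌋₊ = m →
      (pathLaw P).map (discretePartition z x) = discreteLaw (P.map z) m := by
  have := Measure.isProbabilityMeasure_map (μ := P) hz.aemeasurable
  induction m using Nat.strong_induction_on with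
  | _ m ih =>
    intro x hx hxm
    have hmeas := measurable_discretePartition hz x
    rcases eq_or_ne m 0 with rfl | hm
    · have : discretePartition z x = fun _ => sort whole :=
        funext (discretePartition_of_floor_eq_zero z hxm)
      rw [this, Measure.map_const, measure_univ, one_smul, discreteLaw]
    · have := Measure.isProbabilityMeasure_map (μ := pathLaw P) hmeas.aemeasurable
      refine (Measure.eq_of_le_of_isProbabilityMeasure (Measure.le_iff.2 fun s hs => ?_)).symm
      have hlim : Filter.Tendsto (fun N : ℕ => ENNReal.ofReal (1 - (1 / 2) ^ N) *
          discreteLaw (P.map z) m s) Filter.atTop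
          (nhds (ENNReal.ofReal (1 - 0) * discreteLaw (P.map z) m s)) := by
        refine ENNReal.Tendsto.mul_const (ENNReal.tendsto_ofReal ?_) (Or.inr (by finiteness))
        exact (tendsto_pow_atTop_nhds_zero_of_lt_one (by norm_num) (by norm_num)).const_sub 1
      rw [sub_zero, ENNReal.ofReal_one, one_mul] at hlim
      refine le_of_tendsto' hlim fun N => ?_
      have := mul_lintegral_discreteLaw_le P hz hm (fun i hi x => ih i hi)
        (measurable_one.indicator hs) N hx hxm
      rwa [lintegral_indicator_one hs, ← lintegral_map (f := s.indicator 1)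
        (measurable_one.indicator hs) hmeas, lintegral_indicator_one hs] at this

end Discrete

/-! ### Distance between the discrete and the limiting partition -/

theorem Delta.abs_sub_le_one (x y : Delta) (i : ℕ) : |x.1 i - y.1 i| ≤ 1 := by
  rw [abs_sub_le_iff]
  constructor <;> linarith [x.2.1.1 i, y.2.1.1 i, x.le_one i, y.le_one i]

theorem abs_sub_le_distSup (x y : Delta) (i : ℕ) : |x.1 i - y.1 i| ≤ distSup x y :=
  le_ciSup (f := fun i => |x.1 i - y.1 i|)
    ⟨1, by rintro _ ⟨j, rfl⟩; exact x.abs_sub_le_one y j⟩ i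

theorem distSup_nonneg (x y : Delta) : 0 ≤ distSup x y := Real.iSup_nonneg fun _ => abs_nonneg _

theorem distSup_le_one (x y : Delta) : distSup x y ≤ 1 := ciSup_le (x.abs_sub_le_one y)

theorem measurable_distSup : Measurable fun p : Delta × Delta => distSup p.1 p.2 := by
  refine Measurable.iSup fun i => ?_
  have h1 : Measurable fun p : Delta × Delta => p.1.1 i := (measurable_coord i).comp measurable_fst
  have h2 : Measurable fun p : Delta × Delta => p.2.1 i := (measurable_coord i).comp measurable_snd
  exact (h1.sub h2).abs

/-- The fractional part of the stick that remains after `j` breaks. -/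
def excess {Θ : Type*} (x : ℝ) (ω : Path Θ) (j : ℕ) : ℝ := x * remaining ω j - level x ω j

theorem excess_nonneg {Θ : Type*} {x : ℝ} (hx : 0 ≤ x) (ω : Path Θ) (j : ℕ) : 0 ≤ excess x ω j :=
  sub_nonneg.2 (Nat.floor_le (mul_nonneg hx (remaining_nonneg ω j)))

theorem excess_lt_one {Θ : Type*} (x : ℝ) (ω : Path Θ) (j : ℕ) : excess x ω j < 1 := by
  have := Nat.lt_floor_add_one (x * remaining ω j)
  rw [excess, level]
  linarith

theorem discreteStick_sub_stick {Θ : Type*} {n : ℕ} (hn : n ≠ 0) (ω : Path Θ) (j : ℕ) :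
    discreteStick n ω j - stick ω j = (excess n ω (j + 1) - excess n ω j) / n := by
  have : (n : ℝ) ≠ 0 := Nat.cast_ne_zero.2 hn
  rw [discreteStick, stick_eq_sub, excess, excess, Nat.floor_natCast]
  field_simp
  ring

theorem abs_discreteStick_sub_stick_le {Θ : Type*} {n : ℕ} (hn : n ≠ 0) (ω : Path Θ) (j : ℕ) :
    |discreteStick n ω j - stick ω j| ≤ 1 / n := by
  rw [discreteStick_sub_stick hn, abs_div, Nat.abs_cast]
  gcongr
  rw [abs_sub_le_iff]
  have h0 : (0 : ℝ) ≤ n := Nat.cast_nonneg n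
  constructor <;> linarith [excess_nonneg h0 ω j, excess_nonneg h0 ω (j + 1),
    excess_lt_one n ω j, excess_lt_one n ω (j + 1)]

/-- Every discrete piece differs from the corresponding piece of the stick by less than one unit,
so the two partitions are surely close in the supremum distance. -/
theorem distSup_discretePartition_le {Θ : Type*} {z z' : Θ → Delta} {n : ℕ} (hn : n ≠ 0) {ε : ℝ}
    (hε : 0 ≤ ε) {ω : Path Θ} (h : Filter.Tendsto (remaining ω) Filter.atTop (nhds 0))
    (hz : ∀ j, distSup (z' (ω j).2) (z (ω j).2) ≤ ε) :
    distSup (discretePartition z' n ω) (limitPartition z ω) ≤ 1 / n + ε := by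
  have hd := isSimplex_discreteStick (Nat.cast_nonneg n) (by rwa [Nat.floor_natCast]) h
  have hs := isSimplex_stick h
  rw [discretePartition, limitPartition, sortFamily_of (hd.blend _), sortFamily_of (hs.blend _)]
  refine distSup_sort_le _ _ (by positivity) fun p => ?_
  obtain ⟨j, i⟩ := p
  change |discreteStick n ω j * (z' (ω j).2).1 i - stick ω j * (z (ω j).2).1 i| ≤ _
  have hsplit : discreteStick n ω j * (z' (ω j).2).1 i - stick ω j * (z (ω j).2).1 i =
      (discreteStick n ω j - stick ω j) * (z (ω j).2).1 i +
        discreteStick n ω j * ((z' (ω j).2).1 i - (z (ω j).2).1 i) := by ring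
  rw [hsplit]
  refine (abs_add_le _ _).trans (add_le_add ?_ ?_)
  · rw [abs_mul, abs_of_nonneg ((z (ω j).2).2.1.1 i)]
    exact (mul_le_of_le_one_right (abs_nonneg _) ((z (ω j).2).le_one i)).trans
      (abs_discreteStick_sub_stick_le hn ω j)
  · rw [abs_mul, abs_of_nonneg (hd.1 j)]
    have hd1 : discreteStick n ω j ≤ 1 := Simplex.le_one ⟨_, hd⟩ j
    exact (mul_le_of_le_one_left (abs_nonneg _) hd1).trans ((abs_sub_le_distSup _ _ i).trans (hz j))

/-- The indicator that a break of a stick of length `x` changes the integer part of the length. -/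
def crossing {Θ : Type*} (x : ℝ) (w : unitInterval × Θ) : ℝ≥0∞ :=
  if ⌊x * (1 - w.1)⌋₊ < ⌊x⌋₊ then 1 else 0

theorem sum_range_harmonic (m : ℕ) :
    (m : ℝ) + ∑ i ∈ Finset.range m, (harmonic i : ℝ) = m * harmonic m := by
  induction m with
  | zero => simp
  | succ m ih =>
    rw [Finset.sum_range_succ, harmonic_succ]
    push_cast
    field_simp
    linarith

theorem harmonic_cast_nonneg (m : ℕ) : (0 : ℝ) ≤ harmonic m := by
  rw [harmonic]
  push_cast
  positivity

section Crossing

variable {Θ : Type*} [MeasurableSpace Θ] (P : Measure Θ) [IsProbabilityMeasure P]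

theorem measurable_floor_sub_mul : Measurable fun p : ℝ × (unitInterval × Θ) =>
    ⌊p.1 * (1 - (p.2.1 : ℝ))⌋₊ := Nat.measurable_floor.comp (by fun_prop)

theorem measurable_crossing :
    Measurable fun p : ℝ × (unitInterval × Θ) => crossing p.1 p.2 := by
  have h : Measurable fun p : ℝ × (unitInterval × Θ) => ⌊p.1⌋₊ :=
    Nat.measurable_floor.comp measurable_fst
  exact Measurable.ite (measurableSet_lt measurable_floor_sub_mul h) measurable_const
    measurable_const

theorem lintegral_stepLaw_floor (G : ℕ → ℝ≥0∞) {x : ℝ} (hx : 0 < x) :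
    ∫⁻ w, G ⌊x * (1 - w.1)⌋₊ ∂stepLaw P = ENNReal.ofReal x⁻¹ *
      (∑ i ∈ Finset.range ⌊x⌋₊, G i + ENNReal.ofReal (x - ⌊x⌋₊) * G ⌊x⌋₊) := by
  rw [← lintegral_floor_mul_symm G hx]
  exact lintegral_stepLaw_fst P (f := fun u => G ⌊x * (1 - (u : ℝ))⌋₊)
    ((measurable_from_top (f := G)).comp (Nat.measurable_floor.comp (by fun_prop)))

/-- The harmonic numbers are harmonic for the integer part of the stick: they exceed their mean
after one break exactly by the probability that the integer part changes. -/
theorem harmonic_floor_eq (G : ℕ → ℝ≥0∞) {x : ℝ} (hx : 0 < x) {c : ℝ} (hc : 0 ≤ c)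
    (hG : ∀ i, G i = ENNReal.ofReal (c * ((if i < ⌊x⌋₊ then 1 else 0) + harmonic i))) :
    ∫⁻ w, G ⌊x * (1 - w.1)⌋₊ ∂stepLaw P = ENNReal.ofReal (c * harmonic ⌊x⌋₊) := by
  have hh := harmonic_cast_nonneg
  have hfl : (⌊x⌋₊ : ℝ) ≤ x := Nat.floor_le hx.le
  rw [lintegral_stepLaw_floor P G hx, hG ⌊x⌋₊, Finset.sum_congr rfl fun i hi => by
      rw [hG i, if_pos (Finset.mem_range.1 hi)],
    ← ENNReal.ofReal_sum_of_nonneg fun i _ => mul_nonneg hc (add_nonneg zero_le_one (hh i)),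
    if_neg (lt_irrefl _), zero_add, ← ENNReal.ofReal_mul (by linarith),
    ← ENNReal.ofReal_add (Finset.sum_nonneg fun i _ => mul_nonneg hc
      (add_nonneg zero_le_one (hh i))) (mul_nonneg (by linarith) (mul_nonneg hc (hh _))),
    ← ENNReal.ofReal_mul (by positivity), ← Finset.mul_sum, Finset.sum_add_distrib]
  simp only [Finset.sum_const, Finset.card_range, nsmul_eq_mul, mul_one, sum_range_harmonic]
  congr 1
  field_simp
  ring

/-- The expected number of breaks that change the integer part of the stick is at most `H_⌊x⌋`. -/
theorem lintegral_crossing_le {x : ℝ} (hx : 0 ≤ x) :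
    ∫⁻ ω, pathSum crossing x ω ∂pathLaw P ≤ ENNReal.ofReal (harmonic ⌊x⌋₊) := by
  refine lintegral_pathSum_le P measurable_crossing
    (φ := fun x => ENNReal.ofReal (harmonic ⌊x⌋₊)) (fun x hx => ?_) hx
  rcases hx.eq_or_lt with rfl | hx
  · simp [crossing]
  · rw [← lintegral_add_left (f := crossing x) (measurable_crossing.comp measurable_prodMk_left)]
    have := harmonic_floor_eq P (fun i => (if i < ⌊x⌋₊ then 1 else 0) + ENNReal.ofReal (harmonic i))
      hx zero_le_one fun i => by
        rw [one_mul, ENNReal.ofReal_add (by split_ifs <;> simp) (harmonic_cast_nonneg i)]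
        congr 1
        split_ifs <;> simp
    rw [one_mul] at this
    exact this.le

/-- Each discrete piece that is not empty contributes at most `2 / n` to the `L¹` distance, because
the fractional part of the stick can increase only when its integer part changes. -/
theorem tsum_abs_discreteStick_sub_stick_le {Θ : Type*} {n : ℕ} (hn : n ≠ 0) (ω : Path Θ) :
    ∑' j, ENNReal.ofReal |discreteStick n ω j - stick ω j| ≤
      ENNReal.ofReal (2 / n) * pathSum crossing n ω := by
  have hn0 : (0 : ℝ) ≤ n := Nat.cast_nonneg n
  let χ : ℕ → ℝ := fun j => if level n ω (j + 1) < level n ω j then 1 else 0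
  have hχ : ∀ j, crossing (n * remaining ω j) (ω j) = ENNReal.ofReal (χ j) := by
    intro j
    have : ⌊(n : ℝ) * remaining ω j * (1 - (ω j).1)⌋₊ = level n ω (j + 1) := by
      rw [level, remaining_succ, mul_assoc]
    simp only [crossing, this, χ]
    change (if level n ω (j + 1) < level n ω j then (1 : ℝ≥0∞) else 0) = _
    split_ifs <;> simp
  have hχ0 : ∀ j, 0 ≤ χ j := fun j => by simp only [χ]; split_ifs <;> norm_num
  have hstep : ∀ j, |excess n ω (j + 1) - excess n ω j| ≤
      (excess n ω j - excess n ω (j + 1)) + 2 * χ j := by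
    intro j
    have h1 := excess_nonneg hn0 ω j
    have h2 := excess_lt_one n ω (j + 1)
    rcases (antitone_level hn0 ω (Nat.le_succ j)).lt_or_eq with hlt | heq
    · have : χ j = 1 := if_pos hlt
      rw [this, abs_le]
      constructor <;> linarith
    · have : excess n ω (j + 1) ≤ excess n ω j := by
        simp only [excess]
        rw [Nat.succ_eq_add_one] at heq
        rw [heq]
        have := mul_le_mul_of_nonneg_left (remaining_succ_le ω j) hn0
        linarith
      rw [abs_of_nonpos (by linarith)]
      linarith [hχ0 j]
  have hsum : ∀ J, ∑ j ∈ Finset.range J, |excess n ω (j + 1) - excess n ω j| ≤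
      2 * ∑ j ∈ Finset.range J, χ j := by
    intro J
    refine (Finset.sum_le_sum fun j _ => hstep j).trans ?_
    rw [Finset.sum_add_distrib, Finset.sum_range_sub', ← Finset.mul_sum]
    have h0 : excess n ω 0 = 0 := by
      rw [excess, level_zero, remaining_zero, mul_one, Nat.floor_natCast, sub_self]
    linarith [excess_nonneg hn0 ω J]
  refine ENNReal.tsum_le_of_sum_range_le fun J => ?_
  have hJ : ∑ j ∈ Finset.range J, |discreteStick n ω j - stick ω j| ≤
      2 / n * ∑ j ∈ Finset.range J, χ j := by
    simp only [discreteStick_sub_stick hn, abs_div, Nat.abs_cast, ← Finset.sum_div]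
    rw [div_mul_eq_mul_div]
    gcongr
    exact hsum J
  rw [← ENNReal.ofReal_sum_of_nonneg fun _ _ => abs_nonneg _]
  refine (ENNReal.ofReal_le_ofReal hJ).trans ?_
  rw [ENNReal.ofReal_mul (by positivity)]
  gcongr
  rw [ENNReal.ofReal_sum_of_nonneg fun j _ => hχ0 j, pathSum]
  simp only [hχ]
  exact ENNReal.sum_le_tsum _

/-- The discrete pieces have total mass one, and each is independent of the mark that it carries. -/
theorem lintegral_tsum_discreteStick_mul_le {d : Θ → ℝ≥0∞} (hd : Measurable d) {n : ℕ}
    (hn : n ≠ 0) : ∫⁻ ω, ∑' j, ENNReal.ofReal (discreteStick n ω j) * d (ω j).2 ∂pathLaw P ≤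
      ∫⁻ θ, d θ ∂P := by
  obtain ⟨c, hcdef⟩ : ∃ c : ℝ → unitInterval × Θ → ℝ≥0∞, ∀ x w,
      c x w = ((⌊x⌋₊ - ⌊x * (1 - w.1)⌋₊ : ℕ) : ℝ≥0∞) * d w.2 := ⟨_, fun _ _ => rfl⟩
  have hc : Measurable fun p : ℝ × (unitInterval × Θ) => c p.1 p.2 := by
    simp only [hcdef]
    refine Measurable.mul ?_ (hd.comp (by fun_prop))
    have h : Measurable fun p : ℝ × (unitInterval × Θ) => ⌊p.1⌋₊ :=
      Nat.measurable_floor.comp measurable_fst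
    exact (measurable_from_top (f := fun n : ℕ => (n : ℝ≥0∞))).comp
      (h.sub measurable_floor_sub_mul)
  have key := lintegral_pathSum_le P hc (φ := fun x => (⌊x⌋₊ : ℝ≥0∞) * ∫⁻ θ, d θ ∂P)
    (fun x hx => ?_) (Nat.cast_nonneg n)
  · have hterm : ∀ ω : Path Θ, ∑' j, ENNReal.ofReal (discreteStick n ω j) * d (ω j).2 =
        (n : ℝ≥0∞)⁻¹ * pathSum c n ω := by
      intro ω
      rw [pathSum, ← ENNReal.tsum_mul_left]
      refine tsum_congr fun j => ?_
      have hl : ⌊(n : ℝ) * remaining ω j * (1 - (ω j).1)⌋₊ = level n ω (j + 1) := by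
        rw [level, remaining_succ, mul_assoc]
      simp only [hcdef, hl]
      change _ = (n : ℝ≥0∞)⁻¹ * (((level n ω j - level n ω (j + 1) : ℕ) : ℝ≥0∞) * _)
      rw [← mul_assoc, discreteStick, Nat.floor_natCast, mul_comm (n : ℝ≥0∞)⁻¹, ← div_eq_mul_inv,
        ENNReal.ofReal_div_of_pos (by positivity), ENNReal.ofReal_natCast,
        ← Nat.cast_sub (antitone_level (Nat.cast_nonneg n) ω (Nat.le_succ j)),
        ENNReal.ofReal_natCast]
    simp only [hterm]
    rw [lintegral_const_mul _ (measurable_pathSum hc _)]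
    rw [Nat.floor_natCast] at key
    refine (mul_le_mul_right key _).trans ?_
    rw [← mul_assoc, ENNReal.inv_mul_cancel (by simpa using hn) (by finiteness), one_mul]
  · have hcx : Measurable (c x) := hc.comp measurable_prodMk_left
    rw [← lintegral_add_left hcx, lintegral_prod]
    · have hu : ∀ u : unitInterval, ∫⁻ θ, (c x (u, θ) + (⌊x * (1 - (u : ℝ))⌋₊ : ℝ≥0∞) *
          ∫⁻ θ, d θ ∂P) ∂P = (⌊x⌋₊ : ℝ≥0∞) * ∫⁻ θ, d θ ∂P := by
        intro u
        rw [lintegral_add_right _ measurable_const, lintegral_const, measure_univ, mul_one]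
        simp only [hcdef]
        rw [lintegral_const_mul _ hd, ← add_mul, ← Nat.cast_add,
          Nat.sub_add_cancel (floor_mul_one_sub_le hx u)]
      simp only [hu]
      rw [lintegral_const, measure_univ, mul_one]
    · refine (hcx.add (Measurable.mul_const ?_ _)).aemeasurable
      have h : Measurable fun w : unitInterval × Θ => ⌊x * (1 - (w.1 : ℝ))⌋₊ :=
        Nat.measurable_floor.comp (by fun_prop)
      exact (measurable_from_top (f := fun n : ℕ => (n : ℝ≥0∞))).comp h

theorem ofReal_distOne (x y : Delta) :
    ENNReal.ofReal (distOne x y) = ∑' i, ENNReal.ofReal |x.1 i - y.1 i| :=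
  ENNReal.ofReal_tsum_of_nonneg (fun _ => abs_nonneg _) (summable_abs_sub x y)

theorem lintegral_distOne_discretePartition_le {z z' : Θ → Delta} (hz : Measurable z)
    (hz' : Measurable z') {n : ℕ} (hn : n ≠ 0) :
    ∫⁻ ω, ENNReal.ofReal (distOne (discretePartition z' n ω) (limitPartition z ω)) ∂pathLaw P ≤
      ENNReal.ofReal (2 * harmonic n / n) +
        ∫⁻ θ, ENNReal.ofReal (distOne (z' θ) (z θ)) ∂P := by
  have hd : Measurable fun θ => ENNReal.ofReal (distOne (z' θ) (z θ)) :=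
    (measurable_distOne.comp (hz'.prodMk hz)).ennreal_ofReal
  have hpt : ∀ᵐ ω ∂pathLaw P,
      ENNReal.ofReal (distOne (discretePartition z' n ω) (limitPartition z ω)) ≤
        ENNReal.ofReal (2 / n) * pathSum crossing n ω +
          ∑' j, ENNReal.ofReal (discreteStick n ω j) *
            ENNReal.ofReal (distOne (z' (ω j).2) (z (ω j).2)) := by
    filter_upwards [ae_tendsto_remaining P] with ω h
    have hd := isSimplex_discreteStick (Nat.cast_nonneg n) (by rwa [Nat.floor_natCast]) h
    have hs := isSimplex_stick h
    rw [discretePartition, limitPartition, sortFamily_of (hd.blend _), sortFamily_of (hs.blend _)]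
    refine (ENNReal.ofReal_le_ofReal (distOne_sort_le _ _)).trans ?_
    rw [ENNReal.ofReal_tsum_of_nonneg (fun _ => abs_nonneg _) (Simplex.summable_abs_sub _ _),
      ENNReal.tsum_prod']
    refine le_trans ?_ (add_le_add (tsum_abs_discreteStick_sub_stick_le hn ω) le_rfl)
    rw [← ENNReal.tsum_add]
    refine ENNReal.tsum_le_tsum fun j => ?_
    have hterm : ∀ i, ENNReal.ofReal |blend (discreteStick n ω) (fun j => z' (ω j).2) (j, i) -
        blend (stick ω) (fun j => z (ω j).2) (j, i)| ≤
        ENNReal.ofReal |discreteStick n ω j - stick ω j| * ENNReal.ofReal ((z (ω j).2).1 i) +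
          ENNReal.ofReal (discreteStick n ω j) *
            ENNReal.ofReal |(z' (ω j).2).1 i - (z (ω j).2).1 i| := by
      intro i
      rw [← ENNReal.ofReal_mul (abs_nonneg _), ← ENNReal.ofReal_mul (hd.1 j),
        ← ENNReal.ofReal_add (mul_nonneg (abs_nonneg _) ((z (ω j).2).2.1.1 i))
          (mul_nonneg (hd.1 j) (abs_nonneg _))]
      refine ENNReal.ofReal_le_ofReal ?_
      have hsplit : blend (discreteStick n ω) (fun j => z' (ω j).2) (j, i) -
          blend (stick ω) (fun j => z (ω j).2) (j, i) =
          (discreteStick n ω j - stick ω j) * (z (ω j).2).1 i +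
            discreteStick n ω j * ((z' (ω j).2).1 i - (z (ω j).2).1 i) := by
        simp only [blend]; ring
      rw [hsplit]
      refine (abs_add_le _ _).trans_eq ?_
      rw [abs_mul, abs_mul, abs_of_nonneg ((z (ω j).2).2.1.1 i), abs_of_nonneg (hd.1 j)]
    refine (ENNReal.tsum_le_tsum hterm).trans_eq ?_
    rw [ENNReal.tsum_add, ENNReal.tsum_mul_left, ENNReal.tsum_mul_left, Delta.tsum_ofReal, mul_one,
      ofReal_distOne]
  refine (lintegral_mono_ae hpt).trans ?_
  have hm : Measurable fun ω : Path Θ => ENNReal.ofReal (2 / n) * pathSum crossing n ω :=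
    (measurable_pathSum measurable_crossing _).const_mul _
  rw [lintegral_add_left hm, lintegral_const_mul _ (measurable_pathSum measurable_crossing _)]
  refine add_le_add ?_ (lintegral_tsum_discreteStick_mul_le P hd hn)
  refine (mul_le_mul_right (lintegral_crossing_le P (Nat.cast_nonneg n)) _).trans_eq ?_
  rw [Nat.floor_natCast, ← ENNReal.ofReal_mul (by positivity)]
  congr 1
  ring

end Crossing

/-! ### Distance of the limiting partition from a lattice -/

/-- The distance of a real number from the nearest integer. -/
def intDist (y : ℝ) : ℝ := |y - round y|

theorem intDist_le (y : ℝ) (k : ℤ) : intDist y ≤ |y - k| := round_le y k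

theorem intDist_nonneg (y : ℝ) : 0 ≤ intDist y := abs_nonneg _

theorem intDist_intCast (k : ℤ) : intDist k = 0 := by simp [intDist]

theorem intDist_sub_le (x y : ℝ) : intDist x - intDist y ≤ |x - y| := by
  have h1 := intDist_le x (round y)
  have h2 := abs_add_le (x - y) (y - round y)
  rw [sub_add_sub_cancel] at h2
  rw [intDist, intDist] at *
  linarith

theorem abs_intDist_sub_le (x y : ℝ) : |intDist x - intDist y| ≤ |x - y| :=
  abs_sub_le_iff.2 ⟨intDist_sub_le x y, abs_sub_comm x y ▸ intDist_sub_le y x⟩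

theorem continuous_intDist : Continuous intDist := by
  refine LipschitzWith.continuous (K := 1) (LipschitzWith.of_dist_le_mul fun x y => ?_)
  rw [Real.dist_eq, Real.dist_eq, NNReal.coe_one, one_mul]
  exact abs_intDist_sub_le x y

theorem min_le_intDist (i : ℤ) (y : ℝ) : min (y - i) (i + 1 - y) ≤ intDist y := by
  rcases le_or_gt (round y) i with h | h
  · have : ((round y : ℤ) : ℝ) ≤ i := Int.cast_le.2 h
    exact (min_le_left _ _).trans ((by linarith : y - i ≤ y - round y).trans (le_abs_self _))
  · have : (i : ℝ) + 1 ≤ (round y : ℤ) := by exact_mod_cast h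
    refine (min_le_right _ _).trans ((by linarith : (i : ℝ) + 1 - y ≤ -(y - round y)).trans ?_)
    exact neg_le_abs _

theorem setLIntegral_Ico_ofReal {F : ℝ → ℝ} {a b : ℝ} (hab : a ≤ b)
    (hF : ContinuousOn F (Set.Icc a b)) (h0 : ∀ y ∈ Set.Icc a b, 0 ≤ F y) :
    ∫⁻ y in Set.Ico a b, ENNReal.ofReal (F y) = ENNReal.ofReal (∫ y in a..b, F y) := by
  rw [setLIntegral_congr (Ico_ae_eq_Ioc (a := a) (b := b)), intervalIntegral.integral_of_le hab,
    ofReal_integral_eq_lintegral_ofReal]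
  · exact hF.integrableOn_Icc.mono_set Set.Ioc_subset_Icc_self
  · exact (ae_restrict_iff' measurableSet_Ioc).2
      (Filter.Eventually.of_forall fun y hy => h0 y (Set.Ioc_subset_Icc_self hy))

theorem le_setLIntegral_intDist (i : ℕ) :
    ENNReal.ofReal (1 / 4) ≤ ∫⁻ y in Set.Ico (i : ℝ) (i + 1), ENNReal.ofReal (intDist y) := by
  have hu : Set.Ico (i : ℝ) (i + 1) =
      Set.Ico (i : ℝ) (i + 1 / 2) ∪ Set.Ico (i + 1 / 2 : ℝ) (i + 1) :=
    (Set.Ico_union_Ico_eq_Ico (by linarith) (by linarith)).symm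
  rw [hu, lintegral_union measurableSet_Ico Set.Ico_disjoint_Ico_same]
  have h1 : ∫⁻ y in Set.Ico (i : ℝ) (i + 1 / 2), ENNReal.ofReal (y - i) =
      ENNReal.ofReal (1 / 8) := by
    rw [setLIntegral_Ico_ofReal (by linarith) (by fun_prop) fun y hy => by linarith [hy.1]]
    congr 1
    simp
    ring
  have h2 : ∫⁻ y in Set.Ico (i + 1 / 2 : ℝ) (i + 1), ENNReal.ofReal (i + 1 - y) =
      ENNReal.ofReal (1 / 8) := by
    rw [setLIntegral_Ico_ofReal (by linarith) (by fun_prop) fun y hy => by linarith [hy.2]]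
    congr 1
    rw [intervalIntegral.integral_sub (by simp) (by simp)]
    simp
    ring
  have h3 : ENNReal.ofReal (1 / 4) = ENNReal.ofReal (1 / 8) + ENNReal.ofReal (1 / 8) := by
    rw [← ENNReal.ofReal_add (by norm_num) (by norm_num)]
    norm_num
  rw [h3]
  refine add_le_add (h1.symm.trans_le (setLIntegral_mono' measurableSet_Ico fun y hy => ?_))
    (h2.symm.trans_le (setLIntegral_mono' measurableSet_Ico fun y hy => ?_))
  · refine ENNReal.ofReal_le_ofReal ((le_min le_rfl ?_).trans (min_le_intDist i y))
    push_cast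
    linarith [hy.2]
  · refine ENNReal.ofReal_le_ofReal ((le_min ?_ ?_).trans (min_le_intDist i y))
    · push_cast
      linarith [hy.1]
    · push_cast
      rfl

theorem le_setLIntegral_intDist_natCast (m : ℕ) :
    ENNReal.ofReal (m * (1 / 4)) ≤ ∫⁻ y in Set.Ico 0 (m : ℝ), ENNReal.ofReal (intDist y) := by
  induction m with
  | zero => simp
  | succ m ih =>
    have hu : Set.Ico (0 : ℝ) ((m + 1 : ℕ) : ℝ) = Set.Ico 0 (m : ℝ) ∪ Set.Ico (m : ℝ) (m + 1) := by
      rw [Set.Ico_union_Ico_eq_Ico (by positivity) (by linarith)]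
      push_cast
      rfl
    rw [hu, lintegral_union measurableSet_Ico Set.Ico_disjoint_Ico_same, Nat.cast_succ, add_mul,
      one_mul, ENNReal.ofReal_add (by positivity) (by norm_num)]
    exact add_le_add ih (le_setLIntegral_intDist m)

/-- The expected distance of a uniform point of `[0, x]` from the nearest integer is at least a
quarter of the probability that a break of a stick of length `x` changes its integer part. -/
theorem le_lintegral_intDist {x : ℝ} (hx : 0 < x) :
    ENNReal.ofReal x⁻¹ * ENNReal.ofReal (⌊x⌋₊ * (1 / 4)) ≤
      ∫⁻ u : unitInterval, ENNReal.ofReal (intDist (x * u)) := by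
  rw [lintegral_unitInterval_mul (φ := fun y => ENNReal.ofReal (intDist y))
    continuous_intDist.measurable.ennreal_ofReal hx]
  refine mul_le_mul_right ((le_setLIntegral_intDist_natCast _).trans ?_) _
  exact lintegral_mono_set (Set.Ico_subset_Ico_right (Nat.floor_le hx.le))

theorem tsum_comp_sort_whole {h : ℝ → ℝ≥0∞} (h0 : h 0 = 0) :
    ∑' i, h ((sort whole).1 i) = h 1 := by
  rw [Simplex.tsum_comp_rankEntry _ h0, tsum_fintype]
  simp [whole]

theorem measurable_ofReal_intDist : Measurable fun y => ENNReal.ofReal (intDist y) :=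
  continuous_intDist.measurable.ennreal_ofReal

/-- The stick-breaking partition in its form as a limiting partition: the marks are trivial and
the pieces are not cut any further. -/
def stickPartition : Path Unit → Delta := limitPartition fun _ : Unit => sort whole

theorem measurable_stickPartition : Measurable stickPartition :=
  measurable_limitPartition measurable_const

/-- The expected `L¹` distance of the stick-breaking partition, enlarged by a factor `x`, from the
integer lattice is at least a quarter of the harmonic number `H_⌊x⌋`. -/
theorem harmonic_le_lintegral_stickPartition {x : ℝ} (hx : 0 ≤ x) :
    ENNReal.ofReal (1 / 4 * harmonic ⌊x⌋₊) ≤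
      ∫⁻ ω, ∑' i, ENNReal.ofReal (intDist (x * (stickPartition ω).1 i))
        ∂pathLaw (Measure.dirac ()) := by
  refine le_lintegral_tsum_limitPartition (Measure.dirac ()) (z := fun _ => sort whole)
    measurable_const measurable_ofReal_intDist (by simp [intDist])
    (φ := fun x => ENNReal.ofReal (1 / 4 * harmonic ⌊x⌋₊)) (fun x hx => ?_) (C := 1) zero_le_one
    (fun x hx => ?_) hx
  · rcases hx.eq_or_lt with rfl | hx
    · simp
    have h1 : ∀ w : unitInterval × Unit,
        ∑' i, ENNReal.ofReal (intDist (x * w.1 * (sort whole).1 i)) =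
          ENNReal.ofReal (intDist (x * w.1)) := fun w => by
      rw [tsum_comp_sort_whole (h := fun y => ENNReal.ofReal (intDist (x * w.1 * y)))
        (by simp [intDist]), mul_one]
    simp only [h1]
    rw [lintegral_stepLaw_fst _ (f := fun u => ENNReal.ofReal (intDist (x * u)))
      (measurable_ofReal_intDist.comp (by fun_prop))]
    refine le_trans ?_ (add_le_add (le_lintegral_intDist hx) le_rfl)
    have hcr : ENNReal.ofReal x⁻¹ * ENNReal.ofReal (⌊x⌋₊ * (1 / 4)) =
        ∫⁻ w : unitInterval × Unit,
          (fun i => if i < ⌊x⌋₊ then ENNReal.ofReal (1 / 4) else 0) ⌊x * (1 - w.1)⌋₊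
          ∂stepLaw (Measure.dirac ()) := by
      refine Eq.trans ?_ (lintegral_stepLaw_floor (Measure.dirac ())
        (fun i => if i < ⌊x⌋₊ then ENNReal.ofReal (1 / 4) else 0) hx).symm
      rw [Finset.sum_congr rfl fun i hi => if_pos (Finset.mem_range.1 hi)]
      simp [ENNReal.ofReal_mul]
    rw [hcr, ← lintegral_add_left]
    · refine (harmonic_floor_eq (Measure.dirac ()) (fun i =>
        (if i < ⌊x⌋₊ then ENNReal.ofReal (1 / 4) else 0) +
          ENNReal.ofReal (1 / 4 * harmonic i)) hx (by norm_num : (0 : ℝ) ≤ 1 / 4) fun i => ?_).ge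
      rw [mul_add, ENNReal.ofReal_add (by split_ifs <;> norm_num)
        (mul_nonneg (by norm_num) (harmonic_cast_nonneg i))]
      congr 1
      split_ifs <;> simp
    · exact (measurable_from_top (f := fun i : ℕ =>
        if i < ⌊x⌋₊ then ENNReal.ofReal (1 / 4) else 0)).comp
        (Nat.measurable_floor.comp (by fun_prop))
  · refine ENNReal.ofReal_le_ofReal ?_
    have h1 : (harmonic ⌊x⌋₊ : ℝ) ≤ ⌊x⌋₊ := by
      rw [harmonic]
      push_cast
      refine (Finset.sum_le_card_nsmul _ _ 1 fun i _ => ?_).trans_eq (by simp)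
      exact inv_le_one_of_one_le₀ (by linarith [(Nat.cast_nonneg i : (0 : ℝ) ≤ i)])
    linarith [Nat.floor_le hx]

theorem log_sq_div_eight_le {x : ℝ} (hx : 1 ≤ x) : Real.log x ^ 2 / 8 ≤ x := by
  have h1 := Real.log_le_sub_one_of_pos (Real.sqrt_pos.2 (by linarith : 0 < x))
  rw [Real.log_sqrt (by linarith)] at h1
  have h2 := Real.log_nonneg hx
  have h3 := Real.sq_sqrt (by linarith : 0 ≤ x)
  nlinarith [Real.sqrt_nonneg x]

/-- The function `log² x / 8` solves the stick-breaking equation with cost `log (x u) / 4`. -/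
theorem integral_log_add_log_sq {x : ℝ} (hx : 1 ≤ x) :
    ∫ y in (1 : ℝ)..x, (Real.log y / 4 + Real.log y ^ 2 / 8) = x * (Real.log x ^ 2 / 8) := by
  have hpos : ∀ y ∈ Set.uIcc 1 x, y ≠ 0 := fun y hy => by
    rw [Set.uIcc_of_le hx] at hy
    linarith [hy.1]
  have hlog : ContinuousOn Real.log (Set.uIcc 1 x) := Real.continuousOn_log.mono hpos
  rw [intervalIntegral.integral_eq_sub_of_hasDerivAt
    (f := fun y => y * (Real.log y ^ 2 / 8)) (fun y hy => ?_)]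
  · simp
  · exact ((hlog.div_const 4).add ((hlog.pow 2).div_const 8)).intervalIntegrable
  · have h := (hasDerivAt_id y).mul (((Real.hasDerivAt_log (hpos y hy)).pow 2).div_const 8)
    refine h.congr_deriv ?_
    have := hpos y hy
    simp only [id, Pi.pow_apply]
    field_simp
    ring

/-- The square of the logarithm is subharmonic for the cost that bounds the distance of a
stick-breaking partition from the lattice. -/
theorem log_sq_le_lintegral {φ : ℝ → ℝ≥0∞}
    (hφ : ∀ x, 0 ≤ x → φ x = if 1 ≤ x then ENNReal.ofReal (Real.log x ^ 2 / 8) else 0)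
    {x : ℝ} (hx : 1 ≤ x) :
    φ x ≤ (∫⁻ u : unitInterval, ENNReal.ofReal (Real.log (x * u) / 4)) +
      ∫⁻ u : unitInterval, φ (x * (1 - u)) := by
  have hx0 : 0 < x := by linarith
  let ψ : ℝ → ℝ≥0∞ := fun x => if 1 ≤ x then ENNReal.ofReal (Real.log x ^ 2 / 8) else 0
  have hψ : Measurable ψ := Measurable.ite measurableSet_Ici
    (((Real.measurable_log.pow_const 2).div_const 8).ennreal_ofReal) measurable_const
  have h1 : ∀ u : unitInterval, φ (x * (1 - u)) = ψ (x * (1 - u)) := fun u =>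
    hφ _ (mul_nonneg hx0.le (sub_nonneg.2 u.2.2))
  have hl : Measurable fun y => ENNReal.ofReal (Real.log y / 4) :=
    (Real.measurable_log.div_const 4).ennreal_ofReal
  simp only [h1]
  rw [lintegral_unitInterval_mul (φ := fun y => ENNReal.ofReal (Real.log y / 4)) hl hx0,
    lintegral_unitInterval_mul_symm hψ hx0, ← mul_add, ← lintegral_add_left hl, hφ x hx0.le,
    if_pos hx]
  have hlow : ENNReal.ofReal (x * (Real.log x ^ 2 / 8)) ≤
      ∫⁻ y in Set.Ico 0 x, (ENNReal.ofReal (Real.log y / 4) + ψ y) := by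
    refine le_trans ?_ (lintegral_mono_set (Set.Ico_subset_Ico_left zero_le_one))
    have hc : ContinuousOn Real.log (Set.Icc 1 x) :=
      Real.continuousOn_log.mono fun y hy => by
        have := hy.1
        simp only [Set.mem_compl_iff, Set.mem_singleton_iff]
        linarith
    rw [← integral_log_add_log_sq hx, ← setLIntegral_Ico_ofReal
      (F := fun y => Real.log y / 4 + Real.log y ^ 2 / 8) hx
      ((hc.div_const 4).add ((hc.pow 2).div_const 8)) fun y hy => by
        have := Real.log_nonneg hy.1
        positivity]
    refine setLIntegral_mono' measurableSet_Ico fun y hy => ?_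
    have := Real.log_nonneg hy.1
    rw [ENNReal.ofReal_add (by positivity) (by positivity)]
    simp only [ψ, if_pos hy.1]
    exact le_rfl
  refine le_trans (le_of_eq ?_) (mul_le_mul_right hlow _)
  rw [← ENNReal.ofReal_mul (by positivity)]
  congr 1
  field_simp

/-- The random partition of square cutting: the pieces of a stick-breaking sequence are cut in the
proportions of independent stick-breaking partitions. -/
def squarePartition : Path (Path Unit) → Delta := limitPartition stickPartition

theorem measurable_squarePartition : Measurable squarePartition :=
  measurable_limitPartition measurable_stickPartition

/-- Since `log x ≤ H_⌊x⌋`, the expected `L¹` distance of the square-cutting partition, enlarged by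
a factor `x`, from the integer lattice is at least `log² x / 8`. -/
theorem log_sq_le_lintegral_squarePartition {x : ℝ} (hx : 1 ≤ x) :
    ENNReal.ofReal (Real.log x ^ 2 / 8) ≤
      ∫⁻ ω, ∑' i, ENNReal.ofReal (intDist (x * (squarePartition ω).1 i))
        ∂pathLaw (pathLaw (Measure.dirac ())) := by
  let φ : ℝ → ℝ≥0∞ := fun x => if 1 ≤ x then ENNReal.ofReal (Real.log x ^ 2 / 8) else 0
  have hφx : φ x = ENNReal.ofReal (Real.log x ^ 2 / 8) := if_pos hx
  have hφm : Measurable φ := Measurable.ite measurableSet_Ici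
    (((Real.measurable_log.pow_const 2).div_const 8).ennreal_ofReal) measurable_const
  rw [← hφx]
  refine le_lintegral_tsum_limitPartition (pathLaw (Measure.dirac ()))
    measurable_stickPartition measurable_ofReal_intDist (by simp [intDist]) (fun x hx => ?_)
    (C := 1) zero_le_one (fun x hx => ?_) (zero_le_one.trans hx)
  · rcases lt_or_ge x 1 with h1 | h1
    · simp [φ, not_le.2 h1]
    refine (log_sq_le_lintegral (φ := φ) (fun _ _ => rfl) h1).trans ?_
    rw [lintegral_stepLaw_fst _ (f := fun u => φ (x * (1 - u))) (hφm.comp (by fun_prop))]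
    refine add_le_add ?_ le_rfl
    rw [lintegral_prod]
    · refine lintegral_mono fun u => ?_
      have hxu : 0 ≤ x * (u : ℝ) := mul_nonneg hx u.2.1
      refine le_trans (ENNReal.ofReal_le_ofReal ?_) (harmonic_le_lintegral_stickPartition hxu)
      have := log_le_harmonic_floor (x * u) hxu
      linarith
    · refine (Measurable.tsum fun i => measurable_ofReal_intDist.comp
        (Measurable.mul (by fun_prop) ?_)).aemeasurable
      exact (measurable_coord i).comp (measurable_stickPartition.comp measurable_snd)
  · simp only [φ]
    split_ifs with h
    · rw [one_mul]
      exact ENNReal.ofReal_le_ofReal (log_sq_div_eight_le h)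
    · exact zero_le

/-! ### Cycle counts of block permutations -/

section CycleCount

variable {α β : Type*}

/-- The contribution of a point on a cycle of length `c` to the number of cycles of length greater
than `t`. -/
def periodWeight (c : ℕ) (t : ℝ) : ℝ≥0∞ := if t < c then (c : ℝ≥0∞)⁻¹ else 0

/-- The number of cycles of length greater than `t` of a permutation `f` of a finite set, as a sum
over the points of the set. -/
def cycleCount [Fintype α] (f : α → α) (t : ℝ) : ℝ≥0∞ :=
  ∑ p, periodWeight (Function.minimalPeriod f p) t

theorem minimalPeriod_eq_of_semiconj {f : α → α} {f' : β → β} {E : α → β} (hE : E.Injective)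
    {x : α} (h : ∀ n, E (f^[n] x) = f'^[n] (E x)) :
    Function.minimalPeriod f' (E x) = Function.minimalPeriod f x := by
  rw [Function.minimalPeriod_eq_minimalPeriod_iff]
  intro n
  rw [Function.IsPeriodicPt, Function.IsFixedPt, ← h, hE.eq_iff]
  rfl

theorem cycleCount_conj [Fintype α] [Fintype β] (e : α ≃ β) {f : α → α} {f' : β → β}
    (h : ∀ x, e (f x) = f' (e x)) : cycleCount f' = cycleCount f := by
  funext t
  refine (Fintype.sum_equiv e _ _ fun x => ?_).symm
  rw [minimalPeriod_eq_of_semiconj e.injective fun n =>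
    (Function.Semiconj.iterate_right (show Function.Semiconj e f f' from h) n) x]

theorem minimalPeriod_perm_eq_card [Finite α] (σ : Equiv.Perm α) (p : α) :
    Function.minimalPeriod σ p =
      Nat.card {a : α // Quotient.mk (Equiv.Perm.SameCycle.setoid σ) a = Quotient.mk _ p} := by
  have := Fintype.ofFinite (MulAction.orbit (Subgroup.zpowers σ) p)
  have h := MulAction.minimalPeriod_eq_card (a := σ) (b := p)
  change Function.minimalPeriod σ p = _ at h
  rw [h, ← Nat.card_eq_fintype_card]
  refine Nat.card_congr (Equiv.subtypeEquivRight fun a => ?_)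
  rw [Quotient.eq]
  change _ ↔ σ.SameCycle a p
  rw [Equiv.Perm.sameCycle_comm]
  constructor
  · rintro ⟨⟨_, i, rfl⟩, rfl⟩
    exact ⟨i, rfl⟩
  · rintro ⟨i, rfl⟩
    exact ⟨⟨_, i, rfl⟩, rfl⟩

theorem partCount_cycleSimplex [Fintype α] [Nonempty α] (σ : Equiv.Perm α) (t : ℝ) :
    partCount (cycleSimplex σ).1 t = cycleCount σ (t * Fintype.card α) := by
  classical
  have := Fintype.ofFinite (Quotient (Equiv.Perm.SameCycle.setoid σ))
  have hα : (0 : ℝ) < Fintype.card α := Nat.cast_pos.2 Fintype.card_pos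
  rw [partCount, tsum_fintype, cycleCount,
    ← Fintype.sum_fiberwise (Quotient.mk (Equiv.Perm.SameCycle.setoid σ))]
  refine Finset.sum_congr rfl fun q _ => ?_
  have h1 : ∀ p : {a : α // Quotient.mk (Equiv.Perm.SameCycle.setoid σ) a = q},
      periodWeight (Function.minimalPeriod σ p.1) (t * Fintype.card α) = periodWeight (Nat.card
        {a : α // Quotient.mk (Equiv.Perm.SameCycle.setoid σ) a = q}) (t * Fintype.card α) := by
    rintro ⟨p, rfl⟩
    rw [minimalPeriod_perm_eq_card]
  rw [Finset.sum_congr rfl fun p _ => h1 p, Finset.sum_const, Finset.card_univ, nsmul_eq_mul,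
    ← Nat.card_eq_fintype_card, periodWeight]
  have h2 : 0 < Nat.card {a : α // Quotient.mk (Equiv.Perm.SameCycle.setoid σ) a = q} := by
    obtain ⟨p, rfl⟩ := Quotient.exists_rep q
    have : Nonempty {a : α // Quotient.mk (Equiv.Perm.SameCycle.setoid σ) a = ⟦p⟧} := ⟨⟨p, rfl⟩⟩
    exact Nat.card_pos
  have h3 : t < (cycleSimplex σ).1 q ↔ t * Fintype.card α < Nat.card
      {a : α // Quotient.mk (Equiv.Perm.SameCycle.setoid σ) a = q} := by
    rw [← lt_div_iff₀ hα, ← Nat.card_eq_fintype_card]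
    rfl
  simp only [h3]
  split_ifs
  · exact (ENNReal.mul_inv_cancel (by exact_mod_cast h2.ne') (by finiteness)).symm
  · simp

/-- The permutation of `α × β` that moves the block `{x} × β` to the block `{h x} × β` and then
permutes each block `{y} × β` by `g y`. -/
def blockPerm (g : α → Equiv.Perm β) (h : Equiv.Perm α) : Equiv.Perm (α × β) where
  toFun p := (h p.1, g (h p.1) p.2)
  invFun p := (h⁻¹ p.1, (g p.1)⁻¹ p.2)
  left_inv p := by simp
  right_inv p := by simp

theorem blockPerm_apply (g : α → Equiv.Perm β) (h : Equiv.Perm α) (x : α) (b : β) :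
    blockPerm g h (x, b) = (h x, g (h x) b) := rfl

theorem fst_iterate_blockPerm (g : α → Equiv.Perm β) (h : Equiv.Perm α) (n : ℕ) (p : α × β) :
    ((blockPerm g h)^[n] p).1 = h^[n] p.1 :=
  Function.Semiconj.iterate_right (f := Prod.fst) (ga := blockPerm g h) (gb := h)
    (fun _ => rfl) n p

/-- The cycle count of the first return map of `blockPerm g h` to the block `{a} × β`. -/
def holCount [Fintype β] (g : α → Equiv.Perm β) (h : Equiv.Perm α) (a : α) (t : ℝ) : ℝ≥0∞ :=
  ∑ b : β, periodWeight
    (Function.minimalPeriod ((blockPerm g h)^[Function.minimalPeriod h a]) (a, b)) t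

open Classical in
/-- The cycle count of `blockPerm g h` outside the blocks on the cycle of `a`. -/
def restCount [Fintype α] [Fintype β] (g : α → Equiv.Perm β) (h : Equiv.Perm α) (a : α) (t : ℝ) :
    ℝ≥0∞ :=
  ∑ p : α × β, if ∃ j, h^[j] a = p.1 then 0 else
    periodWeight (Function.minimalPeriod (blockPerm g h) p) t

theorem exists_iterate_eq_symm [Finite α] {h : Equiv.Perm α} {a x : α} (n : ℕ) (hn : h^[n] x = a) :
    ∃ j, h^[j] a = x := by
  have hx : 0 < Function.minimalPeriod h x :=
    Function.minimalPeriod_pos_of_mem_periodicPts (h.injective.mem_periodicPts x)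
  refine ⟨(Function.minimalPeriod h x - 1) * n, ?_⟩
  rw [← hn, ← Function.iterate_add_apply]
  have : (Function.minimalPeriod h x - 1) * n + n = Function.minimalPeriod h x * n := by
    obtain ⟨m, hm⟩ := Nat.exists_eq_succ_of_ne_zero hx.ne'
    rw [hm, Nat.succ_eq_add_one, Nat.add_sub_cancel]
    ring
  rw [this]
  exact (Function.isPeriodicPt_minimalPeriod h x).mul_const n

theorem minimalPeriod_perm_pos [Finite α] (h : Equiv.Perm α) (a : α) :
    0 < Function.minimalPeriod h a :=
  Function.minimalPeriod_pos_of_mem_periodicPts (h.injective.mem_periodicPts a)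

theorem mul_periodWeight_mul {l m : ℕ} (hl : 0 < l) (t : ℝ) :
    (l : ℝ≥0∞) * periodWeight (l * m) t = periodWeight m (t / l) := by
  have hl' : (0 : ℝ) < l := Nat.cast_pos.2 hl
  have h : t < ((l * m : ℕ) : ℝ) ↔ t / l < m := by
    rw [div_lt_iff₀ hl', Nat.cast_mul, mul_comm (l : ℝ)]
  rw [periodWeight, periodWeight]
  simp only [h]
  split_ifs
  · rw [Nat.cast_mul, ENNReal.mul_inv (Or.inr (by finiteness)) (Or.inl (by finiteness)),
      ← mul_assoc, ENNReal.mul_inv_cancel (by exact_mod_cast hl.ne') (by finiteness), one_mul]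
  · simp

/-- A cycle of points winds around the cycle of blocks as often as the first return map needs to
come back. -/
theorem minimalPeriod_blockPerm [Finite α] [Finite β] (g : α → Equiv.Perm β) (h : Equiv.Perm α)
    (a : α) (b : β) : Function.minimalPeriod (blockPerm g h) (a, b) = Function.minimalPeriod h a *
      Function.minimalPeriod ((blockPerm g h)^[Function.minimalPeriod h a]) (a, b) := by
  have hd : Function.minimalPeriod h a ∣ Function.minimalPeriod (blockPerm g h) (a, b) := by
    refine Function.IsPeriodicPt.minimalPeriod_dvd ?_
    have := Function.isPeriodicPt_minimalPeriod (blockPerm g h) (a, b)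
    have h2 := congrArg Prod.fst this.eq
    rw [fst_iterate_blockPerm] at h2
    exact h2
  rw [Function.minimalPeriod_iterate_eq_div_gcd (minimalPeriod_perm_pos h a).ne',
    Nat.gcd_eq_right hd, Nat.mul_div_cancel' hd]

/-- The block `{h^[j] a} × β` contributes as many cycles as the block `{a} × β`. -/
theorem sum_periodWeight_block [Finite α] [Fintype β] (g : α → Equiv.Perm β)
    (h : Equiv.Perm α) (a : α) (t : ℝ) (j : ℕ) :
    ∑ b : β, periodWeight (Function.minimalPeriod (blockPerm g h) (h^[j] a, b)) t =
      ∑ b : β, periodWeight (Function.minimalPeriod (blockPerm g h) (a, b)) t := by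
  induction j with
  | zero => rfl
  | succ j ih =>
    rw [← ih]
    refine (Fintype.sum_equiv (g (h^[j + 1] a)) _ _ fun b => ?_).symm
    rw [Function.iterate_succ_apply', ← blockPerm_apply,
      Function.minimalPeriod_apply ((blockPerm g h).injective.mem_periodicPts _)]

/-- The cycles that pass through the block `a` are the cycles of the first return map to this block,
longer by the number of blocks on the cycle of `a`. -/
theorem cycleCount_blockPerm [Fintype α] [Fintype β] (g : α → Equiv.Perm β) (h : Equiv.Perm α)
    (a : α) (t : ℝ) : cycleCount (blockPerm g h) t =
      holCount g h a (t / Function.minimalPeriod h a) + restCount g h a t := by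
  classical
  have h1 : ∀ p : α × β, periodWeight (Function.minimalPeriod (blockPerm g h) p) t =
      (if ∃ j, h^[j] a = p.1 then periodWeight (Function.minimalPeriod (blockPerm g h) p) t else 0)
      + if ∃ j, h^[j] a = p.1 then 0 else
        periodWeight (Function.minimalPeriod (blockPerm g h) p) t := by
    intro p; split_ifs <;> simp
  rw [cycleCount, Finset.sum_congr rfl fun p _ => h1 p, Finset.sum_add_distrib, restCount]
  congr 1
  have h2 : Finset.univ.filter (fun x => ∃ j, h^[j] a = x) =
      (Finset.range (Function.minimalPeriod h a)).image fun j => h^[j] a := by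
    ext x
    simp only [Finset.mem_filter, Finset.mem_univ, true_and, Finset.mem_image, Finset.mem_range]
    constructor
    · rintro ⟨j, rfl⟩
      exact ⟨j % Function.minimalPeriod h a, Nat.mod_lt _ (minimalPeriod_perm_pos h a),
        Function.iterate_mod_minimalPeriod_eq⟩
    · rintro ⟨j, -, rfl⟩
      exact ⟨j, rfl⟩
  rw [Fintype.sum_prod_type]
  have h3 : ∀ x : α, (∑ b : β, if ∃ j, h^[j] a = x then
      periodWeight (Function.minimalPeriod (blockPerm g h) (x, b)) t else 0) =
      if ∃ j, h^[j] a = x then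
        ∑ b : β, periodWeight (Function.minimalPeriod (blockPerm g h) (x, b)) t else 0 := by
    intro x; split_ifs <;> simp
  rw [Finset.sum_congr rfl fun x _ => h3 x, ← Finset.sum_filter, h2, Finset.sum_image]
  · rw [Finset.sum_congr rfl fun j _ => sum_periodWeight_block g h a t j, Finset.sum_const,
      Finset.card_range, nsmul_eq_mul, Finset.mul_sum, holCount]
    refine Finset.sum_congr rfl fun b _ => ?_
    rw [minimalPeriod_blockPerm, mul_periodWeight_mul (minimalPeriod_perm_pos h a)]
  · intro i hi j hj hij
    exact Function.iterate_injOn_Iio_minimalPeriod (by simpa using hi) (by simpa using hj) hij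

end CycleCount

/-! ### Inserting a marked point into a cycle -/

section Insertion

variable {α α' β : Type*}

theorem minimalPeriod_conj (e : α ≃ α') (h : Equiv.Perm α) (a : α) :
    Function.minimalPeriod (e.permCongr h) (e a) = Function.minimalPeriod h a :=
  minimalPeriod_eq_of_semiconj e.injective fun n =>
    (Function.Semiconj.iterate_right (f := e) (ga := h) (gb := e.permCongr h)
      (fun x => by simp) n) a

theorem semiconj_blockPerm (e : α ≃ α') (g : α → Equiv.Perm β) (h : Equiv.Perm α) :
    Function.Semiconj (fun p : α × β => (e p.1, p.2)) (blockPerm g h)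
      (blockPerm (g ∘ e.symm) (e.permCongr h)) := by
  rintro ⟨x, b⟩
  simp [blockPerm_apply]

theorem holCount_conj [Fintype β] (e : α ≃ α') (g : α → Equiv.Perm β) (h : Equiv.Perm α) (a : α) :
    holCount (g ∘ e.symm) (e.permCongr h) (e a) = holCount g h a := by
  have hE : Function.Injective fun p : α × β => (e p.1, p.2) := by
    rintro ⟨x, b⟩ ⟨y, c⟩ hxy
    simpa using hxy
  funext t
  refine Finset.sum_congr rfl fun b _ => ?_
  rw [minimalPeriod_conj, minimalPeriod_eq_of_semiconj (x := (a, b)) hE fun n =>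
    ((semiconj_blockPerm e g h).iterate_right _).iterate_right n _]

theorem restCount_conj [Fintype α] [Fintype α'] [Fintype β] (e : α ≃ α')
    (g : α → Equiv.Perm β) (h : Equiv.Perm α) (a : α) :
    restCount (g ∘ e.symm) (e.permCongr h) (e a) = restCount g h a := by
  classical
  have hE : Function.Injective fun p : α × β => (e p.1, p.2) := by
    rintro ⟨x, b⟩ ⟨y, c⟩ hxy
    simpa using hxy
  funext t
  refine (Fintype.sum_equiv (e.prodCongr (Equiv.refl β)) _ _ fun p => ?_).symm
  have h1 : (∃ j, (e.permCongr h)^[j] (e a) = e p.1) ↔ ∃ j, h^[j] a = p.1 := by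
    refine exists_congr fun j => ?_
    rw [← (Function.Semiconj.iterate_right (f := e) (ga := h) (gb := e.permCongr h)
      (fun x => by simp) j) a, e.injective.eq_iff]
  have h2 : Function.minimalPeriod (blockPerm (g ∘ e.symm) (e.permCongr h)) (e p.1, p.2) =
      Function.minimalPeriod (blockPerm g h) p :=
    minimalPeriod_eq_of_semiconj (x := p) hE fun n =>
      ((semiconj_blockPerm e g h).iterate_right n) p
  change _ = if ∃ j, (e.permCongr h)^[j] (e a) = e p.1 then 0 else
    periodWeight (Function.minimalPeriod _ (e p.1, p.2)) t
  rw [h2]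
  simp only [h1]

theorem iterate_ne_of_lt_minimalPeriod {h : Equiv.Perm α} {a : α} {j : ℕ}
    (hj : j + 1 < Function.minimalPeriod h a) : h^[j + 1] a ≠ a := fun hc =>
  Function.not_isPeriodicPt_of_pos_of_lt_minimalPeriod (by omega) hj hc

theorem injective_some_prod : Function.Injective fun p : α × β => (some p.1, p.2) := by
  rintro ⟨x, b⟩ ⟨y, c⟩ hxy
  simpa using hxy

variable [DecidableEq α]

/-- The permutation of `Option α` obtained from a permutation of `α` by inserting the new point
`none` before the point `a`, in the cycle of `a`. -/
def insertBefore (h : Equiv.Perm α) (a : α) : Equiv.Perm (Option α) :=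
  Equiv.Perm.decomposeOption.symm (some a, h)

theorem insertBefore_none (h : Equiv.Perm α) (a : α) : insertBefore h a none = some a := by
  simp [insertBefore]

theorem insertBefore_some (h : Equiv.Perm α) (a x : α) :
    insertBefore h a (some x) = if h x = a then none else some (h x) := by
  simp [insertBefore, Equiv.swap_apply_def]

theorem iterate_insertBefore_some {h : Equiv.Perm α} {a x : α} {n : ℕ}
    (hx : ∀ j < n, h^[j + 1] x ≠ a) : (insertBefore h a)^[n] (some x) = some (h^[n] x) := by
  induction n with
  | zero => rfl
  | succ n ih =>
    rw [Function.iterate_succ_apply', ih fun j hj => hx j (by omega), insertBefore_some,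
      Function.iterate_succ_apply', if_neg]
    rw [← Function.iterate_succ_apply' h]
    exact hx n (by omega)

theorem iterate_insertBefore_none {h : Equiv.Perm α} {a : α} {n : ℕ}
    (hn : n < Function.minimalPeriod h a) : (insertBefore h a)^[n + 1] none = some (h^[n] a) := by
  rw [Function.iterate_succ_apply, insertBefore_none, iterate_insertBefore_some]
  exact fun j hj => iterate_ne_of_lt_minimalPeriod (by omega)

theorem minimalPeriod_insertBefore [Finite α] (h : Equiv.Perm α) (a : α) :
    Function.minimalPeriod (insertBefore h a) none = Function.minimalPeriod h a + 1 := by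
  have hpos := minimalPeriod_perm_pos h a
  have hp : Function.IsPeriodicPt (insertBefore h a) (Function.minimalPeriod h a + 1) none := by
    obtain ⟨m, hm⟩ := Nat.exists_eq_succ_of_ne_zero hpos.ne'
    rw [hm, Function.IsPeriodicPt, Function.IsFixedPt, Function.iterate_succ_apply',
      iterate_insertBefore_none (by omega), insertBefore_some, if_pos]
    rw [← Function.iterate_succ_apply' h, ← hm]
    exact Function.isPeriodicPt_minimalPeriod h a
  refine le_antisymm (hp.minimalPeriod_le (by omega)) ?_
  by_contra! hlt
  have h0 := hp.minimalPeriod_pos (by omega)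
  obtain ⟨m, hm⟩ := Nat.exists_eq_succ_of_ne_zero h0.ne'
  have h1 := Function.isPeriodicPt_minimalPeriod (insertBefore h a) none
  rw [hm] at h1 hlt
  rw [Function.IsPeriodicPt, Function.IsFixedPt, iterate_insertBefore_none (by omega)] at h1
  simp at h1

/-- The permutations of the blocks left when the block `none` is removed from the cycle of blocks:
what happens in the removed block is composed with what happens in its successor `a`. -/
def contractBlock (G : Option α → Equiv.Perm β) (a : α) : α → Equiv.Perm β :=
  (fun x => G (some x)) * Pi.mulSingle a (G none)

theorem contractBlock_self (G : Option α → Equiv.Perm β) (a : α) :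
    contractBlock G a a = G (some a) * G none := by
  simp [contractBlock]

theorem contractBlock_of_ne (G : Option α → Equiv.Perm β) {a x : α} (hx : x ≠ a) :
    contractBlock G a x = G (some x) := by
  simp [contractBlock, hx]

variable (G : Option α → Equiv.Perm β) (h : Equiv.Perm α) (a : α)

theorem blockPerm_insertBefore_of_ne {x : α} (hx : h x ≠ a) (b : β) :
    blockPerm G (insertBefore h a) (some x, b) =
      (some (blockPerm (contractBlock G a) h (x, b)).1,
        (blockPerm (contractBlock G a) h (x, b)).2) := by
  rw [blockPerm_apply, blockPerm_apply, insertBefore_some, if_neg hx, contractBlock_of_ne G hx]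

theorem blockPerm_insertBefore_of_eq {x : α} (hx : h x = a) (b : β) :
    blockPerm G (insertBefore h a) (blockPerm G (insertBefore h a) (some x, b)) =
      (some (blockPerm (contractBlock G a) h (x, b)).1,
        (blockPerm (contractBlock G a) h (x, b)).2) := by
  rw [blockPerm_apply G _ (some x), insertBefore_some, if_pos hx, blockPerm_apply,
    insertBefore_none, blockPerm_apply, hx, contractBlock_self]
  rfl

theorem iterate_blockPerm_insertBefore {x : α} {n : ℕ} (hx : ∀ j < n, h^[j + 1] x ≠ a) (b : β) :
    (blockPerm G (insertBefore h a))^[n] (some x, b) =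
      (some ((blockPerm (contractBlock G a) h)^[n] (x, b)).1,
        ((blockPerm (contractBlock G a) h)^[n] (x, b)).2) := by
  induction n with
  | zero => rfl
  | succ n ih =>
    rw [Function.iterate_succ_apply', ih fun j hj => hx j (by omega),
      blockPerm_insertBefore_of_ne, Function.iterate_succ_apply']
    rw [fst_iterate_blockPerm, ← Function.iterate_succ_apply' h]
    exact hx n (by omega)

/-- The first return map to the block `a` does not notice the inserted block. -/
theorem return_blockPerm_insertBefore [Finite α] (b : β) :
    (blockPerm G (insertBefore h a))^[Function.minimalPeriod h a + 1] (some a, b) =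
      (some ((blockPerm (contractBlock G a) h)^[Function.minimalPeriod h a] (a, b)).1,
        ((blockPerm (contractBlock G a) h)^[Function.minimalPeriod h a] (a, b)).2) := by
  obtain ⟨m, hm⟩ := Nat.exists_eq_succ_of_ne_zero (minimalPeriod_perm_pos h a).ne'
  have ha := Function.isPeriodicPt_minimalPeriod h a
  rw [hm, Nat.succ_eq_add_one] at ha ⊢
  rw [Function.iterate_succ_apply', Function.iterate_succ_apply',
    iterate_blockPerm_insertBefore G h a fun j hj => iterate_ne_of_lt_minimalPeriod (by omega),
    blockPerm_insertBefore_of_eq, Function.iterate_succ_apply' (blockPerm (contractBlock G a) h)]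
  rw [fst_iterate_blockPerm, ← Function.iterate_succ_apply' h]
  exact ha

theorem holCount_insertBefore [Finite α] [Fintype β] :
    holCount G (insertBefore h a) none = holCount (contractBlock G a) h a := by
  funext t
  rw [holCount, holCount, minimalPeriod_insertBefore]
  refine Fintype.sum_equiv (G (some a)) _ _ fun b => ?_
  have h1 := minimalPeriod_eq_of_semiconj
    (f := (blockPerm G (insertBefore h a))^[Function.minimalPeriod h a + 1])
    (f' := (blockPerm G (insertBefore h a))^[Function.minimalPeriod h a + 1])
    (blockPerm G (insertBefore h a)).injective (x := (none, b)) fun n =>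
      ((Function.Semiconj.iterate_right (show Function.Semiconj _ _ _ from fun _ => rfl)
        _).iterate_right n) _
  -- the first return map to the block `none` is conjugate, by one step, to that of the block `a`
  rw [← h1, blockPerm_apply, insertBefore_none]
  congr 1
  have key : ∀ n c, ∃ d,
      ((blockPerm (contractBlock G a) h)^[Function.minimalPeriod h a])^[n] (a, c) = (a, d) ∧
      ((blockPerm G (insertBefore h a))^[Function.minimalPeriod h a + 1])^[n] (some a, c)
        = (some a, d) := by
    intro n c
    induction n with
    | zero => exact ⟨c, rfl, rfl⟩
    | succ n ih =>
      obtain ⟨d, hd, hd'⟩ := ih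
      have h2 : ((blockPerm (contractBlock G a) h)^[Function.minimalPeriod h a] (a, d)).1 = a := by
        rw [fst_iterate_blockPerm]
        exact Function.isPeriodicPt_minimalPeriod h a
      refine ⟨((blockPerm (contractBlock G a) h)^[Function.minimalPeriod h a] (a, d)).2, ?_, ?_⟩
      · rw [Function.iterate_succ_apply', hd]
        exact Prod.ext h2 rfl
      · rw [Function.iterate_succ_apply', hd', return_blockPerm_insertBefore, h2]
  refine minimalPeriod_eq_of_semiconj (x := (a, G (some a) b)) injective_some_prod fun n => ?_
  obtain ⟨d, hd, hd'⟩ := key n (G (some a) b)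
  rw [hd]
  exact hd'.symm

theorem exists_iterate_insertBefore_iff [Finite α] (x : α) :
    (∃ j, (insertBefore h a)^[j] none = some x) ↔ ∃ j, h^[j] a = x := by
  constructor
  · intro hj
    by_contra hc
    obtain ⟨j, hj⟩ := hj
    obtain ⟨i, hi⟩ := exists_iterate_eq_symm j hj
    rw [iterate_insertBefore_some] at hi
    · simp at hi
    · exact fun i _ hi' => hc (exists_iterate_eq_symm _ hi')
  · rintro ⟨j, rfl⟩
    refine ⟨j % Function.minimalPeriod h a + 1, ?_⟩
    rw [iterate_insertBefore_none (Nat.mod_lt _ (minimalPeriod_perm_pos h a)),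
      Function.iterate_mod_minimalPeriod_eq]

theorem restCount_insertBefore [Fintype α] [Fintype β] :
    restCount G (insertBefore h a) none = restCount (contractBlock G a) h a := by
  classical
  funext t
  rw [restCount, restCount, Fintype.sum_prod_type, Fintype.sum_option, Fintype.sum_prod_type]
  have h0 : ∃ j, (insertBefore h a)^[j] none = none := ⟨0, rfl⟩
  simp only [h0, if_true, Finset.sum_const_zero, zero_add, exists_iterate_insertBefore_iff]
  refine Finset.sum_congr rfl fun x _ => Finset.sum_congr rfl fun b _ => ?_
  split_ifs with hx
  · rfl
  · congr 1
    refine minimalPeriod_eq_of_semiconj (x := (x, b)) injective_some_prod fun n => ?_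
    exact (iterate_blockPerm_insertBefore G h a
      (fun j _ hj => hx (exists_iterate_eq_symm _ hj)) b).symm

end Insertion

section NewCycle

variable {α β : Type*} (G : Option α → Equiv.Perm β) (h : Equiv.Perm α)

theorem semiconj_optionCongr : Function.Semiconj (fun p : α × β => (some p.1, p.2))
    (blockPerm (fun x => G (some x)) h) (blockPerm G h.optionCongr) := by
  rintro ⟨x, b⟩
  simp [blockPerm_apply]

theorem minimalPeriod_optionCongr_none : Function.minimalPeriod h.optionCongr none = 1 := by
  rw [Function.minimalPeriod_eq_one_iff_isFixedPt]
  simp [Function.IsFixedPt]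

theorem holCount_optionCongr [Fintype β] : holCount G h.optionCongr none = cycleCount (G none) := by
  funext t
  rw [holCount, minimalPeriod_optionCongr_none, Function.iterate_one]
  refine Finset.sum_congr rfl fun b _ => ?_
  congr 1
  refine minimalPeriod_eq_of_semiconj (f := G none) (E := fun b : β => ((none : Option α), b))
    (fun _ _ hbc => by simpa using hbc) fun n => ?_
  exact (Function.Semiconj.iterate_right (fun b => by simp [blockPerm_apply]) n) b

theorem restCount_optionCongr [Fintype α] [Fintype β] :
    restCount G h.optionCongr none = cycleCount (blockPerm (fun x => G (some x)) h) := by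
  classical
  funext t
  rw [restCount, cycleCount, Fintype.sum_prod_type, Fintype.sum_option, Fintype.sum_prod_type]
  have h0 : ∀ j, h.optionCongr^[j] none = none := fun j =>
    Function.iterate_fixed (by simp) j
  simp only [h0, exists_const, if_true, Finset.sum_const_zero, zero_add, reduceCtorEq, if_false]
  refine Finset.sum_congr rfl fun x _ => Finset.sum_congr rfl fun b _ => ?_
  congr 1
  exact minimalPeriod_eq_of_semiconj (x := (x, b)) injective_some_prod fun n =>
    (semiconj_optionCongr G h).iterate_right n _

end NewCycle

/-! ### The blocks of a marked cycle under the uniform measure -/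

section Mean

variable {ι κ : Type*} [Fintype ι] [Fintype κ]

/-- The average of a function on a finite set. -/
def mean (f : ι → ℝ≥0∞) : ℝ≥0∞ := (Fintype.card ι : ℝ≥0∞)⁻¹ * ∑ i, f i

theorem mean_equiv (e : ι ≃ κ) (f : κ → ℝ≥0∞) : (mean fun i => f (e i)) = mean f := by
  rw [mean, mean, Fintype.card_congr e, e.sum_comp]

theorem mean_prod (f : ι × κ → ℝ≥0∞) : mean f = mean fun i => mean fun j => f (i, j) := by
  rw [mean, mean, Fintype.card_prod, Fintype.sum_prod_type, Nat.cast_mul,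
    ENNReal.mul_inv (Or.inr (by finiteness)) (Or.inl (by finiteness)), mul_assoc, Finset.mul_sum]
  rfl

theorem mean_comm (f : ι → κ → ℝ≥0∞) :
    (mean fun i => mean fun j => f i j) = mean fun j => mean fun i => f i j := by
  rw [← mean_prod fun p : ι × κ => f p.1 p.2, ← mean_prod fun p : κ × ι => f p.2 p.1,
    ← mean_equiv (Equiv.prodComm ι κ)]
  rfl

theorem mean_const [Nonempty ι] (c : ℝ≥0∞) : (mean fun _ : ι => c) = c := by
  rw [mean, Finset.sum_const, Finset.card_univ, nsmul_eq_mul, ← mul_assoc,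
    ENNReal.inv_mul_cancel (by simp) (by finiteness), one_mul]

theorem mean_option (f : Option ι → ℝ≥0∞) :
    mean f = ((Fintype.card ι + 1 : ℕ) : ℝ≥0∞)⁻¹ * (f none + ∑ i, f (some i)) := by
  rw [mean, Fintype.card_option, Fintype.sum_option]

end Mean

section Marked

variable {α α' β : Type*} [Fintype α] [Fintype α'] [Fintype β] [DecidableEq α] [DecidableEq α']
  [DecidableEq β]

/-- The average, over all block permutations of `α × β`, of a function of the number of blocks on
the cycle of the block `a`, of the cycle count of the first return map to this block, and of
the cycle count outside the blocks on this cycle. -/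
def markedMean (β : Type*) [Fintype β] [DecidableEq β] (a : α)
    (F : ℕ → (ℝ → ℝ≥0∞) → (ℝ → ℝ≥0∞) → ℝ≥0∞) : ℝ≥0∞ :=
  mean fun g : α → Equiv.Perm β => mean fun h : Equiv.Perm α =>
    F (Function.minimalPeriod h a) (holCount g h a) (restCount g h a)

theorem markedMean_conj (e : α ≃ α') (a : α) (F : ℕ → (ℝ → ℝ≥0∞) → (ℝ → ℝ≥0∞) → ℝ≥0∞) :
    markedMean β (e a) F = markedMean β a F := by
  rw [markedMean, markedMean, ← mean_equiv (e.arrowCongr (Equiv.refl (Equiv.Perm β)))]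
  congr 1
  funext g
  rw [← mean_equiv e.permCongr]
  congr 1
  funext h
  change F _ (holCount (g ∘ e.symm) _ _) (restCount (g ∘ e.symm) _ _) = _
  rw [minimalPeriod_conj, holCount_conj, restCount_conj]

/-- If the permutations in the blocks are uniform, they remain so when a block is removed. -/
theorem mean_contractBlock (a : α) (Φ : (α → Equiv.Perm β) → ℝ≥0∞) :
    (mean fun G : Option α → Equiv.Perm β => Φ (contractBlock G a)) = mean Φ := by
  rw [← mean_equiv (Equiv.piOptionEquivProd (β := fun _ : Option α => Equiv.Perm β)).symm,
    mean_prod]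
  have h : ∀ g0 : Equiv.Perm β, (mean fun g : α → Equiv.Perm β => Φ (contractBlock
      ((Equiv.piOptionEquivProd (β := fun _ : Option α => Equiv.Perm β)).symm (g0, g)) a)) =
      mean Φ := fun g0 =>
    mean_equiv (Equiv.mulRight (Pi.mulSingle a g0 : α → Equiv.Perm β)) Φ
  simp only [h]
  exact mean_const _

/-- In a uniform block permutation of `α ∪ {none}`, the block `none` either is a new cycle of blocks
or is inserted before one of the blocks in `α`. -/
theorem markedMean_none (F : ℕ → (ℝ → ℝ≥0∞) → (ℝ → ℝ≥0∞) → ℝ≥0∞) :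
    markedMean β (none : Option α) F = ((Fintype.card α + 1 : ℕ) : ℝ≥0∞)⁻¹ *
      ((mean fun g0 : Equiv.Perm β => mean fun g : α → Equiv.Perm β => mean fun h : Equiv.Perm α =>
          F 1 (cycleCount g0) (cycleCount (blockPerm g h))) +
        ∑ a : α, markedMean β a fun l => F (l + 1)) := by
  rw [markedMean, mean_comm, ← mean_equiv Equiv.Perm.decomposeOption.symm, mean_prod, mean_option]
  congr 2
  · rw [mean_comm, ← mean_equiv
      (Equiv.piOptionEquivProd (β := fun _ : Option α => Equiv.Perm β)).symm, mean_prod]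
    congr 1
    funext g0
    congr 1
    funext g
    congr 1
    funext h
    have h1 : Equiv.Perm.decomposeOption.symm (none, h) = h.optionCongr := by
      ext1 x
      simp
    rw [h1, minimalPeriod_optionCongr_none, holCount_optionCongr, restCount_optionCongr]
    rfl
  · refine Finset.sum_congr rfl fun a _ => ?_
    rw [markedMean, mean_comm, ← mean_contractBlock a]
    congr 1
    funext G
    congr 1
    funext h
    change F (Function.minimalPeriod (insertBefore h a) none)
      (holCount G (insertBefore h a) none) (restCount G (insertBefore h a) none) = _
    rw [minimalPeriod_insertBefore, holCount_insertBefore, restCount_insertBefore]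

/-- The number of blocks that are not on the cycle of a marked block is uniform, the first return
map to the marked block is a uniform permutation, and what happens outside the cycle of blocks is
a uniform block permutation. -/
theorem markedMean_fin (n : ℕ) (a : Fin (n + 1)) (F : ℕ → (ℝ → ℝ≥0∞) → (ℝ → ℝ≥0∞) → ℝ≥0∞) :
    markedMean β a F = ((n + 1 : ℕ) : ℝ≥0∞)⁻¹ * ∑ i ∈ Finset.range (n + 1),
      mean fun g0 : Equiv.Perm β => mean fun g : Fin i → Equiv.Perm β =>
        mean fun h : Equiv.Perm (Fin i) =>
          F (n + 1 - i) (cycleCount g0) (cycleCount (blockPerm g h)) := by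
  induction n generalizing F with
  | zero =>
    rw [← markedMean_conj (finSuccEquiv' a) a, finSuccEquiv'_at, markedMean_none]
    simp
  | succ n ih =>
    rw [← markedMean_conj (finSuccEquiv' a) a, finSuccEquiv'_at, markedMean_none,
      Finset.sum_range_succ _ (n + 1), add_comm (mean _)]
    rw [Finset.sum_congr rfl fun a _ => ih a fun l => F (l + 1), Finset.sum_const, Finset.card_univ,
      Fintype.card_fin, nsmul_eq_mul, ← mul_assoc, ENNReal.mul_inv_cancel (by simp)
      (by finiteness), one_mul, Nat.add_sub_cancel_left]
    congr 2
    refine Finset.sum_congr rfl fun i hi => ?_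
    rw [Nat.sub_add_comm (Finset.mem_range.1 hi).le]

end Marked

/-! ### The cycle law of the wreath product is a discrete square cutting law -/

section CyclePartition

variable {α β : Type*} [Fintype α] [Fintype β]

open Classical in
/-- The sorted cycle lengths of a permutation, as proportions of the size of the set; the partition
with a single part if the set is empty. -/
def cyclePartition (σ : Equiv.Perm α) : Delta :=
  if _ : Nonempty α then sort (cycleSimplex σ) else sort whole

theorem cyclePartition_of_nonempty [h : Nonempty α] (σ : Equiv.Perm α) :
    cyclePartition σ = sort (cycleSimplex σ) := dif_pos h

theorem cyclePartition_of_isEmpty [h : IsEmpty α] (σ : Equiv.Perm α) :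
    cyclePartition σ = sort whole := dif_neg (not_nonempty_iff.2 h)

theorem partCount_cyclePartition [Nonempty α] (σ : Equiv.Perm α) {t : ℝ} (ht : 0 ≤ t) :
    partCount (cyclePartition σ).1 t = cycleCount σ (t * Fintype.card α) := by
  rw [cyclePartition_of_nonempty, Simplex.partCount_sort _ ht, partCount_cycleSimplex]

open Classical in
/-- The value of a function of partitions at the partition of `N` units that has `κ t` parts of more
than `t` units; it is `0` if there is no such partition. -/
def evalCount (N : ℕ) (f : Delta → ℝ≥0∞) (κ : ℝ → ℝ≥0∞) : ℝ≥0∞ :=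
  if h : ∃ x : Delta, ∀ t, 0 ≤ t → partCount x.1 t = κ (t * N) then f h.choose else 0

theorem evalCount_eq {N : ℕ} (f : Delta → ℝ≥0∞) {κ : ℝ → ℝ≥0∞} {x : Delta}
    (hx : ∀ t, 0 ≤ t → partCount x.1 t = κ (t * N)) : evalCount N f κ = f x := by
  have h : ∃ x : Delta, ∀ t, 0 ≤ t → partCount x.1 t = κ (t * N) := ⟨x, hx⟩
  rw [evalCount, dif_pos h]
  congr 1
  exact Delta.ext_partCount fun t ht => (h.choose_spec t ht).trans (hx t ht).symm

theorem partCount_squareStep_cyclePartition [Nonempty β] {n i : ℕ} (hi : i < n + 1)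
    (g0 : Equiv.Perm β) (σ : Equiv.Perm (Fin i × β)) {t : ℝ} (ht : 0 ≤ t) :
    partCount (squareStep (cutFraction (n + 1) i, cyclePartition g0, cyclePartition σ)).1 t =
      cycleCount g0 (t * ((n + 1) * Fintype.card β : ℕ) / (n + 1 - i : ℕ)) +
        cycleCount σ (t * ((n + 1) * Fintype.card β : ℕ)) := by
  have hn : (0 : ℝ) < ((n + 1 : ℕ) : ℝ) := Nat.cast_pos.2 n.succ_pos
  have hni : (0 : ℝ) < ((n + 1 - i : ℕ) : ℝ) := Nat.cast_pos.2 (by omega)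
  have hu : (cutFraction (n + 1) i : ℝ) = ((n + 1 - i : ℕ) : ℝ) / ((n + 1 : ℕ) : ℝ) := by
    rw [coe_cutFraction hi.le, Nat.cast_sub hi.le]
  rw [partCount_squareStep _ _ _ ht, one_sub_cutFraction n.succ_ne_zero hi.le, hu]
  congr 1
  · rw [partCount_const_mul _ (div_pos hni hn), partCount_cyclePartition _ (by positivity)]
    congr 1
    push_cast
    field_simp
  · rcases Nat.eq_zero_or_pos i with rfl | hi0
    · rw [partCount_of_le_zero (by simp) ht, cycleCount, Finset.univ_eq_empty, Finset.sum_empty]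
    · have : Nonempty (Fin i) := ⟨⟨0, hi0⟩⟩
      have hi' : (0 : ℝ) < i := Nat.cast_pos.2 hi0
      rw [partCount_const_mul _ (div_pos hi' hn), partCount_cyclePartition _ (by positivity)]
      congr 1
      rw [Fintype.card_prod, Fintype.card_fin]
      push_cast
      field_simp

variable [DecidableEq β]

/-- If `Q` is the law of the cycle lengths of a uniform permutation of `β`, then `discreteLaw Q n`
is the law of the cycle lengths of a uniform block permutation of `n` blocks. -/
theorem mean_cyclePartition_blockPerm [Nonempty β] {Q : Measure Delta} [IsProbabilityMeasure Q]
    (hQ : ∀ f : Delta → ℝ≥0∞, Measurable f →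
      (mean fun g : Equiv.Perm β => f (cyclePartition g)) = ∫⁻ s, f s ∂Q)
    (n : ℕ) {f : Delta → ℝ≥0∞} (hf : Measurable f) :
    (mean fun g : Fin n → Equiv.Perm β => mean fun h : Equiv.Perm (Fin n) =>
      f (cyclePartition (blockPerm g h))) = ∫⁻ x, f x ∂discreteLaw Q n := by
  induction n using Nat.strong_induction_on generalizing f with
  | _ n ih =>
    cases n with
    | zero =>
      simp only [cyclePartition_of_isEmpty]
      rw [discreteLaw, lintegral_dirac' _ hf, mean_const, mean_const]
    | succ n =>
      have h1 : (mean fun g : Fin (n + 1) → Equiv.Perm β => mean fun h : Equiv.Perm (Fin (n + 1)) =>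
          f (cyclePartition (blockPerm g h))) = markedMean β (0 : Fin (n + 1)) fun l κ κ' =>
            evalCount ((n + 1) * Fintype.card β) f fun t => κ (t / l) + κ' t := by
        rw [markedMean]
        congr 1
        funext g
        congr 1
        funext h
        rw [evalCount_eq f (x := cyclePartition (blockPerm g h))]
        intro t ht
        rw [partCount_cyclePartition _ ht, cycleCount_blockPerm g h 0, Fintype.card_prod,
          Fintype.card_fin]
      rw [h1, markedMean_fin, lintegral_discreteLaw n.succ_ne_zero hf]
      congr 1
      refine Finset.sum_congr rfl fun i hi => ?_
      have hi := Finset.mem_range.1 hi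
      have hm : Measurable fun p : Delta × Delta =>
          f (squareStep (cutFraction (n + 1) i, p.1, p.2)) :=
        hf.comp (measurable_squareStep_right _)
      rw [← hQ _ (Measurable.lintegral_prod_right' hm)]
      congr 1
      funext g0
      have hm' : Measurable fun y => f (squareStep (cutFraction (n + 1) i, cyclePartition g0, y)) :=
        Measurable.comp (f := fun y => (cyclePartition g0, y)) hm measurable_prodMk_left
      refine Eq.trans ?_ (ih i hi hm')
      congr 1
      funext g
      congr 1
      funext h
      exact evalCount_eq f fun t ht => partCount_squareStep_cyclePartition hi _ _ ht

end CyclePartition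

/-- The law of the cycle lengths, divided by `k`, of a uniform permutation of `k` points, as
a discrete stick-breaking law; see `mean_cyclePartition_perm`. -/
def permLaw (k : ℕ) : Measure Delta := discreteLaw (Measure.dirac (sort whole)) k

instance (k : ℕ) : IsProbabilityMeasure (permLaw k) := by unfold permLaw; infer_instance

theorem mean_cyclePartition_unit {f : Delta → ℝ≥0∞} (hf : Measurable f) :
    (mean fun g : Equiv.Perm Unit => f (cyclePartition g)) =
      ∫⁻ s, f s ∂Measure.dirac (sort whole) := by
  have h : ∀ g : Equiv.Perm Unit, cyclePartition g = sort whole := by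
    intro g
    refine Delta.ext_partCount fun t ht => ?_
    have hg : Function.minimalPeriod g () = 1 :=
      Function.minimalPeriod_eq_one_iff_isFixedPt.2 rfl
    rw [partCount_cyclePartition g ht, partCount_sort_whole ht, cycleCount]
    simp [hg, periodWeight]
  simp only [h]
  rw [mean_const, lintegral_dirac' _ hf]

theorem mean_cyclePartition_perm (k : ℕ) [NeZero k] {f : Delta → ℝ≥0∞} (hf : Measurable f) :
    (mean fun g : Equiv.Perm (Fin k) => f (cyclePartition g)) = ∫⁻ s, f s ∂permLaw k := by
  have : Nonempty (Fin k) := ⟨0⟩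
  -- permutations of `k` points are block permutations of `k` blocks with a single point
  rw [permLaw, ← mean_cyclePartition_blockPerm (β := Unit) (fun f hf => mean_cyclePartition_unit hf)
    k hf]
  have h : ∀ (g : Fin k → Equiv.Perm Unit) (h : Equiv.Perm (Fin k)),
      cyclePartition (blockPerm g h) = cyclePartition h := by
    intro g h
    refine Delta.ext_partCount fun t ht => ?_
    rw [partCount_cyclePartition _ ht, partCount_cyclePartition _ ht,
      cycleCount_conj (Equiv.prodPUnit (Fin k)) (f := blockPerm g h) (f' := h) fun _ => rfl]
    simp
  simp only [h]
  rw [mean_const]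

theorem lintegral_cycleLaw (k n : ℕ) [NeZero k] [NeZero n] {f : Delta → ℝ≥0∞}
    (hf : Measurable f) : ∫⁻ x, f x ∂cycleLaw k n =
      mean fun w : Wreath k n => f (sort (cycleSimplex (Wreath.toPerm k n w))) := by
  let _ : MeasurableSpace (Wreath k n) := ⊤
  have : MeasurableSingletonClass (Wreath k n) := ⟨fun _ => trivial⟩
  rw [cycleLaw, ← PMF.toMeasure_map (hf := measurable_from_top),
    lintegral_map hf measurable_from_top, lintegral_fintype, mean, Finset.mul_sum]
  refine Finset.sum_congr rfl fun w _ => ?_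
  rw [PMF.toMeasure_apply_singleton _ _ (measurableSet_singleton w), PMF.uniformOfFintype_apply,
    mul_comm]

/-- The cycle lengths of a uniform element of the wreath product are cut from `n` blocks like the
cycles of a uniform permutation of the blocks, and each cycle of blocks is further cut like
the cycles of a uniform permutation of `k` points. -/
theorem cycleLaw_eq_discreteLaw (k n : ℕ) [NeZero k] [NeZero n] :
    cycleLaw k n = discreteLaw (permLaw k) n := by
  have hn : Nonempty (Fin n) := ⟨0⟩
  have hk : Nonempty (Fin k) := ⟨0⟩
  have key : ∀ f : Delta → ℝ≥0∞, Measurable f →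
      ∫⁻ x, f x ∂cycleLaw k n = ∫⁻ x, f x ∂discreteLaw (permLaw k) n := by
    intro f hf
    rw [lintegral_cycleLaw k n hf, ← mean_cyclePartition_blockPerm
      (fun f hf => mean_cyclePartition_perm k hf) n hf,
      ← mean_equiv SemidirectProduct.equivProd.symm, mean_prod]
    congr 1
    funext g
    congr 1
    funext h
    rw [cyclePartition_of_nonempty]
    rfl
  ext s hs
  rw [← lintegral_indicator_one hs, ← lintegral_indicator_one hs]
  exact key _ (measurable_one.indicator hs)

/-! ### The two forms of the Wasserstein distance and couplings -/

section Wasserstein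

variable {d : (Delta → Delta → ℝ) → Measure Delta → Measure Delta → ℝ} {ρ : Delta → Delta → ℝ}

theorem integrable_cost (hρ : Measurable fun p : Delta × Delta => ρ p.1 p.2)
    (h0 : ∀ x y, 0 ≤ ρ x y) {C : ℝ} (hC : ∀ x y, ρ x y ≤ C) (γ : Measure (Delta × Delta))
    [IsProbabilityMeasure γ] : Integrable (fun p : Delta × Delta => ρ p.1 p.2) γ :=
  integrable_of_abs_sub_le hρ (C := C) fun p q => abs_sub_le_iff.2
    ⟨by linarith [hC p.1 p.2, h0 q.1 q.2], by linarith [hC q.1 q.2, h0 p.1 p.2]⟩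

theorem dist_le_of_coupling (hd : d = dualDist ∨ d = transportDist)
    (hρ : Measurable fun p : Delta × Delta => ρ p.1 p.2) (h0 : ∀ x y, 0 ≤ ρ x y) {C : ℝ}
    (hC : ∀ x y, ρ x y ≤ C) (γ : Measure (Delta × Delta)) [IsProbabilityMeasure γ] :
    d ρ (γ.map Prod.fst) (γ.map Prod.snd) ≤ ∫ p, ρ p.1 p.2 ∂γ := by
  rcases hd with rfl | rfl
  · refine csSup_le ⟨0, fun _ => 0, continuous_const, by simpa using h0, by simp⟩ ?_
    rintro c ⟨f, hf, hfρ, rfl⟩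
    exact (le_abs_self _).trans
      (integral_sub_le_of_coupling (integrable_cost hρ h0 hC γ) hC hf.measurable hfρ)
  · refine csInf_le ⟨0, ?_⟩ ⟨γ, rfl, rfl, rfl⟩
    rintro c ⟨γ', -, -, rfl⟩
    exact integral_nonneg fun p => h0 _ _

/-- The existence of a coupling matters: the infimum of the empty set is `0`. -/
theorem le_dist_of_lipschitz (hd : d = dualDist ∨ d = transportDist)
    (hρ : Measurable fun p : Delta × Delta => ρ p.1 p.2) (h0 : ∀ x y, 0 ≤ ρ x y) {C : ℝ}
    (hC : ∀ x y, ρ x y ≤ C) (γ : Measure (Delta × Delta)) [IsProbabilityMeasure γ] {f : Delta → ℝ}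
    (hf : Continuous f) (hfρ : ∀ x y, |f x - f y| ≤ ρ x y) :
    ∫ x, f x ∂γ.map Prod.fst - ∫ x, f x ∂γ.map Prod.snd ≤
      d ρ (γ.map Prod.fst) (γ.map Prod.snd) := by
  rcases hd with rfl | rfl
  · refine le_csSup ⟨∫ p, ρ p.1 p.2 ∂γ, ?_⟩ ⟨f, hf, hfρ, rfl⟩
    rintro c ⟨g, hg, hgρ, rfl⟩
    exact (le_abs_self _).trans
      (integral_sub_le_of_coupling (integrable_cost hρ h0 hC γ) hC hg.measurable hgρ)
  · refine le_csInf ⟨_, γ, rfl, rfl, rfl⟩ ?_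
    rintro c ⟨γ', h1, h2, rfl⟩
    have : IsProbabilityMeasure γ' := by
      refine ⟨?_⟩
      rw [← Set.preimage_univ (f := Prod.fst),
        ← Measure.map_apply measurable_fst MeasurableSet.univ, h1,
        Measure.map_apply measurable_fst MeasurableSet.univ, Set.preimage_univ, measure_univ]
    rw [← h1, ← h2]
    exact (le_abs_self _).trans
      (integral_sub_le_of_coupling (integrable_cost hρ h0 hC γ') hC hf.measurable hfρ)

end Wasserstein

/-! ### Existence and uniqueness of the limit laws -/

theorem isStickBreaking_iff {μ : Measure Delta} :
    IsStickBreaking μ ↔ IsSquareCutting (Measure.dirac (sort whole)) μ := by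
  refine and_congr_right fun hμ => ?_
  have h : stickStep = squareStep ∘ fun p : unitInterval × Delta => (p.1, sort whole, p.2) :=
    funext fun p => stickStep_eq_squareStep p.1 p.2
  have hm : Measurable fun p : unitInterval × Delta => (p.1, sort whole, p.2) := by fun_prop
  rw [h, ← Measure.map_map measurable_squareStep hm]
  have h2 : ((volume : Measure unitInterval).prod μ).map (fun p => (p.1, sort whole, p.2)) =
      (volume : Measure unitInterval).prod ((Measure.dirac (sort whole)).prod μ) := by
    rw [Measure.dirac_prod]
    conv_rhs => rw [← Measure.map_id (μ := (volume : Measure unitInterval))]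
    rw [Measure.map_prod_map _ _ measurable_id measurable_prodMk_left]
    rfl
  rw [h2]

theorem isStickBreaking_map_stickPartition :
    IsStickBreaking ((pathLaw (Measure.dirac ())).map stickPartition) := by
  have h := isSquareCutting_map_limitPartition (Measure.dirac ()) (z := fun _ => sort whole)
    measurable_const
  rw [Measure.map_const, measure_univ, one_smul] at h
  exact isStickBreaking_iff.2 h

theorem IsStickBreaking.unique {μ μ' : Measure Delta} (hμ : IsStickBreaking μ)
    (hμ' : IsStickBreaking μ') : μ = μ' :=
  (isStickBreaking_iff.1 hμ).unique (isStickBreaking_iff.1 hμ')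

theorem IsStickBreaking.eq_map {μ : Measure Delta} (hμ : IsStickBreaking μ) :
    μ = (pathLaw (Measure.dirac ())).map stickPartition :=
  hμ.unique isStickBreaking_map_stickPartition

theorem isSquareCutting_map_squarePartition {μ : Measure Delta} (hμ : IsStickBreaking μ) :
    IsSquareCutting μ ((pathLaw (pathLaw (Measure.dirac ()))).map squarePartition) := by
  rw [hμ.eq_map]
  exact isSquareCutting_map_limitPartition _ measurable_stickPartition

/-! ### The coupling of the cycles of the wreath product with square cutting -/

/-- The discrete version of `stickPartition`, for a stick of `k` units. -/
def permPartition (k : ℕ) : Path Unit → Delta := discretePartition (fun _ => sort whole) k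

/-- The discrete version of `squarePartition`, for a stick of `n` units of `k` units each. -/
def wreathPartition (k n : ℕ) : Path (Path Unit) → Delta := discretePartition (permPartition k) n

theorem measurable_permPartition (k : ℕ) : Measurable (permPartition k) :=
  measurable_discretePartition measurable_const _

theorem measurable_wreathPartition (k n : ℕ) : Measurable (wreathPartition k n) :=
  measurable_discretePartition (measurable_permPartition k) _

theorem map_permPartition (k : ℕ) :
    (pathLaw (Measure.dirac ())).map (permPartition k) = permLaw k := by
  rw [permPartition, map_discretePartition _ measurable_const k (Nat.cast_nonneg k)
    (Nat.floor_natCast k), Measure.map_const, measure_univ, one_smul, permLaw]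

theorem map_wreathPartition (k n : ℕ) [NeZero k] [NeZero n] :
    (pathLaw (pathLaw (Measure.dirac ()))).map (wreathPartition k n) = cycleLaw k n := by
  rw [wreathPartition, map_discretePartition _ (measurable_permPartition k) n (Nat.cast_nonneg n)
    (Nat.floor_natCast n), map_permPartition, cycleLaw_eq_discreteLaw]

/-- The joint law of the discrete and of the continuous square-cutting partitions that use the same
breaks. -/
def squareCoupling (k n : ℕ) : Measure (Delta × Delta) :=
  (pathLaw (pathLaw (Measure.dirac ()))).map fun ω => (wreathPartition k n ω, squarePartition ω)

theorem measurable_squareCoupling (k n : ℕ) :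
    Measurable fun ω => (wreathPartition k n ω, squarePartition ω) :=
  (measurable_wreathPartition k n).prodMk measurable_squarePartition

instance (k n : ℕ) : IsProbabilityMeasure (squareCoupling k n) :=
  Measure.isProbabilityMeasure_map (measurable_squareCoupling k n).aemeasurable

theorem map_fst_squareCoupling (k n : ℕ) [NeZero k] [NeZero n] :
    (squareCoupling k n).map Prod.fst = cycleLaw k n := by
  rw [squareCoupling, Measure.map_map measurable_fst (measurable_squareCoupling k n),
    ← map_wreathPartition]
  rfl

theorem map_snd_squareCoupling (k n : ℕ) : (squareCoupling k n).map Prod.snd =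
    (pathLaw (pathLaw (Measure.dirac ()))).map squarePartition := by
  rw [squareCoupling, Measure.map_map measurable_snd (measurable_squareCoupling k n)]
  rfl

/-- What holds for almost every mark holds almost surely for all marks of a path. -/
theorem ae_forall_mark {Θ : Type*} [MeasurableSpace Θ] {P : Measure Θ} [IsProbabilityMeasure P]
    {p : Θ → Prop} (h : ∀ᵐ θ ∂P, p θ) : ∀ᵐ ω ∂pathLaw P, ∀ j, p (ω j).2 := by
  refine ae_all_iff.2 fun j => ?_
  exact (measurePreserving_eval_infinitePi (fun _ : ℕ => stepLaw P) j).quasiMeasurePreserving.ae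
    (Measure.quasiMeasurePreserving_snd.ae h)

theorem ae_distSup_permPartition_le (k : ℕ) [NeZero k] : ∀ᵐ ω ∂pathLaw (Measure.dirac ()),
    distSup (permPartition k ω) (stickPartition ω) ≤ 1 / k := by
  filter_upwards [ae_tendsto_remaining (Measure.dirac ())] with ω hω
  have h := distSup_discretePartition_le (z := fun _ => sort whole) (z' := fun _ => sort whole)
    (NeZero.ne k) le_rfl hω fun j => by simp [distSup]
  rwa [add_zero] at h

theorem ae_distSup_wreathPartition_le (k n : ℕ) [NeZero k] [NeZero n] :
    ∀ᵐ ω ∂pathLaw (pathLaw (Measure.dirac ())),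
      distSup (wreathPartition k n ω) (squarePartition ω) ≤ 1 / k + 1 / n := by
  filter_upwards [ae_tendsto_remaining (pathLaw (Measure.dirac ())),
    ae_forall_mark (ae_distSup_permPartition_le k)] with ω hω hz
  rw [add_comm]
  exact distSup_discretePartition_le (NeZero.ne n) (by positivity) hω hz

theorem integral_distSup_squareCoupling_le (k n : ℕ) [NeZero k] [NeZero n] :
    ∫ p, distSup p.1 p.2 ∂squareCoupling k n ≤ 1 / k + 1 / n := by
  have h : ∀ᵐ p ∂squareCoupling k n, distSup p.1 p.2 ≤ 1 / k + 1 / n :=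
    (ae_map_iff (measurable_squareCoupling k n).aemeasurable
      (measurableSet_le measurable_distSup measurable_const)).2 (ae_distSup_wreathPartition_le k n)
  have := integral_mono_ae (integrable_cost measurable_distSup distSup_nonneg distSup_le_one _)
    (integrable_const _) h
  simpa using this

theorem lintegral_distOne_permPartition_le (k : ℕ) [NeZero k] :
    ∫⁻ ω, ENNReal.ofReal (distOne (permPartition k ω) (stickPartition ω))
      ∂pathLaw (Measure.dirac ()) ≤ ENNReal.ofReal (2 * harmonic k / k) := by
  have h := lintegral_distOne_discretePartition_le (Measure.dirac ()) (z := fun _ => sort whole)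
    (z' := fun _ => sort whole) measurable_const measurable_const (NeZero.ne k)
  have h0 : distOne (sort whole) (sort whole) = 0 := by simp [distOne]
  simp only [h0, ENNReal.ofReal_zero, lintegral_zero, add_zero] at h
  exact h

theorem integral_distOne_squareCoupling_le (k n : ℕ) [NeZero k] [NeZero n] :
    ∫ p, distOne p.1 p.2 ∂squareCoupling k n ≤ 2 * harmonic k / k + 2 * harmonic n / n := by
  have hk : (0 : ℝ) ≤ 2 * harmonic k / k := by have := harmonic_cast_nonneg k; positivity
  have hn : (0 : ℝ) ≤ 2 * harmonic n / n := by have := harmonic_cast_nonneg n; positivity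
  rw [integral_eq_lintegral_of_nonneg_ae (Filter.Eventually.of_forall fun p => distOne_nonneg _ _)
    measurable_distOne.aestronglyMeasurable]
  refine ENNReal.toReal_le_of_le_ofReal (by positivity) ?_
  rw [squareCoupling, lintegral_map measurable_distOne.ennreal_ofReal
    (measurable_squareCoupling k n), add_comm, ENNReal.ofReal_add hn hk]
  exact (lintegral_distOne_discretePartition_le _ measurable_stickPartition
    (measurable_permPartition k) (NeZero.ne n)).trans
      (add_le_add le_rfl (lintegral_distOne_permPartition_le k))

/-- Since `H_n ≤ 1 + log n` and `γ > 1 / 2`, the difference `3 (log n + γ) - 2 H_n` is positive for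
`n ≥ 2`; the error term is needed only for `n = 1`. -/
theorem two_mul_harmonic_div_le (n : ℕ) [NeZero n] : 2 * (harmonic n : ℝ) / n ≤
    3 * (Real.log n + Real.eulerMascheroniConstant) / n + 1 / (n : ℝ) ^ 2 := by
  have hn : (1 : ℝ) ≤ n := Nat.one_le_cast.2 (NeZero.pos n)
  have hγ := Real.one_half_lt_eulerMascheroniConstant
  have h1 := harmonic_le_one_add_log n
  have key : 2 * (harmonic n : ℝ) ≤
      3 * (Real.log n + Real.eulerMascheroniConstant) + 1 / (n : ℝ) := by
    have h0 : 0 ≤ 1 / (n : ℝ) := by positivity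
    rcases Nat.lt_or_ge n 2 with h | h
    · have : n = 1 := by have := NeZero.pos n; omega
      subst this
      norm_num [harmonic_succ]
      linarith
    · have h2 : Real.log 2 ≤ Real.log n :=
        Real.log_le_log two_pos (by exact_mod_cast h)
      linarith [Real.log_two_gt_d9]
  calc 2 * (harmonic n : ℝ) / n
      ≤ (3 * (Real.log n + Real.eulerMascheroniConstant) + 1 / (n : ℝ)) / n := by gcongr
    _ = _ := by field_simp

/-! ### The lower bound: cycle lengths are integers -/

theorem lintegral_intDist_cycleLaw (k n : ℕ) [NeZero k] [NeZero n] :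
    ∫⁻ x, ∑' i, ENNReal.ofReal (intDist (((k : ℝ) * n) * x.1 i)) ∂cycleLaw k n = 0 := by
  have hm : Measurable fun x : Delta =>
      ∑' i, ENNReal.ofReal (intDist (((k : ℝ) * n) * x.1 i)) :=
    Measurable.tsum fun i => measurable_ofReal_intDist.comp ((measurable_coord i).const_mul _)
  rw [lintegral_cycleLaw k n hm]
  have h : ∀ w : Wreath k n, ∑' i, ENNReal.ofReal (intDist (((k : ℝ) * n) *
      (sort (cycleSimplex (Wreath.toPerm k n w))).1 i)) = 0 := by
    intro w
    rw [Simplex.tsum_comp_rankEntry _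
      (g := fun y => ENNReal.ofReal (intDist (((k : ℝ) * n) * y))) (by simp [intDist])]
    refine ENNReal.tsum_eq_zero.2 fun q => ?_
    have hkn : (k : ℝ) * n ≠ 0 :=
      mul_ne_zero (Nat.cast_ne_zero.2 (NeZero.ne k)) (Nat.cast_ne_zero.2 (NeZero.ne n))
    have hc : (Nat.card (Fin n × Fin k) : ℝ) = k * n := by
      rw [Nat.card_prod, Nat.card_fin, Nat.card_fin, Nat.cast_mul, mul_comm]
    rw [cycleSimplex]
    dsimp only
    rw [hc, mul_div_cancel₀ _ hkn, ← Int.cast_natCast, intDist_intCast, ENNReal.ofReal_zero]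
  simp only [h]
  exact mean_const 0

theorem sum_abs_sub_le_distOne (x y : Delta) (s : Finset ℕ) :
    ∑ i ∈ s, |x.1 i - y.1 i| ≤ distOne x y :=
  (Simplex.summable_abs_sub x.toSimplex y.toSimplex).sum_le_tsum s fun _ _ => abs_nonneg _

/-- The sum of the distances of `M x₀, …, M x_{N-1}` from the integers, divided by `M`, is
`1`-Lipschitz for the `L¹` distance. -/
theorem abs_sum_intDist_div_sub_le {M : ℝ} (hM : 0 < M) (N : ℕ) (x y : Delta) :
    |-(∑ i ∈ Finset.range N, intDist (M * x.1 i)) / M -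
      -(∑ i ∈ Finset.range N, intDist (M * y.1 i)) / M| ≤ distOne x y := by
  refine le_trans ?_ (sum_abs_sub_le_distOne x y (Finset.range N))
  rw [← sub_div, neg_sub_neg, ← Finset.sum_sub_distrib, abs_div, abs_of_pos hM, div_le_iff₀ hM,
    Finset.sum_mul]
  refine (Finset.abs_sum_le_sum_abs _ _).trans (Finset.sum_le_sum fun i _ => ?_)
  refine (abs_intDist_sub_le _ _).trans ?_
  rw [← mul_sub, abs_mul, abs_of_pos hM, abs_sub_comm, mul_comm]

theorem continuous_sum_intDist (M : ℝ) (N : ℕ) :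
    Continuous fun x : Delta => ∑ i ∈ Finset.range N, intDist (M * x.1 i) :=
  continuous_finsetSum _ fun i _ => continuous_intDist.comp
    (continuous_const.mul ((continuous_apply i).comp continuous_subtype_val))

theorem measurable_ofReal_intDist_mul_coord (M : ℝ) (i : ℕ) :
    Measurable fun x : Delta => ENNReal.ofReal (intDist (M * x.1 i)) :=
  measurable_ofReal_intDist.comp ((measurable_coord i).const_mul M)

theorem integral_sum_intDist (μ : Measure Delta) (M : ℝ) (N : ℕ) :
    ∫ x, ∑ i ∈ Finset.range N, intDist (M * x.1 i) ∂μ =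
      (∑ i ∈ Finset.range N, ∫⁻ x, ENNReal.ofReal (intDist (M * x.1 i)) ∂μ).toReal := by
  rw [integral_eq_lintegral_of_nonneg_ae (Filter.Eventually.of_forall fun x =>
    Finset.sum_nonneg fun i _ => intDist_nonneg _)
    (continuous_sum_intDist M N).measurable.aestronglyMeasurable,
    ← lintegral_finsetSum _ fun i _ => measurable_ofReal_intDist_mul_coord M i]
  simp only [ENNReal.ofReal_sum_of_nonneg fun i _ => intDist_nonneg _]

/-- The lower bound for the distance `d`, from the test functions `-(∑_{i<N} dist(M xᵢ, ℤ)) / M`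
with `M = k n`. -/
theorem log_sq_div_le_dist {d : (Delta → Delta → ℝ) → Measure Delta → Measure Delta → ℝ}
    (hd : d = dualDist ∨ d = transportDist) (k n : ℕ) [NeZero k] [NeZero n] :
    Real.log ((k : ℝ) * n) ^ 2 / (8 * ((k : ℝ) * n)) ≤ d distOne (cycleLaw k n)
      ((pathLaw (pathLaw (Measure.dirac ()))).map squarePartition) := by
  have hM1 : (1 : ℝ) ≤ (k : ℝ) * n := one_le_mul_of_one_le_of_one_le
    (Nat.one_le_cast.2 (NeZero.pos k)) (Nat.one_le_cast.2 (NeZero.pos n))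
  have hlow := log_sq_le_lintegral_squarePartition hM1
  have hzero := lintegral_intDist_cycleLaw k n
  obtain ⟨M, hM⟩ : ∃ M : ℝ, (k : ℝ) * n = M := ⟨_, rfl⟩
  rw [hM] at hM1 hlow hzero ⊢
  have hM0 : 0 < M := by linarith
  have hmeas := measurable_ofReal_intDist_mul_coord M
  have hle := fun (f : Delta → ℝ) (hf : Continuous f) (h : ∀ x y, |f x - f y| ≤ distOne x y) =>
    le_dist_of_lipschitz hd measurable_distOne distOne_nonneg distOne_le_two (squareCoupling k n)
      hf h
  rw [map_fst_squareCoupling, map_snd_squareCoupling] at hle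
  obtain ⟨ν, hν⟩ : ∃ ν, (pathLaw (pathLaw (Measure.dirac ()))).map squarePartition = ν := ⟨_, rfl⟩
  have hνp : IsProbabilityMeasure ν :=
    hν ▸ Measure.isProbabilityMeasure_map measurable_squarePartition.aemeasurable
  have hlow' : ENNReal.ofReal (Real.log M ^ 2 / 8) ≤
      ∑' i, ∫⁻ x, ENNReal.ofReal (intDist (M * x.1 i)) ∂ν := by
    rw [← lintegral_tsum fun i => (hmeas i).aemeasurable, ← hν,
      lintegral_map (Measurable.tsum hmeas) measurable_squarePartition]
    exact hlow
  rw [lintegral_tsum fun i => (hmeas i).aemeasurable] at hzero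
  rw [hν] at hle ⊢
  have hd0 : 0 ≤ d distOne (cycleLaw k n) ν := by
    have := hle (fun _ => 0) continuous_const fun x y => by simpa using distOne_nonneg x y
    simpa using this
  have hup : ∑' i, ∫⁻ x, ENNReal.ofReal (intDist (M * x.1 i)) ∂ν ≤
      ENNReal.ofReal (M * d distOne (cycleLaw k n) ν) := by
    refine ENNReal.tsum_le_of_sum_range_le fun N => ?_
    have h := hle _ ((continuous_sum_intDist M N).neg.div_const M)
      (abs_sum_intDist_div_sub_le hM0 N)
    simp only [Pi.neg_apply] at h
    rw [integral_div, integral_div, integral_neg, integral_neg, integral_sum_intDist,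
      integral_sum_intDist, Finset.sum_eq_zero fun i _ => ENNReal.tsum_eq_zero.1 hzero i,
      ENNReal.toReal_zero, neg_zero, zero_div, zero_sub, neg_div, neg_neg, div_le_iff₀' hM0] at h
    refine ENNReal.le_ofReal_iff_toReal_le ?_ (by positivity) |>.2 h
    refine (ENNReal.sum_lt_top.2 fun i _ => ?_).ne
    refine lt_of_le_of_lt (lintegral_mono (g := fun _ => 1) fun x => ?_) (by simp)
    rw [← ENNReal.ofReal_one]
    refine ENNReal.ofReal_le_ofReal ?_
    linarith [show intDist (M * x.1 i) ≤ 1 / 2 from abs_sub_round _]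
  have hfin := (ENNReal.ofReal_le_ofReal_iff (by positivity)).1 (hlow'.trans hup)
  rw [div_le_iff₀ (by positivity)]
  linarith

end SquareCutting

end

theorem theorem1p1 :
    (∃! μ : MeasureTheory.Measure SquareCutting.Delta, SquareCutting.IsStickBreaking μ) ∧
    (∀ μ : MeasureTheory.Measure SquareCutting.Delta, SquareCutting.IsStickBreaking μ →
      ∃! ν : MeasureTheory.Measure SquareCutting.Delta, SquareCutting.IsSquareCutting μ ν) ∧
    ∃ K : ℝ, ∀ μ ν : MeasureTheory.Measure SquareCutting.Delta,
      SquareCutting.IsStickBreaking μ → SquareCutting.IsSquareCutting μ ν →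
      ∀ (k n : ℕ) [NeZero k] [NeZero n],
      ∀ d, (d = SquareCutting.dualDist ∨ d = SquareCutting.transportDist) →
        d SquareCutting.distSup (SquareCutting.cycleLaw k n) ν ≤ 1 / (k : ℝ) + 1 / (n : ℝ) ∧
        Real.log ((k : ℝ) * n) ^ 2 / (8 * ((k : ℝ) * n)) ≤
          d SquareCutting.distOne (SquareCutting.cycleLaw k n) ν ∧
        d SquareCutting.distOne (SquareCutting.cycleLaw k n) ν ≤
          3 * (Real.log k + Real.eulerMascheroniConstant) / k +
          3 * (Real.log n + Real.eulerMascheroniConstant) / n +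
          K * (1 / (k : ℝ) ^ 2 + 1 / (n : ℝ) ^ 2) := by
  refine ⟨⟨_, SquareCutting.isStickBreaking_map_stickPartition,
    fun μ' hμ' => hμ'.eq_map⟩, fun μ hμ => ?_, 1, ?_⟩
  · have := hμ.1
    exact ⟨_, SquareCutting.isSquareCutting_map_squarePartition hμ, fun ν' hν' =>
      hν'.unique (SquareCutting.isSquareCutting_map_squarePartition hμ)⟩
  · intro μ ν hμ hν k n _ _ d hd
    have := hμ.1
    rw [hν.unique (SquareCutting.isSquareCutting_map_squarePartition hμ)]
    refine ⟨?_, SquareCutting.log_sq_div_le_dist hd k n, ?_⟩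
    · rw [← SquareCutting.map_fst_squareCoupling, ← SquareCutting.map_snd_squareCoupling k n]
      exact (SquareCutting.dist_le_of_coupling hd SquareCutting.measurable_distSup
        SquareCutting.distSup_nonneg SquareCutting.distSup_le_one _).trans
        (SquareCutting.integral_distSup_squareCoupling_le k n)
    · rw [← SquareCutting.map_fst_squareCoupling, ← SquareCutting.map_snd_squareCoupling k n]
      refine (SquareCutting.dist_le_of_coupling hd SquareCutting.measurable_distOne
        SquareCutting.distOne_nonneg SquareCutting.distOne_le_two _).trans ?_
      refine (SquareCutting.integral_distOne_squareCoupling_le k n).trans ?_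
      linarith [SquareCutting.two_mul_harmonic_div_le k, SquareCutting.two_mul_harmonic_div_le n]
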